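/- Let $\gamma>1$, $\mu\ge 0$, $\lambda\ge 0$ and $p(u)=u^{-\gamma}/\gamma$. Let $C^1_b(\mathbb R)$ be the set of bounded continuously differentiable functions on $\mathbb R$ with bounded derivative. For $\varepsilon>0$ and $\varphi,\psi\in C^1_b(\mathbb R)$ consider the Cauchy problem $$u_t-v_x=0,\qquad v_t+p(u)_x=-\frac{\lambda}{(1+t)^{\mu}}\,v,\qquad (u,v)(0,x)=(1+\varepsilon\varphi(x),\ \varepsilon\psi(x)),\qquad x\in\mathbb R,\ t\ge 0,$$ for $C^1$ solutions with $u>0$. The lifespan $T^*\in[0,\infty]$ is the supremum of all $T>0$ such that a $C^1$ solution exists on $[0,T)\times\mathbb R$ with $$\sup_{t\in[0,T)}\Big(\|(u,v)(t)\|_{L^\infty}+\|(u_t,v_t)(t)\|_{L^\infty}+\|(u_x,v_x)(t)\|_{L^\infty}+\|p'(u(t))\|_{L^\infty}\Big)<\infty .$$ (The supremum of the empty set is understood to lie below every positive number.) **Theorem.** Suppose that $\lim_{x\to-\infty}(\varphi(x),\psi(x))=(\varphi_-,\psi_-)$ for some $(\varphi_-,\psi_-)\in\mathbb R^2$. Then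 there exist $\varepsilon_0>0$ and $C>0$, depending on $\gamma,\mu,\lambda,\varphi,\psi$ but not on $\varepsilon$, such that for all $0<\varepsilon\le\varepsilon_0$: - $T^*\ge C\varepsilon^{-1}$ if $\mu>1$ (and $\lambda\ge0$); - $T^*\ge C\varepsilon^{-2/(2-\lambda)}$ if $\mu=1$ and $0\le\lambda<2$; - $T^*\ge e^{C/\varepsilon}$ if $\mu=1$ and $\lambda=2$; - $T^*=\infty$ if $0\le\mu<1$ and $\lambda>0$, or if $\mu=1$ and $\lambda>2$. -/

import Mathlib

open Set Filter Topology

namespace DampedEuler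

noncomputable section

/-- The class `C¹_b(ℝ)`: continuously differentiable, bounded, with bounded derivative. -/
def IsC1b (f : ℝ → ℝ) : Prop :=
  ContDiff ℝ 1 f ∧ (∃ M : ℝ, ∀ x, |f x| ≤ M) ∧ ∃ M : ℝ, ∀ x, |deriv f x| ≤ M

/-- The pressure law `p(u) = u^{-γ} / γ` (used for `u > 0` only). -/
def pressure (γ u : ℝ) : ℝ := u ^ (-γ) / γ

/-- The partial derivative `f_t(t, x)` of a function on `[0, T) × ℝ`; it is one-sided at `t = 0`. -/
def dt (T : ℝ) (f : ℝ → ℝ → ℝ) (t x : ℝ) : ℝ := derivWithin (fun τ => f τ x) (Ico 0 T) t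

/-- The partial derivative `f_x(t, x)`. -/
def dx (f : ℝ → ℝ → ℝ) (t x : ℝ) : ℝ := deriv (fun y => f t y) x

/-- `(u, v)` is a classical solution, on `[0, T) × ℝ`, of the Cauchy problem
`u_t - v_x = 0`, `v_t + p(u)_x = - lam / (1 + t)^mu * v`, `(u, v)(0, ·) = (u₀, v₀)`:
it is `C¹` up to `t = 0`, the specific volume `u` is positive, and the equations hold pointwise. -/
structure IsSolution (γ mu lam : ℝ) (u₀ v₀ : ℝ → ℝ) (T : ℝ) (u v : ℝ → ℝ → ℝ) : Prop where
  contDiffOn_u : ContDiffOn ℝ 1 (fun z : ℝ × ℝ => u z.1 z.2) (Ico (0 : ℝ) T ×ˢ univ)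
  contDiffOn_v : ContDiffOn ℝ 1 (fun z : ℝ × ℝ => v z.1 z.2) (Ico (0 : ℝ) T ×ˢ univ)
  pos : ∀ t ∈ Ico (0 : ℝ) T, ∀ x, 0 < u t x
  mass : ∀ t ∈ Ico (0 : ℝ) T, ∀ x, dt T u t x - dx v t x = 0
  momentum : ∀ t ∈ Ico (0 : ℝ) T, ∀ x,
    dt T v t x + dx (fun τ y => pressure γ (u τ y)) t x = -(lam / (1 + t) ^ mu) * v t x
  init_u : ∀ x, u 0 x = u₀ x
  init_v : ∀ x, v 0 x = v₀ x

/-- On `[0, T)` the sup norms of `u`, `v`, of their first partial derivatives, and of `p'(u)`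
are bounded uniformly in time. -/
def IsBoundedOn (γ T : ℝ) (u v : ℝ → ℝ → ℝ) : Prop :=
  ∃ M : ℝ, ∀ t ∈ Ico (0 : ℝ) T, ∀ x,
    |u t x| ≤ M ∧ |v t x| ≤ M ∧
    |dt T u t x| ≤ M ∧ |dt T v t x| ≤ M ∧
    |dx u t x| ≤ M ∧ |dx v t x| ≤ M ∧
    |deriv (pressure γ) (u t x)| ≤ M

/-- The lifespan `T*`: the supremum of all `T > 0` such that the solution exists on `[0, T) × ℝ`
with the norms of `IsBoundedOn` bounded there; `⊤` means that the solution is global. -/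
def lifespan (γ mu lam : ℝ) (u₀ v₀ : ℝ → ℝ) : EReal :=
  sSup {S : EReal | ∃ T : ℝ, S = (T : EReal) ∧ 0 < T ∧
    ∃ u v : ℝ → ℝ → ℝ, IsSolution γ mu lam u₀ v₀ T u v ∧ IsBoundedOn γ T u v}

end

end DampedEuler

/-! In coordinates `(ξ, β)` that are constant along the right-going and the left-going
characteristics, the slopes `p`, `q` of the Riemann invariants, the densities `N = t_ξ`,
`Q = t_β`, the specific volume `u` and the time `t` solve an autonomous semilinear system with
data on `ξ + β = 0`. After truncation of its right-hand side Picard iteration solves it on the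
whole plane, so that only a priori bounds are needed. They are obtained by a bootstrap over the
triangles of dependence: the Riemann invariants do not grow, and the modified slope
`y = u ^ (-m) p + (a / 2) θ(u)`, with `a` the damping coefficient, satisfies
`y' = -(a / 2) y + O((|y| + ε a) ^ 2 + ε |a ^ 2 / 4 + a' / 2|)`. As long as a supersolution `n` of
this scalar Riccati equation stays small, the truncation is inactive and the characteristic
coordinates map onto the strip below that time.

Let `E = exp (∫ a / 2)`. If `∫ 1 / E` diverges, a supersolution of the form `ε J / E` stays small
until `∫ 1 / E` reaches the order `1 / ε`; this gives `1 / ε`, `ε ^ (-2 / (2 - λ))` and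
`exp (C / ε)` in the three cases. In the global cases a small multiple of `(b + t) ^ (-μ)`, with
`b` large, is a supersolution for all times. -/

namespace DampedEuler

noncomputable section

/-! ### Picard iteration in the characteristic plane -/

section Picard

variable {E E₁ E₂ : Type*} [NormedAddCommGroup E] [NormedSpace ℝ E]
  [NormedAddCommGroup E₁] [NormedSpace ℝ E₁] [NormedAddCommGroup E₂] [NormedSpace ℝ E₂]

open BoundedContinuousFunction in
theorem exists_fixedPoint_of_weighted_contraction [CompleteSpace E] {X : Type*}
    [TopologicalSpace X] {w : X → ℝ} (hw : Continuous w) (hw0 : ∀ x, 0 < w x)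
    {Φ : C(X, E) → C(X, E)} {q : NNReal} (hq : q < 1)
    (hΦ : ∀ f g : C(X, E), ∀ d : ℝ, (∀ x, ‖f x - g x‖ ≤ d * w x) →
      ∀ x, ‖Φ f x - Φ g x‖ ≤ q * d * w x)
    {f₀ : C(X, E)} {C : ℝ} (h₀ : ∀ x, ‖Φ f₀ x - f₀ x‖ ≤ C * w x) : ∃ f, Φ f = f := by
  -- The substitution `f = f₀ + w • h` turns `Φ` into a contraction of bounded functions `h`.
  let J : (X →ᵇ E) → C(X, E) := fun h => ⟨fun x => f₀ x + w x • h x, by fun_prop⟩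
  have hJ : ∀ h k x, ‖J h x - J k x‖ ≤ dist h k * w x := fun h k x => by
    simp only [J, ContinuousMap.coe_mk, add_sub_add_left_eq_sub, ← smul_sub, norm_smul,
      Real.norm_eq_abs, abs_of_pos (hw0 x), ← dist_eq_norm]
    rw [mul_comm]
    exact mul_le_mul_of_nonneg_right (dist_coe_le_dist x) (hw0 x).le
  have hJ0 : ∀ h x, ‖J h x - f₀ x‖ ≤ ‖h‖ * w x := fun h x => by
    simpa [J] using hJ h 0 x
  let T : (X →ᵇ E) → (X →ᵇ E) := fun h =>
    ofNormedAddCommGroup (fun x => (w x)⁻¹ • (Φ (J h) x - f₀ x))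
      ((hw.inv₀ fun x => (hw0 x).ne').smul (by fun_prop)) (q * ‖h‖ + C) fun x => by
        rw [norm_smul, norm_inv, Real.norm_eq_abs, abs_of_pos (hw0 x), inv_mul_le_iff₀ (hw0 x)]
        calc ‖Φ (J h) x - f₀ x‖
            ≤ ‖Φ (J h) x - Φ f₀ x‖ + ‖Φ f₀ x - f₀ x‖ := norm_sub_le_norm_sub_add_norm_sub _ _ _
          _ ≤ q * ‖h‖ * w x + C * w x := add_le_add (hΦ _ _ _ (hJ0 h) x) (h₀ x)
          _ = w x * (q * ‖h‖ + C) := by ring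
  have hT : ContractingWith q T := by
    refine ⟨hq, LipschitzWith.of_dist_le_mul fun h k => ?_⟩
    rw [dist_le (by positivity)]
    intro x
    rw [dist_eq_norm]
    simp only [T, coe_ofNormedAddCommGroup, ← smul_sub, sub_sub_sub_cancel_right]
    rw [norm_smul, norm_inv, Real.norm_eq_abs, abs_of_pos (hw0 x), inv_mul_le_iff₀ (hw0 x),
      mul_comm]
    exact hΦ _ _ _ (hJ h k) x
  refine ⟨J (hT.fixedPoint T), ContinuousMap.ext fun x => ?_⟩
  have hfix : (w x)⁻¹ • (Φ (J (hT.fixedPoint T)) x - f₀ x) = hT.fixedPoint T x :=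
    DFunLike.congr_fun hT.fixedPoint_isFixedPt x
  change _ = f₀ x + w x • hT.fixedPoint T x
  rw [← hfix, smul_inv_smul₀ (hw0 x).ne', add_sub_cancel]

theorem continuous_integral_fst {H : ℝ × ℝ → E} (hH : Continuous H) :
    Continuous fun z : ℝ × ℝ => ∫ s in (-z.2)..z.1, H (s, z.2) := by
  have from_zero : ∀ e : ℝ × ℝ → ℝ, Continuous e →
      Continuous fun z : ℝ × ℝ => ∫ s in (0 : ℝ)..e z, H (s, z.2) := fun e he =>
    intervalIntegral.continuous_parametric_intervalIntegral_of_continuous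
      (f := fun (z : ℝ × ℝ) s => H (s, z.2)) (by fun_prop) he
  refine ((from_zero _ continuous_fst).sub (from_zero _ continuous_snd.neg)).congr fun z => ?_
  exact intervalIntegral.integral_interval_sub_left
    (Continuous.intervalIntegrable (by fun_prop) _ _)
    (Continuous.intervalIntegrable (by fun_prop) _ _)

theorem continuous_integral_snd {H : ℝ × ℝ → E} (hH : Continuous H) :
    Continuous fun z : ℝ × ℝ => ∫ b in (-z.1)..z.2, H (z.1, b) :=
  (continuous_integral_fst (H := fun z => H (z.2, z.1)) (by fun_prop)).comp continuous_swap

theorem abs_integral_exp_mul_abs_le {K : ℝ} (hK : 0 < K) (L : ℝ) :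
    |∫ s in (0 : ℝ)..L, Real.exp (K * |s|)| ≤ Real.exp (K * |L|) / K := by
  wlog hL : 0 ≤ L generalizing L
  · have h := this (-L) (by linarith)
    rw [← neg_zero, ← intervalIntegral.integral_comp_neg, intervalIntegral.integral_symm] at h
    simpa only [abs_neg, neg_neg, neg_zero] using h
  have drop_abs : ∫ s in (0 : ℝ)..L, Real.exp (K * |s|) = ∫ s in (0 : ℝ)..L, Real.exp (K * s) :=
    intervalIntegral.integral_congr fun s hs => by
      rw [uIcc_of_le hL] at hs
      simp only [abs_of_nonneg hs.1]
  have compute : ∫ s in (0 : ℝ)..L, Real.exp (K * s) = (Real.exp (K * L) - 1) / K := by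
    rw [intervalIntegral.integral_comp_mul_left _ hK.ne', integral_exp, mul_zero, Real.exp_zero,
      smul_eq_mul, inv_mul_eq_div]
  have one_le : 1 ≤ Real.exp (K * L) := Real.one_le_exp (by positivity)
  rw [drop_abs, compute, abs_of_nonneg hL, abs_of_nonneg (by positivity [sub_nonneg.2 one_le])]
  gcongr
  linarith

/-- The weight of the norm in which the Picard map of the characteristic problem contracts
(a Bielecki norm); it grows with the distance from the line `ξ + β = 0` carrying the data. -/
def bieleckiWeight (K : ℝ) (z : ℝ × ℝ) : ℝ := Real.exp (K * |z.1 + z.2|)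

theorem bieleckiWeight_pos (K : ℝ) (z : ℝ × ℝ) : 0 < bieleckiWeight K z := Real.exp_pos _

theorem one_le_bieleckiWeight {K : ℝ} (hK : 0 ≤ K) (z : ℝ × ℝ) : 1 ≤ bieleckiWeight K z :=
  Real.one_le_exp (by positivity)

theorem continuous_bieleckiWeight (K : ℝ) : Continuous (bieleckiWeight K) := by
  unfold bieleckiWeight
  fun_prop

theorem norm_integral_fst_le_of_weight {K C : ℝ} (hK : 0 < K) {H : ℝ × ℝ → E}
    (hC : ∀ z, ‖H z‖ ≤ C * bieleckiWeight K z) (z : ℝ × ℝ) :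
    ‖∫ s in (-z.2)..z.1, H (s, z.2)‖ ≤ C / K * bieleckiWeight K z := by
  have hC0 : 0 ≤ C :=
    nonneg_of_mul_nonneg_left ((norm_nonneg _).trans (hC 0)) (bieleckiWeight_pos K 0)
  have shift : ∫ s in (-z.2)..z.1, Real.exp (K * |s + z.2|)
      = ∫ s in (0 : ℝ)..(z.1 + z.2), Real.exp (K * |s|) := by
    rw [intervalIntegral.integral_comp_add_right (fun s => Real.exp (K * |s|)), neg_add_cancel]
  calc ‖∫ s in (-z.2)..z.1, H (s, z.2)‖
      ≤ |∫ s in (-z.2)..z.1, C * Real.exp (K * |s + z.2|)| :=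
        intervalIntegral.norm_integral_le_abs_of_norm_le (.of_forall fun s => hC (s, z.2))
          (Continuous.intervalIntegrable (by fun_prop) _ _)
    _ = C * |∫ s in (0 : ℝ)..(z.1 + z.2), Real.exp (K * |s|)| := by
        rw [intervalIntegral.integral_const_mul, abs_mul, abs_of_nonneg hC0, shift]
    _ ≤ C * (Real.exp (K * |z.1 + z.2|) / K) := by
        gcongr
        exact abs_integral_exp_mul_abs_le hK _
    _ = C / K * bieleckiWeight K z := by rw [bieleckiWeight]; ring

theorem norm_integral_snd_le_of_weight {K C : ℝ} (hK : 0 < K) {H : ℝ × ℝ → E}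
    (hC : ∀ z, ‖H z‖ ≤ C * bieleckiWeight K z) (z : ℝ × ℝ) :
    ‖∫ b in (-z.1)..z.2, H (z.1, b)‖ ≤ C / K * bieleckiWeight K z := by
  have weight_swap : ∀ y : ℝ × ℝ, bieleckiWeight K y.swap = bieleckiWeight K y := fun y => by
    simp only [bieleckiWeight, Prod.fst_swap, Prod.snd_swap, add_comm]
  rw [← weight_swap z]
  exact norm_integral_fst_le_of_weight hK (H := fun y => H y.swap)
    (fun y => (hC y.swap).trans_eq (by rw [weight_swap])) z.swap

theorem hasDerivAt_integral_right [CompleteSpace E] {h : ℝ → E} (hh : Continuous h) (e : E)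
    (a b : ℝ) : HasDerivAt (fun s => e + ∫ x in a..s, h x) (h b) b :=
  (intervalIntegral.integral_hasDerivAt_right (hh.intervalIntegrable _ _)
    (hh.stronglyMeasurableAtFilter _ _) hh.continuousAt).const_add e

/-- The Picard map of the characteristic problem `U_ξ = F(U, V)`, `V_β = G(U, V)` for the pair
`f = (U, V)`, where `f₀` extends the data from the line `ξ + β = 0`. -/
def picardMap (F : C(E₁ × E₂, E₁)) (G : C(E₁ × E₂, E₂)) (f₀ f : C(ℝ × ℝ, E₁ × E₂)) :
    C(ℝ × ℝ, E₁ × E₂) where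
  toFun z := f₀ z + (∫ s in (-z.2)..z.1, F (f (s, z.2)), ∫ b in (-z.1)..z.2, G (f (z.1, b)))
  continuous_toFun := f₀.continuous.add
    ((continuous_integral_fst (H := fun y => F (f y)) (by fun_prop)).prodMk
      (continuous_integral_snd (H := fun y => G (f y)) (by fun_prop)))

theorem norm_picardMap_sub_le {F : C(E₁ × E₂, E₁)} {G : C(E₁ × E₂, E₂)} {k : NNReal}
    (hF : LipschitzWith k F) (hG : LipschitzWith k G) {K d : ℝ} (hK : 0 < K)
    {f₀ f g : C(ℝ × ℝ, E₁ × E₂)} (hfg : ∀ z, ‖f z - g z‖ ≤ d * bieleckiWeight K z) (z : ℝ × ℝ) :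
    ‖picardMap F G f₀ f z - picardMap F G f₀ g z‖ ≤ k * d / K * bieleckiWeight K z := by
  have of_lip : ∀ y, k * ‖f y - g y‖ ≤ k * d * bieleckiWeight K y := fun y => by
    rw [mul_assoc]
    exact mul_le_mul_of_nonneg_left (hfg y) k.coe_nonneg
  have diff : picardMap F G f₀ f z - picardMap F G f₀ g z =
      (∫ s in (-z.2)..z.1, (F (f (s, z.2)) - F (g (s, z.2))),
        ∫ b in (-z.1)..z.2, (G (f (z.1, b)) - G (g (z.1, b)))) := by
    rw [intervalIntegral.integral_sub, intervalIntegral.integral_sub]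
    · simp only [picardMap, ContinuousMap.coe_mk, add_sub_add_left_eq_sub, Prod.mk_sub_mk]
    all_goals exact Continuous.intervalIntegrable (by fun_prop) _ _
  rw [diff]
  exact max_le
    (norm_integral_fst_le_of_weight hK (fun y => (hF.norm_sub_le _ _).trans (of_lip y)) z)
    (norm_integral_snd_le_of_weight hK (fun y => (hG.norm_sub_le _ _).trans (of_lip y)) z)

theorem exists_picardMap_eq [CompleteSpace E₁] [CompleteSpace E₂] {F : C(E₁ × E₂, E₁)}
    {G : C(E₁ × E₂, E₂)} {k : NNReal} {M : ℝ} (hF : LipschitzWith k F) (hG : LipschitzWith k G)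
    {f₀ : C(ℝ × ℝ, E₁ × E₂)} (hFM : ∀ z, ‖F (f₀ z)‖ ≤ M) (hGM : ∀ z, ‖G (f₀ z)‖ ≤ M) :
    ∃ f, picardMap F G f₀ f = f := by
  set K : ℝ := 2 * (k + 1) with hK_def
  have hK : 0 < K := by positivity
  have contraction : ∀ f g : C(ℝ × ℝ, E₁ × E₂), ∀ d : ℝ,
      (∀ z, ‖f z - g z‖ ≤ d * bieleckiWeight K z) → ∀ z,
      ‖picardMap F G f₀ f z - picardMap F G f₀ g z‖
        ≤ (1 / 2 : NNReal) * d * bieleckiWeight K z := by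
    intro f g d hfg z
    have hd : 0 ≤ d :=
      nonneg_of_mul_nonneg_left ((norm_nonneg _).trans (hfg 0)) (bieleckiWeight_pos K 0)
    have rate : k * d / K ≤ (1 / 2 : NNReal) * d := by
      rw [div_le_iff₀ hK, hK_def]
      push_cast
      linarith
    exact (norm_picardMap_sub_le hF hG hK hfg z).trans
      (mul_le_mul_of_nonneg_right rate (bieleckiWeight_pos K z).le)
  have start : ∀ z, ‖picardMap F G f₀ f₀ z - f₀ z‖ ≤ M / K * bieleckiWeight K z := fun z => by
    have hM : 0 ≤ M := (norm_nonneg _).trans (hFM 0)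
    have bdd : ∀ y, M ≤ M * bieleckiWeight K y := fun y =>
      le_mul_of_one_le_right hM (one_le_bieleckiWeight hK.le y)
    simp only [picardMap, ContinuousMap.coe_mk, add_sub_cancel_left]
    exact max_le (norm_integral_fst_le_of_weight hK (fun y => (hFM y).trans (bdd y)) z)
      (norm_integral_snd_le_of_weight hK (fun y => (hGM y).trans (bdd y)) z)
  exact exists_fixedPoint_of_weighted_contraction (continuous_bieleckiWeight K)
    (bieleckiWeight_pos K) (by norm_num [← NNReal.coe_lt_coe]) contraction start

theorem exists_characteristic_solution [CompleteSpace E₁] [CompleteSpace E₂]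
    {F : E₁ × E₂ → E₁} {G : E₁ × E₂ → E₂} {k : NNReal} {M : ℝ}
    (hF : LipschitzWith k F) (hG : LipschitzWith k G)
    {U₀ : ℝ → E₁} {V₀ : ℝ → E₂} (hU₀ : Continuous U₀) (hV₀ : Continuous V₀)
    (hFM : ∀ x y, ‖F (U₀ x, V₀ y)‖ ≤ M) (hGM : ∀ x y, ‖G (U₀ x, V₀ y)‖ ≤ M) :
    ∃ f : ℝ × ℝ → E₁ × E₂, Continuous f ∧ (∀ x, f (-x, x) = (U₀ x, V₀ x)) ∧
      (∀ ξ β, HasDerivAt (fun s => (f (s, β)).1) (F (f (ξ, β))) ξ) ∧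
      ∀ ξ β, HasDerivAt (fun b => (f (ξ, b)).2) (G (f (ξ, β))) β := by
  let F' : C(E₁ × E₂, E₁) := ⟨F, hF.continuous⟩
  let G' : C(E₁ × E₂, E₂) := ⟨G, hG.continuous⟩
  let f₀ : C(ℝ × ℝ, E₁ × E₂) := ⟨fun z => (U₀ z.2, V₀ (-z.1)), by fun_prop⟩
  obtain ⟨f, hf⟩ := exists_picardMap_eq (F := F') (G := G') (f₀ := f₀) hF hG
    (fun z => hFM z.2 (-z.1)) fun z => hGM z.2 (-z.1)
  have integral_eq : ∀ ξ β, f (ξ, β) =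
      (U₀ β + ∫ s in (-β)..ξ, F' (f (s, β)), V₀ (-ξ) + ∫ b in (-ξ)..β, G' (f (ξ, b))) :=
    fun ξ β => (DFunLike.congr_fun hf (ξ, β)).symm
  refine ⟨f, f.continuous, fun x => ?_, fun ξ β => ?_, fun ξ β => ?_⟩
  · rw [integral_eq]
    simp only [neg_neg, intervalIntegral.integral_same, add_zero]
  · refine (hasDerivAt_integral_right (h := fun s => F' (f (s, β))) (by fun_prop) (U₀ β)
      (-β) ξ).congr_of_eventuallyEq (.of_forall fun s => ?_)
    exact congr_arg Prod.fst (integral_eq s β)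
  · refine (hasDerivAt_integral_right (h := fun b => G' (f (ξ, b))) (by fun_prop) (V₀ (-ξ))
      (-ξ) β).congr_of_eventuallyEq (.of_forall fun b => ?_)
    exact congr_arg Prod.snd (integral_eq ξ b)

end Picard

/-! ### Potentials of closed forms -/

section Potential

/-- An open set of the characteristic plane containing, with each point, the segment that joins it
to the line `ξ + β = 0` in the direction of `β`. -/
structure IsSegmentDomain (D : Set (ℝ × ℝ)) : Prop where
  isOpen : IsOpen D
  segment : ∀ ξ β, (ξ, β) ∈ D → ∀ b ∈ uIcc (-ξ) β, (ξ, b) ∈ D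

/-- On `D`, the function `f` has the partial derivative `f'` in the first variable. -/
def HasPartialFst (D : Set (ℝ × ℝ)) (f f' : ℝ × ℝ → ℝ) : Prop :=
  ∀ ξ β, (ξ, β) ∈ D → HasDerivAt (fun s => f (s, β)) (f' (ξ, β)) ξ

/-- On `D`, the function `f` has the partial derivative `f'` in the second variable. -/
def HasPartialSnd (D : Set (ℝ × ℝ)) (f f' : ℝ × ℝ → ℝ) : Prop :=
  ∀ ξ β, (ξ, β) ∈ D → HasDerivAt (fun b => f (ξ, b)) (f' (ξ, β)) β

theorem hasDerivAt_integral_moving_left {E : Type*} [NormedAddCommGroup E] [NormedSpace ℝ E]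
    [CompleteSpace E] {A : ℝ × ℝ → E} (hA : Continuous A) (ξ : ℝ) :
    HasDerivAt (fun s => ∫ b in (-s)..(-ξ), A (s, b)) (A (ξ, -ξ)) ξ := by
  rw [hasDerivAt_iff_isLittleO, Asymptotics.isLittleO_iff]
  intro ε hε
  obtain ⟨δ, hδ, close⟩ := Metric.continuousAt_iff.1 (hA.continuousAt (x := (ξ, -ξ))) ε hε
  filter_upwards [Metric.ball_mem_nhds ξ hδ] with s hs
  rw [Metric.mem_ball, Real.dist_eq] at hs
  have integrand_le : ∀ b ∈ uIoc (-s) (-ξ), ‖A (s, b) - A (ξ, -ξ)‖ ≤ ε := by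
    intro b hb
    have b_close : |b - -ξ| ≤ |s - ξ| := by
      have := abs_sub_left_of_mem_uIcc (uIoc_subset_uIcc (uIoc_comm (-s) (-ξ) ▸ hb))
      rwa [neg_sub_neg, abs_sub_comm ξ s] at this
    rw [← dist_eq_norm]
    refine (close ?_).le
    rw [Prod.dist_eq, Real.dist_eq, Real.dist_eq]
    exact max_lt hs (b_close.trans_lt hs)
  have remainder : (∫ b in (-s)..(-ξ), A (s, b)) - (∫ b in (-ξ)..(-ξ), A (ξ, b))
      - (s - ξ) • A (ξ, -ξ) = ∫ b in (-s)..(-ξ), (A (s, b) - A (ξ, -ξ)) := by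
    rw [intervalIntegral.integral_sub (Continuous.intervalIntegrable (by fun_prop) _ _)
      (Continuous.intervalIntegrable (by fun_prop) _ _), intervalIntegral.integral_same,
      intervalIntegral.integral_const, sub_zero, neg_sub_neg]
  rw [remainder]
  refine (intervalIntegral.norm_integral_le_of_norm_le_const integrand_le).trans_eq ?_
  rw [Real.norm_eq_abs, neg_sub_neg]

theorem hasDerivAt_integral_fst_of_tube {A H : ℝ × ℝ → ℝ} (hA : Continuous A) (hH : Continuous H)
    {D : Set (ℝ × ℝ)} (hD : IsOpen D) (hAH : HasPartialFst D A H)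
    {ξ a b : ℝ} (htube : ∀ y ∈ uIcc a b, (ξ, y) ∈ D) :
    HasDerivAt (fun s => ∫ y in a..b, A (s, y)) (∫ y in a..b, H (ξ, y)) ξ := by
  have nearby : ∀ᶠ s in 𝓝 ξ, ∀ y ∈ uIcc a b, (s, y) ∈ D :=
    isCompact_uIcc.eventually_forall_of_forall_eventually fun y hy => hD.mem_nhds (htube y hy)
  obtain ⟨δ, hδ, hball⟩ := Metric.eventually_nhds_iff_ball.1 nearby
  obtain ⟨C, hC⟩ := ((isCompact_closedBall ξ δ).prod
    (isCompact_uIcc (a := a) (b := b))).exists_bound_of_continuousOn hH.continuousOn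
  refine (intervalIntegral.hasDerivAt_integral_of_dominated_loc_of_deriv_le
    (F' := fun s y => H (s, y)) (bound := fun _ => C) (Metric.ball_mem_nhds ξ hδ)
    (.of_forall fun s => Continuous.aestronglyMeasurable (by fun_prop))
    (Continuous.intervalIntegrable (by fun_prop) _ _)
    (Continuous.aestronglyMeasurable (by fun_prop))
    (.of_forall fun y hy s hs => ?_) (Continuous.intervalIntegrable (by fun_prop) _ _)
    (.of_forall fun y hy s hs => ?_)).2
  · exact hC (s, y) ⟨Metric.ball_subset_closedBall hs, uIoc_subset_uIcc hy⟩
  · exact hAH s y (hball s hs y (uIoc_subset_uIcc hy))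

/-- The function with given datum on `ξ + β = 0` and given derivative `A` in the direction `β`. -/
def potential (f₀ : ℝ → ℝ) (A : ℝ × ℝ → ℝ) (z : ℝ × ℝ) : ℝ :=
  f₀ (-z.1) + ∫ b in (-z.1)..z.2, A (z.1, b)

theorem continuous_potential {f₀ : ℝ → ℝ} {A : ℝ × ℝ → ℝ} (hf₀ : Continuous f₀)
    (hA : Continuous A) : Continuous (potential f₀ A) :=
  (hf₀.comp continuous_fst.neg).add (continuous_integral_snd hA)

theorem potential_diag (f₀ : ℝ → ℝ) (A : ℝ × ℝ → ℝ) (x : ℝ) : potential f₀ A (-x, x) = f₀ x := by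
  simp [potential]

theorem hasPartialSnd_potential (f₀ : ℝ → ℝ) {A : ℝ × ℝ → ℝ} (hA : Continuous A)
    (D : Set (ℝ × ℝ)) : HasPartialSnd D (potential f₀ A) A := fun ξ β _ =>
  hasDerivAt_integral_right (h := fun b => A (ξ, b)) (by fun_prop) (f₀ (-ξ)) (-ξ) β

/-- The closed form `B dξ + A dβ` (`H` being the common value of `A_ξ` and `B_β`) is exact: its
potential has the expected derivative in the direction `ξ` as well. -/
theorem hasPartialFst_potential {D : Set (ℝ × ℝ)} (hD : IsSegmentDomain D) {f₀ : ℝ → ℝ}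
    {A B H : ℝ × ℝ → ℝ} (hA : Continuous A) (hH : Continuous H)
    (hf₀ : ∀ x, HasDerivAt f₀ (A (-x, x) - B (-x, x)) x)
    (hAH : HasPartialFst D A H) (hBH : HasPartialSnd D B H) :
    HasPartialFst D (potential f₀ A) B := by
  intro ξ β h
  have segment := hD.segment ξ β h
  have integral_H : ∫ b in (-ξ)..β, H (ξ, b) = B (ξ, β) - B (ξ, -ξ) :=
    intervalIntegral.integral_eq_sub_of_hasDerivAt (fun b hb => hBH ξ b (segment b hb))
      (Continuous.intervalIntegrable (by fun_prop) _ _)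
  have datum : HasDerivAt (fun s => f₀ (-s)) (-(A (ξ, -ξ) - B (ξ, -ξ))) ξ := by
    simpa [Function.comp_def] using (hf₀ (-ξ)).comp ξ (hasDerivAt_neg ξ)
  have split : (fun s => potential f₀ A (s, β)) = fun s =>
      f₀ (-s) + ((∫ b in (-s)..(-ξ), A (s, b)) + ∫ b in (-ξ)..β, A (s, b)) := by
    funext s
    rw [intervalIntegral.integral_add_adjacent_intervals] <;>
    first | rfl | exact Continuous.intervalIntegrable (by fun_prop) _ _
  rw [split]
  refine (datum.add ((hasDerivAt_integral_moving_left hA ξ).add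
    (hasDerivAt_integral_fst_of_tube hA hH hD.isOpen hAH segment))).congr_deriv ?_
  rw [integral_H]
  ring

theorem HasPartialSnd.eqOn_potential {D : Set (ℝ × ℝ)} (hD : IsSegmentDomain D)
    {f A : ℝ × ℝ → ℝ} (hA : Continuous A) (hf : HasPartialSnd D f A) :
    EqOn f (potential (fun x => f (-x, x)) A) D := by
  rintro ⟨ξ, β⟩ h
  have integral_A : ∫ b in (-ξ)..β, A (ξ, b) = f (ξ, β) - f (ξ, -ξ) :=
    intervalIntegral.integral_eq_sub_of_hasDerivAt
      (fun b hb => hf ξ b (hD.segment ξ β h b hb))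
      (Continuous.intervalIntegrable (by fun_prop) _ _)
  simp only [potential, integral_A, neg_neg, add_sub_cancel]

theorem HasPartialSnd.hasPartialFst_of_closed {D : Set (ℝ × ℝ)} (hD : IsSegmentDomain D)
    {f A B H : ℝ × ℝ → ℝ} (hf : HasPartialSnd D f A) (hA : Continuous A) (hH : Continuous H)
    (hdiag : ∀ x, HasDerivAt (fun y => f (-y, y)) (A (-x, x) - B (-x, x)) x)
    (hAH : HasPartialFst D A H) (hBH : HasPartialSnd D B H) : HasPartialFst D f B := by
  intro ξ β h
  have nearby : ∀ᶠ s in 𝓝 ξ, (s, β) ∈ D :=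
    (Continuous.prodMk_left β).continuousAt.eventually (hD.isOpen.mem_nhds h)
  refine (hasPartialFst_potential hD hA hH hdiag hAH hBH ξ β h).congr_of_eventuallyEq ?_
  filter_upwards [nearby] with s hs using hf.eqOn_potential hD hA hs

/-- The continuous linear form `(h, k) ↦ a h + b k` on the plane. -/
def planeForm (a b : ℝ) : ℝ × ℝ →L[ℝ] ℝ :=
  a • ContinuousLinearMap.fst ℝ ℝ ℝ + b • ContinuousLinearMap.snd ℝ ℝ ℝ

@[simp] theorem planeForm_apply (a b : ℝ) (z : ℝ × ℝ) : planeForm a b z = a * z.1 + b * z.2 := by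
  simp [planeForm]

theorem hasStrictFDerivAt_of_partials {D : Set (ℝ × ℝ)} (hD : IsOpen D) {f A B : ℝ × ℝ → ℝ}
    (hA : Continuous A) (hB : Continuous B)
    (h₁ : HasPartialFst D f B) (h₂ : HasPartialSnd D f A) {z : ℝ × ℝ} (hz : z ∈ D) :
    HasStrictFDerivAt f (planeForm (B z) (A z)) z := by
  have continuous_toSpanSingleton : ∀ {C : ℝ × ℝ → ℝ}, Continuous C →
      Continuous fun y => ContinuousLinearMap.toSpanSingleton ℝ (C y) := fun hC =>
    (ContinuousLinearMap.toSpanSingletonCLE (𝕜 := ℝ) (E := ℝ)).continuous.comp hC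
  have coprod : planeForm (B z) (A z) = (ContinuousLinearMap.toSpanSingleton ℝ (B z)).coprod
      (ContinuousLinearMap.toSpanSingleton ℝ (A z)) := by
    ext <;> simp
  rw [coprod]
  exact hasStrictFDerivAt_uncurry_coprod (𝕜 := ℝ) (f := fun a b => f (a, b))
    (f₁ := fun a b => ContinuousLinearMap.toSpanSingleton ℝ (B (a, b)))
    (f₂ := fun a b => ContinuousLinearMap.toSpanSingleton ℝ (A (a, b)))
    (by filter_upwards [hD.mem_nhds hz] with v hv using (h₁ v.1 v.2 hv).hasFDerivAt)
    (by filter_upwards [hD.mem_nhds hz] with v hv using (h₂ v.1 v.2 hv).hasFDerivAt)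
    (continuous_toSpanSingleton hB).continuousAt (continuous_toSpanSingleton hA).continuousAt

end Potential

section BoundedLipschitz

/-- Truncation of a real number to the interval `[l, h]`. -/
def clip (l h x : ℝ) : ℝ := max l (min h x)

theorem continuous_clip (l h : ℝ) : Continuous (clip l h) :=
  continuous_const.max (continuous_const.min continuous_id)

theorem lipschitzWith_clip (l h : ℝ) : LipschitzWith 1 (clip l h) :=
  (LipschitzWith.id.const_min h).const_max l

theorem le_clip (l h x : ℝ) : l ≤ clip l h x := le_max_left _ _

theorem clip_le {l h : ℝ} (hlh : l ≤ h) (x : ℝ) : clip l h x ≤ h := max_le hlh (min_le_left _ _)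

theorem clip_of_mem_Icc {l h x : ℝ} (hx : x ∈ Icc l h) : clip l h x = x := by
  rw [clip, min_eq_right hx.2, max_eq_right hx.1]

theorem clip_eq_of_mem_Ioo {l h x : ℝ} (hx : clip l h x ∈ Ioo l h) : clip l h x = x := by
  have lt_min : l < min h x := (lt_max_iff.1 hx.1).resolve_left (lt_irrefl _)
  have min_lt : min h x < h := (le_max_right _ _).trans_lt hx.2
  have x_lt : x < h := (min_lt_iff.1 min_lt).resolve_left (lt_irrefl _)
  exact clip_of_mem_Icc ⟨(lt_min.trans_le (min_le_right _ _)).le, x_lt.le⟩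

theorem hasDerivAt_clip {f : ℝ → ℝ} {f' s l h : ℝ} (hf : HasDerivAt f f' s)
    (hs : clip l h (f s) ∈ Ioo l h) : HasDerivAt (fun x => clip l h (f x)) f' s := by
  have continuousAt : ContinuousAt (fun x => clip l h (f x)) s :=
    (continuous_clip l h).continuousAt.comp hf.continuousAt
  refine hf.congr_of_eventuallyEq ?_
  filter_upwards [continuousAt.eventually (Ioo_mem_nhds hs.1 hs.2)] with x hx
  exact clip_eq_of_mem_Ioo hx

variable {α E E' : Type*} [PseudoMetricSpace α] [NormedAddCommGroup E] [NormedAddCommGroup E']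

/-- Bounded and globally Lipschitz functions. -/
def BddLip (f : α → E) : Prop :=
  (∃ K, LipschitzWith K f) ∧ ∃ M, ∀ x, ‖f x‖ ≤ M

namespace BddLip

theorem const (r : E) : BddLip fun _ : α => r :=
  ⟨⟨0, LipschitzWith.const r⟩, ‖r‖, fun _ => le_rfl⟩

theorem comp {β : Type*} [PseudoMetricSpace β] {f : α → E} {g : β → α} {K : NNReal}
    (hf : BddLip f) (hg : LipschitzWith K g) : BddLip fun x => f (g x) := by
  obtain ⟨⟨K', hK'⟩, M, hM⟩ := hf
  exact ⟨⟨_, hK'.comp hg⟩, M, fun x => hM (g x)⟩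

theorem prodMk {f : α → E} {g : α → E'} (hf : BddLip f) (hg : BddLip g) :
    BddLip fun x => (f x, g x) := by
  obtain ⟨⟨K, hK⟩, M, hM⟩ := hf
  obtain ⟨⟨K', hK'⟩, M', hM'⟩ := hg
  exact ⟨⟨_, hK.prodMk hK'⟩, max M M', fun x => max_le_max (hM x) (hM' x)⟩

theorem neg {f : α → E} (hf : BddLip f) : BddLip fun x => -f x := by
  obtain ⟨⟨K, hK⟩, M, hM⟩ := hf
  exact ⟨⟨K, hK.neg⟩, M, fun x => by rw [norm_neg]; exact hM x⟩

theorem add {f g : α → E} (hf : BddLip f) (hg : BddLip g) : BddLip fun x => f x + g x := by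
  obtain ⟨⟨K, hK⟩, M, hM⟩ := hf
  obtain ⟨⟨K', hK'⟩, M', hM'⟩ := hg
  exact ⟨⟨_, hK.add hK'⟩, M + M', fun x => norm_add_le_of_le (hM x) (hM' x)⟩

theorem sub {f g : α → E} (hf : BddLip f) (hg : BddLip g) : BddLip fun x => f x - g x := by
  simpa only [sub_eq_add_neg] using hf.add hg.neg

variable {f g : α → ℝ}

theorem mul (hf : BddLip f) (hg : BddLip g) : BddLip fun x => f x * g x := by
  obtain ⟨⟨K, hK⟩, M, hM⟩ := hf
  obtain ⟨⟨K', hK'⟩, M', hM'⟩ := hg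
  refine ⟨⟨M.toNNReal * K' + M'.toNNReal * K, LipschitzWith.of_dist_le_mul fun x y => ?_⟩, M * M',
    fun x => ?_⟩
  · have hM0 : 0 ≤ M := (norm_nonneg _).trans (hM x)
    have hM0' : 0 ≤ M' := (norm_nonneg _).trans (hM' x)
    push_cast
    rw [Real.coe_toNNReal _ hM0, Real.coe_toNNReal _ hM0']
    calc dist (f x * g x) (f y * g y) = ‖f x * (g x - g y) + g y * (f x - f y)‖ := by
          rw [dist_eq_norm]; congr 1; ring
      _ ≤ ‖f x‖ * dist (g x) (g y) + ‖g y‖ * dist (f x) (f y) := by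
          simpa only [norm_mul, dist_eq_norm] using
            norm_add_le (f x * (g x - g y)) (g y * (f x - f y))
      _ ≤ M * (K' * dist x y) + M' * (K * dist x y) := by
          gcongr
          exacts [hM x, hK'.dist_le_mul x y, hM' y, hK.dist_le_mul x y]
      _ = (M * K' + M' * K) * dist x y := by ring
  · rw [norm_mul]
    exact mul_le_mul (hM x) (hM' x) (norm_nonneg _) ((norm_nonneg _).trans (hM x))

theorem inv {l : ℝ} (hl : 0 < l) (hf : BddLip f) (hlf : ∀ x, l ≤ f x) :
    BddLip fun x => (f x)⁻¹ := by
  obtain ⟨⟨K, hK⟩, -⟩ := hf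
  have pos : ∀ x, 0 < f x := fun x => hl.trans_le (hlf x)
  have inv_nonneg : ∀ x, 0 ≤ (f x)⁻¹ := fun x => (inv_pos.2 (pos x)).le
  refine ⟨⟨(l⁻¹ * l⁻¹).toNNReal * K, LipschitzWith.of_dist_le_mul fun x y => ?_⟩, l⁻¹,
    fun x => ?_⟩
  · push_cast
    rw [Real.coe_toNNReal _ (by positivity)]
    calc dist (f x)⁻¹ (f y)⁻¹ = (f x)⁻¹ * (f y)⁻¹ * dist (f x) (f y) := by
          rw [Real.dist_eq, Real.dist_eq, inv_sub_inv (pos x).ne' (pos y).ne', abs_div,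
            abs_of_pos (mul_pos (pos x) (pos y)), abs_sub_comm, div_eq_inv_mul, mul_inv]
      _ ≤ l⁻¹ * l⁻¹ * (K * dist x y) := by
          gcongr
          exacts [inv_nonneg y, hlf x, hlf y, hK.dist_le_mul x y]
      _ = l⁻¹ * l⁻¹ * K * dist x y := by ring
  · rw [Real.norm_of_nonneg (inv_nonneg x)]
    exact inv_anti₀ hl (hlf x)

theorem clip {l h : ℝ} (hlh : l ≤ h) {K : NNReal} (hf : LipschitzWith K f) :
    BddLip fun x => clip l h (f x) :=
  ⟨⟨_, (lipschitzWith_clip l h).comp hf⟩, max |l| |h|,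
    fun _ => abs_le_max_abs_abs (le_clip _ _ _) (clip_le hlh _)⟩

end BddLip

end BoundedLipschitz

/-! ### The characteristic system -/

/-- The speed of sound `√(-p'(u))` in terms of the specific volume, `c(u) = u ^ (-2m)` with
`m = (γ + 1) / 4`. -/
def speed (m u : ℝ) : ℝ := u ^ (-(2 * m))

theorem speed_pos (m : ℝ) {u : ℝ} (hu : 0 < u) : 0 < speed m u := Real.rpow_pos_of_pos hu _

theorem hasDerivAt_speed (m : ℝ) {u : ℝ} (hu : 0 < u) :
    HasDerivAt (speed m) (2 * (-m / u) * speed m u) u := by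
  refine (Real.hasDerivAt_rpow_const (p := -(2 * m)) (Or.inl hu.ne')).congr_deriv ?_
  rw [Real.rpow_sub_one hu.ne', speed]
  field_simp

theorem continuous_speed (m : ℝ) {α : Type*} [TopologicalSpace α] {u : α → ℝ}
    (hu : Continuous u) (hu_pos : ∀ x, 0 < u x) : Continuous fun x => speed m (u x) :=
  hu.rpow_const fun x => Or.inl (hu_pos x).ne'

/-- The rate of change of a slope `p` in time along its characteristic, when `q` is the slope of
the other family, `u` the specific volume and `α` the damping coefficient. -/
def slopeRate (m α u p q : ℝ) : ℝ := -m / u * (p ^ 2 - p * q) - α / 2 * (p + q)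

theorem BddLip.slopeRate {α : Type*} [PseudoMetricSpace α] {m l : ℝ} {a u p q : α → ℝ}
    (ha : BddLip a) (hl : 0 < l) (hu : BddLip u) (hlu : ∀ x, l ≤ u x) (hp : BddLip p)
    (hq : BddLip q) : BddLip fun x => slopeRate m (a x) (u x) (p x) (q x) := by
  simpa only [DampedEuler.slopeRate, div_eq_mul_inv, sq] using
    ((((const (-m)).mul (hu.inv hl hlu)).mul ((hp.mul hp).sub (hp.mul hq))).sub
      ((ha.mul (const 2⁻¹)).mul (hp.add hq)))

/-- The part of the damped Euler equations in characteristic coordinates that determines a solution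
from its data. The coordinates `(ξ, β)` label the right-going characteristic issuing from `x = -ξ`
and the left-going one issuing from `x = β`; `p` and `q` stand for the `x`-derivatives of the
Riemann invariants `v + η(u)` and `v - η(u)`, where `η' = c`, and `N = t_ξ`, `Q = t_β`. The
functions are total, but the equations are only imposed on `D`. -/
structure CharacteristicSystem (m : ℝ) (a u₀ p₀ q₀ : ℝ → ℝ) (D : Set (ℝ × ℝ)) where
  (p q N Q u t : ℝ × ℝ → ℝ)
  cont_p : Continuous p
  cont_q : Continuous q
  cont_N : Continuous N
  cont_Q : Continuous Q
  cont_u : Continuous u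
  cont_t : Continuous t
  u_pos : ∀ z, 0 < u z
  p_diag : ∀ x, p (-x, x) = p₀ x
  q_diag : ∀ x, q (-x, x) = q₀ x
  N_diag : ∀ x, N (-x, x) = 1 / (2 * speed m (u₀ x))
  Q_diag : ∀ x, Q (-x, x) = 1 / (2 * speed m (u₀ x))
  u_diag : ∀ x, u (-x, x) = u₀ x
  t_diag : ∀ x, t (-x, x) = 0
  p_fst : HasPartialFst D p fun z => N z * slopeRate m (a (t z)) (u z) (p z) (q z)
  q_snd : HasPartialSnd D q fun z => Q z * slopeRate m (a (t z)) (u z) (q z) (p z)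
  Q_fst : HasPartialFst D Q fun z => m / u z * (p z + q z) * N z * Q z
  N_snd : HasPartialSnd D N fun z => m / u z * (p z + q z) * N z * Q z
  u_snd : HasPartialSnd D u fun z => p z * Q z
  t_snd : HasPartialSnd D t Q

/-- Solutions of the damped Euler equations in characteristic coordinates, on a region `D`,
including the position `X` and the velocity `v`. -/
structure CharacteristicSolution (m : ℝ) (a u₀ v₀ p₀ q₀ : ℝ → ℝ) (D : Set (ℝ × ℝ)) extends
    CharacteristicSystem m a u₀ p₀ q₀ D where
  (X v : ℝ × ℝ → ℝ)
  cont_X : Continuous X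
  cont_v : Continuous v
  X_diag : ∀ x, X (-x, x) = x
  v_diag : ∀ x, v (-x, x) = v₀ x
  u_fst : HasPartialFst D u fun z => q z * N z
  t_fst : HasPartialFst D t N
  X_fst : HasPartialFst D X fun z => -(speed m (u z) * N z)
  X_snd : HasPartialSnd D X fun z => speed m (u z) * Q z
  v_fst : HasPartialFst D v fun z => -(a (t z) * v z * N z) - speed m (u z) * q z * N z
  v_snd : HasPartialSnd D v fun z => -(a (t z) * v z * Q z) + speed m (u z) * p z * Q z

/-- The reflection `x ↦ -x` exchanges the two families of characteristics. -/
def CharacteristicSolution.swap {m : ℝ} {a u₀ v₀ p₀ q₀ : ℝ → ℝ} {D : Set (ℝ × ℝ)}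
    (S : CharacteristicSolution m a u₀ v₀ p₀ q₀ D) :
    CharacteristicSolution m a (fun x => u₀ (-x)) (fun x => -v₀ (-x)) (fun x => q₀ (-x))
      (fun x => p₀ (-x)) (Prod.swap ⁻¹' D) where
  p z := S.q z.swap
  q z := S.p z.swap
  N z := S.Q z.swap
  Q z := S.N z.swap
  u z := S.u z.swap
  t z := S.t z.swap
  X z := -S.X z.swap
  v z := -S.v z.swap
  cont_p := S.cont_q.comp continuous_swap
  cont_q := S.cont_p.comp continuous_swap
  cont_N := S.cont_Q.comp continuous_swap
  cont_Q := S.cont_N.comp continuous_swap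
  cont_u := S.cont_u.comp continuous_swap
  cont_t := S.cont_t.comp continuous_swap
  cont_X := (S.cont_X.comp continuous_swap).neg
  cont_v := (S.cont_v.comp continuous_swap).neg
  u_pos z := S.u_pos z.swap
  p_diag x := by simpa using S.q_diag (-x)
  q_diag x := by simpa using S.p_diag (-x)
  N_diag x := by simpa using S.Q_diag (-x)
  Q_diag x := by simpa using S.N_diag (-x)
  u_diag x := by simpa using S.u_diag (-x)
  t_diag x := by simpa using S.t_diag (-x)
  X_diag x := by simpa using congrArg Neg.neg (S.X_diag (-x))
  v_diag x := by simpa using congrArg Neg.neg (S.v_diag (-x))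
  p_fst ξ β h := S.q_snd β ξ h
  q_snd ξ β h := S.p_fst β ξ h
  Q_fst ξ β h := (S.N_snd β ξ h).congr_deriv (by simp only [Prod.swap_prod_mk]; ring)
  N_snd ξ β h := (S.Q_fst β ξ h).congr_deriv (by simp only [Prod.swap_prod_mk]; ring)
  u_fst ξ β h := S.u_snd β ξ h
  u_snd ξ β h := S.u_fst β ξ h
  t_fst ξ β h := S.t_snd β ξ h
  t_snd ξ β h := S.t_fst β ξ h
  X_fst ξ β h := (S.X_snd β ξ h).neg
  X_snd ξ β h := (S.X_fst β ξ h).neg.congr_deriv (by simp only [Prod.swap_prod_mk]; ring)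
  v_fst ξ β h := (S.v_snd β ξ h).neg.congr_deriv (by simp only [Prod.swap_prod_mk]; ring)
  v_snd ξ β h := (S.v_fst β ξ h).neg.congr_deriv (by simp only [Prod.swap_prod_mk]; ring)

/-- The points whose segment to the line `ξ + β = 0` in the direction of `β` lies in `O`. -/
def segmentDomain (O : Set (ℝ × ℝ)) : Set (ℝ × ℝ) :=
  {z | ∀ b ∈ uIcc (-z.1) z.2, (z.1, b) ∈ O}

theorem segmentDomain_subset (O : Set (ℝ × ℝ)) : segmentDomain O ⊆ O :=
  fun z hz => hz z.2 right_mem_uIcc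

theorem mem_segmentDomain_iff_forall_unit {O : Set (ℝ × ℝ)} {z : ℝ × ℝ} :
    z ∈ segmentDomain O ↔ ∀ k ∈ Icc (0 : ℝ) 1, (z.1, -z.1 + k * (z.1 + z.2)) ∈ O := by
  simp only [segmentDomain, mem_ofPred_eq, ← segment_eq_uIcc, segment_eq_image', forall_mem_image,
    smul_eq_mul, sub_neg_eq_add, add_comm z.2 z.1]

theorem isSegmentDomain_segmentDomain {O : Set (ℝ × ℝ)} (hO : IsOpen O) :
    IsSegmentDomain (segmentDomain O) where
  isOpen := isOpen_iff_mem_nhds.2 fun z hz => by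
    rw [mem_segmentDomain_iff_forall_unit] at hz
    have endpoint_continuous :
        Continuous fun w : (ℝ × ℝ) × ℝ => (w.1.1, -w.1.1 + w.2 * (w.1.1 + w.1.2)) := by
      fun_prop
    filter_upwards [isCompact_Icc.eventually_forall_of_forall_eventually (x₀ := z)
      (P := fun z k => (z.1, -z.1 + k * (z.1 + z.2)) ∈ O) fun k hk =>
        endpoint_continuous.continuousAt.eventually (hO.mem_nhds (hz k hk))] with y hy
    exact mem_segmentDomain_iff_forall_unit.2 hy
  segment _ _ h _ hb c hc := h c (uIcc_subset_uIcc left_mem_uIcc hb hc)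

/-- The states of the characteristic system at which no truncation is active. -/
def Untruncated (B p q N Q u : ℝ) : Prop :=
  p ∈ Ioo (-2) 2 ∧ q ∈ Ioo (-2) 2 ∧ N ∈ Ioo (-B) B ∧ Q ∈ Ioo (-B) B ∧ u ∈ Ioo (1 / 4) 4

theorem Untruncated.isOpen {B : ℝ} {p q N Q u : ℝ × ℝ → ℝ} (hp : Continuous p)
    (hq : Continuous q) (hN : Continuous N) (hQ : Continuous Q) (hu : Continuous u) :
    IsOpen {z | Untruncated B (p z) (q z) (N z) (Q z) (u z)} :=
  (isOpen_Ioo.preimage hp).inter ((isOpen_Ioo.preimage hq).inter ((isOpen_Ioo.preimage hN).inter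
    ((isOpen_Ioo.preimage hQ).inter (isOpen_Ioo.preimage hu))))

theorem hasDerivAt_fst {E F : Type*} [NormedAddCommGroup E] [NormedSpace ℝ E]
    [NormedAddCommGroup F] [NormedSpace ℝ F] {f : ℝ → E × F} {f' : E × F} {x : ℝ}
    (hf : HasDerivAt f f' x) : HasDerivAt (fun s => (f s).1) f'.1 x :=
  (hasFDerivAt_fst (𝕜 := ℝ) (p := f x)).comp_hasDerivAt x hf

theorem hasDerivAt_snd {E F : Type*} [NormedAddCommGroup E] [NormedSpace ℝ E]
    [NormedAddCommGroup F] [NormedSpace ℝ F] {f : ℝ → E × F} {f' : E × F} {x : ℝ}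
    (hf : HasDerivAt f f' x) : HasDerivAt (fun s => (f s).2) f'.2 x :=
  (hasFDerivAt_snd (𝕜 := ℝ) (p := f x)).comp_hasDerivAt x hf

/-- The unknowns `((p, Q), (q, N, u, t))` of the characteristic system, grouped by the direction in
which they are transported. -/
abbrev CharacteristicState := (ℝ × ℝ) × (ℝ × ℝ × ℝ × ℝ)

namespace CharacteristicState

/-- Truncation of a state to the range of `Untruncated`; the time `t` is left free. -/
def truncate (B : ℝ) (x : CharacteristicState) : CharacteristicState :=
  ((clip (-2) 2 x.1.1, clip (-B) B x.1.2),
    (clip (-2) 2 x.2.1, clip (-B) B x.2.2.1, clip (1 / 4) 4 x.2.2.2.1, x.2.2.2.2))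

/-- The derivative of `(p, Q)` in the direction `ξ`. -/
def rateFst (m : ℝ) (a : ℝ → ℝ) : CharacteristicState → ℝ × ℝ
  | ((p, Q), (q, N, u, t)) => (N * slopeRate m (a t) u p q, m / u * (p + q) * N * Q)

/-- The derivative of `(q, N, u, t)` in the direction `β`. -/
def rateSnd (m : ℝ) (a : ℝ → ℝ) : CharacteristicState → ℝ × ℝ × ℝ × ℝ
  | ((p, Q), (q, N, u, t)) => (Q * slopeRate m (a t) u q p, m / u * (p + q) * N * Q, p * Q, Q)

theorem bddLip_rate_truncate (m : ℝ) {B : ℝ} (hB : 0 ≤ B) {a : ℝ → ℝ} (ha : BddLip a) :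
    BddLip (fun x => rateFst m a (truncate B x)) ∧ BddLip fun x => rateSnd m a (truncate B x) := by
  have lip_V : LipschitzWith 1 fun x : CharacteristicState => x.2 := .prod_snd
  have lip_Nut := LipschitzWith.prod_snd.comp lip_V
  have lip_ut := LipschitzWith.prod_snd.comp lip_Nut
  have hp : BddLip fun x => (truncate B x).1.1 :=
    .clip (by norm_num) (LipschitzWith.prod_fst.comp .prod_fst)
  have hQ : BddLip fun x => (truncate B x).1.2 :=
    .clip (by linarith) (LipschitzWith.prod_snd.comp .prod_fst)
  have hq : BddLip fun x => (truncate B x).2.1 :=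
    .clip (by norm_num) (LipschitzWith.prod_fst.comp lip_V)
  have hN : BddLip fun x => (truncate B x).2.2.1 :=
    .clip (by linarith) (LipschitzWith.prod_fst.comp lip_Nut)
  have hu : BddLip fun x => (truncate B x).2.2.2.1 :=
    .clip (by norm_num) (LipschitzWith.prod_fst.comp lip_ut)
  have hat : BddLip fun x => a (truncate B x).2.2.2.2 :=
    ha.comp (g := fun x : CharacteristicState => x.2.2.2.2) (LipschitzWith.prod_snd.comp lip_ut)
  have hl : (0 : ℝ) < 1 / 4 := by norm_num
  have u_ge : ∀ x, 1 / 4 ≤ (truncate B x).2.2.2.1 := fun x => le_clip _ _ _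
  have stretch : BddLip fun x => m / (truncate B x).2.2.2.1 *
      ((truncate B x).1.1 + (truncate B x).2.1) * (truncate B x).2.2.1 * (truncate B x).1.2 := by
    simpa only [div_eq_mul_inv] using
      ((((BddLip.const m).mul (hu.inv hl u_ge)).mul (hp.add hq)).mul hN).mul hQ
  exact ⟨(hN.mul (.slopeRate hat hl hu u_ge hp hq)).prodMk stretch,
    (hQ.mul (.slopeRate hat hl hu u_ge hq hp)).prodMk (stretch.prodMk ((hp.mul hQ).prodMk hQ))⟩

theorem exists_truncated_solution (m : ℝ) {B : ℝ} (hB : 0 ≤ B) {a : ℝ → ℝ} (ha : BddLip a)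
    {U₀ : ℝ → ℝ × ℝ} {V₀ : ℝ → ℝ × ℝ × ℝ × ℝ} (hU₀ : Continuous U₀) (hV₀ : Continuous V₀) :
    ∃ f : ℝ × ℝ → CharacteristicState, Continuous f ∧ (∀ x, f (-x, x) = (U₀ x, V₀ x)) ∧
      (∀ ξ β, HasDerivAt (fun s => (f (s, β)).1) (rateFst m a (truncate B (f (ξ, β)))) ξ) ∧
      ∀ ξ β, HasDerivAt (fun b => (f (ξ, b)).2) (rateSnd m a (truncate B (f (ξ, β)))) β := by
  obtain ⟨⟨⟨K, hF⟩, M, hFM⟩, ⟨K', hG⟩, M', hGM⟩ := bddLip_rate_truncate m hB ha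
  exact exists_characteristic_solution (k := max K K') (M := max M M')
    (hF.weaken (le_max_left _ _)) (hG.weaken (le_max_right _ _)) hU₀ hV₀
    (fun _ _ => (hFM _).trans (le_max_left _ _)) fun _ _ => (hGM _).trans (le_max_right _ _)

theorem continuous_truncate (B : ℝ) : Continuous (truncate B) := by
  unfold truncate
  have := continuous_clip
  fun_prop

theorem truncate_eq_self {B : ℝ} {x : CharacteristicState}
    (hx : Untruncated B x.1.1 x.2.1 x.2.2.1 x.1.2 x.2.2.2.1) : truncate B x = x := by
  obtain ⟨hp, hq, hN, hQ, hu⟩ := hx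
  simp only [truncate, clip_of_mem_Icc (Ioo_subset_Icc_self hp),
    clip_of_mem_Icc (Ioo_subset_Icc_self hq), clip_of_mem_Icc (Ioo_subset_Icc_self hN),
    clip_of_mem_Icc (Ioo_subset_Icc_self hQ), clip_of_mem_Icc (Ioo_subset_Icc_self hu)]

/-- The truncation of a solution `f` of the truncated system solves the characteristic system
wherever its values are not on the boundary of the truncation range. -/
def toCharacteristicSystem {m B : ℝ} {a u₀ p₀ q₀ : ℝ → ℝ} {D : Set (ℝ × ℝ)}
    {f : ℝ × ℝ → CharacteristicState} (hf : Continuous f)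
    (f_diag : ∀ x, truncate B (f (-x, x)) =
      ((p₀ x, 1 / (2 * speed m (u₀ x))), (q₀ x, 1 / (2 * speed m (u₀ x)), u₀ x, 0)))
    (f_fst : ∀ ξ β,
      HasDerivAt (fun s => (f (s, β)).1) (rateFst m a (truncate B (f (ξ, β)))) ξ)
    (f_snd : ∀ ξ β,
      HasDerivAt (fun b => (f (ξ, b)).2) (rateSnd m a (truncate B (f (ξ, β)))) β)
    (hD : ∀ z ∈ D, Untruncated B (truncate B (f z)).1.1 (truncate B (f z)).2.1
      (truncate B (f z)).2.2.1 (truncate B (f z)).1.2 (truncate B (f z)).2.2.2.1) :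
    CharacteristicSystem m a u₀ p₀ q₀ D :=
  have cont := (continuous_truncate B).comp hf
  have V_snd := fun ξ β => hasDerivAt_snd (f_snd ξ β)
  have ut_snd := fun ξ β => hasDerivAt_snd (V_snd ξ β)
  { p := fun z => (truncate B (f z)).1.1
    q := fun z => (truncate B (f z)).2.1
    N := fun z => (truncate B (f z)).2.2.1
    Q := fun z => (truncate B (f z)).1.2
    u := fun z => (truncate B (f z)).2.2.2.1
    t := fun z => (truncate B (f z)).2.2.2.2
    cont_p := cont.fst.fst
    cont_q := cont.snd.fst
    cont_N := cont.snd.snd.fst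
    cont_Q := cont.fst.snd
    cont_u := cont.snd.snd.snd.fst
    cont_t := cont.snd.snd.snd.snd
    u_pos := fun z => lt_of_lt_of_le (by norm_num) (le_clip _ _ _)
    p_diag := fun x => by rw [f_diag]
    q_diag := fun x => by rw [f_diag]
    N_diag := fun x => by rw [f_diag]
    Q_diag := fun x => by rw [f_diag]
    u_diag := fun x => by rw [f_diag]
    t_diag := fun x => by rw [f_diag]
    p_fst := fun ξ β h => hasDerivAt_clip (hasDerivAt_fst (f_fst ξ β)) (hD _ h).1
    Q_fst := fun ξ β h => hasDerivAt_clip (hasDerivAt_snd (f_fst ξ β)) (hD _ h).2.2.2.1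
    q_snd := fun ξ β h => hasDerivAt_clip (hasDerivAt_fst (f_snd ξ β)) (hD _ h).2.1
    N_snd := fun ξ β h => hasDerivAt_clip (hasDerivAt_fst (V_snd ξ β)) (hD _ h).2.2.1
    u_snd := fun ξ β h => hasDerivAt_clip (hasDerivAt_fst (ut_snd ξ β)) (hD _ h).2.2.2.2
    t_snd := fun ξ β _ => (hasDerivAt_snd (ut_snd ξ β) :) }

end CharacteristicState

open CharacteristicState in
theorem exists_characteristicSystem (m : ℝ) {B : ℝ} {a : ℝ → ℝ} (ha : BddLip a)
    {u₀ p₀ q₀ : ℝ → ℝ} (hu₀ : Continuous u₀) (hp₀ : Continuous p₀) (hq₀ : Continuous q₀)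
    (hdata : ∀ x, Untruncated B (p₀ x) (q₀ x) (1 / (2 * speed m (u₀ x)))
      (1 / (2 * speed m (u₀ x))) (u₀ x)) :
    ∃ (D : Set (ℝ × ℝ)) (S : CharacteristicSystem m a u₀ p₀ q₀ D), IsSegmentDomain D ∧
      segmentDomain {z | Untruncated B (S.p z) (S.q z) (S.N z) (S.Q z) (S.u z)} ⊆ D := by
  have hB : 0 ≤ B := by linarith [(hdata 0).2.2.1.1, (hdata 0).2.2.1.2]
  have u₀_pos : ∀ x, 0 < u₀ x := fun x => lt_trans (by norm_num) (hdata x).2.2.2.2.1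
  have hN₀ : Continuous fun x => 1 / (2 * speed m (u₀ x)) :=
    continuous_const.div ((continuous_speed m hu₀ u₀_pos).const_mul 2) fun x =>
      (mul_pos two_pos (speed_pos m (u₀_pos x))).ne'
  obtain ⟨f, hf, f_diag, f_fst, f_snd⟩ := exists_truncated_solution m hB ha
    (U₀ := fun x => (p₀ x, 1 / (2 * speed m (u₀ x))))
    (V₀ := fun x => (q₀ x, 1 / (2 * speed m (u₀ x)), u₀ x, 0)) (by fun_prop) (by fun_prop)
  have cont := (continuous_truncate B).comp hf
  have isOpen_untruncated := Untruncated.isOpen (B := B) cont.fst.fst cont.snd.fst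
    cont.snd.snd.fst cont.fst.snd cont.snd.snd.snd.fst
  exact ⟨_, toCharacteristicSystem hf
      (fun x => (congrArg _ (f_diag x)).trans (truncate_eq_self (hdata x))) f_fst f_snd
      fun z hz => segmentDomain_subset _ hz,
    isSegmentDomain_segmentDomain isOpen_untruncated, subset_rfl⟩

namespace CharacteristicSystem

variable {m : ℝ} {a u₀ p₀ q₀ : ℝ → ℝ} {D : Set (ℝ × ℝ)}
  (S : CharacteristicSystem m a u₀ p₀ q₀ D)

theorem cont_speed : Continuous fun z => speed m (S.u z) := continuous_speed m S.cont_u S.u_pos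

theorem cont_div_u (r : ℝ) : Continuous fun z => r / S.u z :=
  continuous_const.div S.cont_u fun z => (S.u_pos z).ne'

include S in
theorem speed_u₀_pos (x : ℝ) : 0 < speed m (u₀ x) :=
  S.u_diag x ▸ speed_pos m (S.u_pos (-x, x))

theorem speed_snd : HasPartialSnd D (fun z => speed m (S.u z))
    fun z => 2 * (-m / S.u z) * speed m (S.u z) * (S.p z * S.Q z) := fun ξ β h =>
  HasDerivAt.comp (h₂ := speed m) β (hasDerivAt_speed m (S.u_pos (ξ, β))) (S.u_snd ξ β h)

theorem t_fst (hD : IsSegmentDomain D) : HasPartialFst D S.t S.N := by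
  have := S.cont_p
  have := S.cont_q
  have := S.cont_N
  have := S.cont_Q
  have := S.cont_div_u m
  refine S.t_snd.hasPartialFst_of_closed hD S.cont_Q (by fun_prop) (fun x => ?_) S.Q_fst S.N_snd
  simpa only [S.t_diag, S.N_diag, S.Q_diag, sub_self] using hasDerivAt_const x (0 : ℝ)

theorem u_fst (hD : IsSegmentDomain D) (ha : Continuous a) {v₀' u₀' : ℝ → ℝ}
    (hu₀ : ∀ x, HasDerivAt u₀ (u₀' x) x) (hp₀ : ∀ x, p₀ x = v₀' x + speed m (u₀ x) * u₀' x)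
    (hq₀ : ∀ x, q₀ x = v₀' x - speed m (u₀ x) * u₀' x) :
    HasPartialFst D S.u fun z => S.q z * S.N z := by
  have := S.cont_p
  have := S.cont_q
  have := S.cont_N
  have := S.cont_Q
  have := S.cont_t
  have := S.cont_div_u m
  refine S.u_snd.hasPartialFst_of_closed hD (by fun_prop) (H := fun z => S.N z * S.Q z *
      (2 * (m / S.u z) * S.p z * S.q z - a (S.t z) / 2 * (S.p z + S.q z))) (by fun_prop)
      (fun x => ?_) (fun ξ β h => ?_) fun ξ β h => ?_
  · simp only [S.u_diag, S.p_diag, S.q_diag, S.N_diag, S.Q_diag, hp₀, hq₀]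
    refine (hu₀ x).congr_deriv ?_
    have := (S.speed_u₀_pos x).ne'
    field_simp
    ring
  · exact ((S.p_fst ξ β h).mul (S.Q_fst ξ β h)).congr_deriv (by simp only [slopeRate]; ring)
  · exact ((S.q_snd ξ β h).mul (S.N_snd ξ β h)).congr_deriv (by simp only [slopeRate]; ring)

variable {S} (hu_fst : HasPartialFst D S.u fun z => S.q z * S.N z)

include hu_fst

theorem speed_fst : HasPartialFst D (fun z => speed m (S.u z))
    fun z => 2 * (-m / S.u z) * speed m (S.u z) * (S.q z * S.N z) := fun ξ β h =>
  HasDerivAt.comp (h₂ := speed m) ξ (hasDerivAt_speed m (S.u_pos (ξ, β))) (hu_fst ξ β h)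

theorem hasPartialFst_position (hD : IsSegmentDomain D) :
    HasPartialFst D (potential id fun z => speed m (S.u z) * S.Q z)
      fun z => -(speed m (S.u z) * S.N z) := by
  have := S.cont_p
  have := S.cont_q
  have := S.cont_N
  have := S.cont_Q
  have := S.cont_speed
  have := S.cont_div_u m
  refine hasPartialFst_potential hD (H := fun z => speed m (S.u z) * (m / S.u z) *
      (S.p z - S.q z) * S.N z * S.Q z) (by fun_prop) (by fun_prop)
      (fun x => ?_) (fun ξ β h => ?_) fun ξ β h => ?_
  · refine (hasDerivAt_id x).congr_deriv ?_
    simp only [S.u_diag, S.N_diag, S.Q_diag]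
    have := (S.speed_u₀_pos x).ne'
    field_simp
    ring
  · exact ((speed_fst hu_fst ξ β h).mul (S.Q_fst ξ β h)).congr_deriv (by ring)
  · exact ((S.speed_snd ξ β h).mul (S.N_snd ξ β h)).neg.congr_deriv (by ring)

theorem hasPartialFst_velocity (hD : IsSegmentDomain D) {A : ℝ → ℝ} (ha : Continuous a)
    (hA : ∀ s, HasDerivAt A (a s) s) (hA0 : A 0 = 0) {v₀ v₀' u₀' : ℝ → ℝ}
    (hv₀ : ∀ x, HasDerivAt v₀ (v₀' x) x) (hp₀ : ∀ x, p₀ x = v₀' x + speed m (u₀ x) * u₀' x)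
    (hq₀ : ∀ x, q₀ x = v₀' x - speed m (u₀ x) * u₀' x) :
    HasPartialFst D
      (potential v₀ fun z => Real.exp (A (S.t z)) * (speed m (S.u z) * (S.p z * S.Q z)))
      fun z => -(Real.exp (A (S.t z)) * (speed m (S.u z) * (S.q z * S.N z))) := by
  have := S.cont_p
  have := S.cont_q
  have := S.cont_N
  have := S.cont_Q
  have := S.cont_t
  have := S.cont_speed
  have cont_A : Continuous A := continuous_iff_continuousAt.2 fun s => (hA s).continuousAt
  refine hasPartialFst_potential hD (H := fun z => Real.exp (A (S.t z)) * speed m (S.u z) *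
      S.N z * S.Q z * (a (S.t z) / 2) * (S.p z - S.q z)) (by fun_prop) (by fun_prop)
      (fun x => ?_) (fun ξ β h => ?_) fun ξ β h => ?_
  · refine (hv₀ x).congr_deriv ?_
    simp only [S.u_diag, S.N_diag, S.Q_diag, S.p_diag, S.q_diag, S.t_diag, hp₀, hq₀, hA0,
      Real.exp_zero]
    have := (S.speed_u₀_pos x).ne'
    field_simp
    ring
  · refine ((((hA _).comp ξ (S.t_fst hD ξ β h)).exp).mul ((speed_fst hu_fst ξ β h).mul
      ((S.p_fst ξ β h).mul (S.Q_fst ξ β h)))).congr_deriv ?_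
    simp only [Pi.mul_apply, Function.comp_apply, slopeRate]
    ring
  · refine ((((hA _).comp β (S.t_snd ξ β h)).exp).mul ((S.speed_snd ξ β h).mul
      ((S.q_snd ξ β h).mul (S.N_snd ξ β h)))).neg.congr_deriv ?_
    simp only [Pi.mul_apply, Function.comp_apply, slopeRate]
    ring

end CharacteristicSystem

theorem CharacteristicSystem.exists_characteristicSolution {m : ℝ} {a A u₀ u₀' v₀ v₀' p₀ q₀ : ℝ → ℝ}
    {D : Set (ℝ × ℝ)} (S : CharacteristicSystem m a u₀ p₀ q₀ D) (hD : IsSegmentDomain D)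
    (ha : Continuous a) (hA : ∀ s, HasDerivAt A (a s) s) (hA0 : A 0 = 0)
    (hu₀ : ∀ x, HasDerivAt u₀ (u₀' x) x) (hv₀ : ∀ x, HasDerivAt v₀ (v₀' x) x)
    (hp₀ : ∀ x, p₀ x = v₀' x + speed m (u₀ x) * u₀' x)
    (hq₀ : ∀ x, q₀ x = v₀' x - speed m (u₀ x) * u₀' x) :
    ∃ T : CharacteristicSolution m a u₀ v₀ p₀ q₀ D, T.toCharacteristicSystem = S := by
  have := S.cont_p
  have := S.cont_Q
  have := S.cont_t
  have cont_speed := S.cont_speed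
  have cont_A : Continuous A := continuous_iff_continuousAt.2 fun s => (hA s).continuousAt
  have cont_v₀ : Continuous v₀ := continuous_iff_continuousAt.2 fun s => (hv₀ s).continuousAt
  have u_fst := S.u_fst hD ha hu₀ hp₀ hq₀
  -- `w = exp (A t) v` is the potential, since the damping term is absent from its equations.
  set w := potential v₀ fun z => Real.exp (A (S.t z)) * (speed m (S.u z) * (S.p z * S.Q z))
  have w_fst := hasPartialFst_velocity u_fst hD ha hA hA0 hv₀ hp₀ hq₀
  have w_snd : HasPartialSnd D w _ := hasPartialSnd_potential v₀ (by fun_prop) D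
  have cont_w : Continuous w := continuous_potential cont_v₀ (by fun_prop)
  have exp_mul : ∀ s, Real.exp (-s) * Real.exp s = 1 := fun s => by rw [← Real.exp_add]; simp
  refine ⟨{ S with
    X := potential id fun z => speed m (S.u z) * S.Q z
    v := fun z => Real.exp (-A (S.t z)) * w z
    cont_X := continuous_potential continuous_id (by fun_prop)
    cont_v := by fun_prop
    X_diag := potential_diag _ _
    v_diag := fun x => by
      simp only [S.t_diag, hA0, neg_zero, Real.exp_zero, one_mul]
      exact potential_diag _ _ x
    u_fst := u_fst
    t_fst := S.t_fst hD
    X_fst := hasPartialFst_position u_fst hD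
    X_snd := hasPartialSnd_potential id (by fun_prop) D
    v_fst := fun ξ β h => ?_
    v_snd := fun ξ β h => ?_ }, rfl⟩
  · refine (((hA _).comp ξ (S.t_fst hD ξ β h)).neg.exp.mul (w_fst ξ β h)).congr_deriv ?_
    simp only [Function.comp_apply, Pi.neg_apply]
    linear_combination -(speed m (S.u (ξ, β)) * (S.q (ξ, β) * S.N (ξ, β))) *
      exp_mul (A (S.t (ξ, β)))
  · refine (((hA _).comp β (S.t_snd ξ β h)).neg.exp.mul (w_snd ξ β h)).congr_deriv ?_
    simp only [Function.comp_apply, Pi.neg_apply]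
    linear_combination (speed m (S.u (ξ, β)) * (S.p (ξ, β) * S.Q (ξ, β))) *
      exp_mul (A (S.t (ξ, β)))

theorem exists_characteristicSolution (m : ℝ) {B : ℝ} {a A u₀ u₀' v₀ v₀' p₀ q₀ : ℝ → ℝ}
    (ha : BddLip a) (hA : ∀ s, HasDerivAt A (a s) s) (hA0 : A 0 = 0)
    (hu₀ : ∀ x, HasDerivAt u₀ (u₀' x) x) (hv₀ : ∀ x, HasDerivAt v₀ (v₀' x) x)
    (hu₀' : Continuous u₀') (hv₀' : Continuous v₀')
    (hp₀ : ∀ x, p₀ x = v₀' x + speed m (u₀ x) * u₀' x)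
    (hq₀ : ∀ x, q₀ x = v₀' x - speed m (u₀ x) * u₀' x)
    (hdata : ∀ x, Untruncated B (p₀ x) (q₀ x) (1 / (2 * speed m (u₀ x)))
      (1 / (2 * speed m (u₀ x))) (u₀ x)) :
    ∃ (D : Set (ℝ × ℝ)) (S : CharacteristicSolution m a u₀ v₀ p₀ q₀ D), IsOpen D ∧
      segmentDomain {z | Untruncated B (S.p z) (S.q z) (S.N z) (S.Q z) (S.u z)} ⊆ D := by
  have cont_u₀ : Continuous u₀ := continuous_iff_continuousAt.2 fun s => (hu₀ s).continuousAt
  have cont_speed : Continuous fun x => speed m (u₀ x) :=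
    continuous_speed m cont_u₀ fun x => lt_trans (by norm_num) (hdata x).2.2.2.2.1
  have cont_p₀ : Continuous p₀ := (funext hp₀ : p₀ = _) ▸ by fun_prop
  have cont_q₀ : Continuous q₀ := (funext hq₀ : q₀ = _) ▸ by fun_prop
  obtain ⟨K, hK⟩ := ha.1
  obtain ⟨D, S, hD, subset_D⟩ := exists_characteristicSystem m ha cont_u₀ cont_p₀ cont_q₀ hdata
  obtain ⟨T, rfl⟩ := S.exists_characteristicSolution hD hK.continuous hA hA0 hu₀ hv₀ hp₀ hq₀
  exact ⟨D, T, hD.isOpen, subset_D⟩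

/-! ### Comparison and triangles of dependence -/

section Comparison

theorem le_of_hasDerivAt_nonneg {f f' : ℝ → ℝ} {a b : ℝ} (hab : a ≤ b)
    (hf : ContinuousOn f (Icc a b)) (hf' : ∀ s ∈ Ioo a b, HasDerivAt f (f' s) s)
    (nonneg : ∀ s ∈ Ioo a b, 0 ≤ f' s) : f a ≤ f b := by
  refine monotoneOn_of_deriv_nonneg (convex_Icc a b) hf ?_ ?_ (left_mem_Icc.2 hab)
    (right_mem_Icc.2 hab) hab <;> rw [interior_Icc] <;> intro s hs
  · exact (hf' s hs).differentiableAt.differentiableWithinAt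
  · exact (hf' s hs).deriv.symm ▸ nonneg s hs

theorem lt_of_hasDerivAt_pos {f f' : ℝ → ℝ} {a b : ℝ} (hab : a < b)
    (hf : ContinuousOn f (Icc a b)) (hf' : ∀ s ∈ Ioo a b, HasDerivAt f (f' s) s)
    (pos : ∀ s ∈ Ioo a b, 0 < f' s) : f a < f b := by
  refine strictMonoOn_of_deriv_pos (convex_Icc a b) hf ?_ (left_mem_Icc.2 hab.le)
    (right_mem_Icc.2 hab.le) hab
  rw [interior_Icc]
  exact fun s hs => (hf' s hs).deriv.symm ▸ pos s hs

theorem pos_of_hasDerivAt_add_mul_nonneg {f f' k k' : ℝ → ℝ} {a b : ℝ} (hab : a ≤ b)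
    (hf : ContinuousOn f (Icc a b)) (hk : ContinuousOn k (Icc a b))
    (hf' : ∀ s ∈ Ioo a b, HasDerivAt f (f' s) s) (hk' : ∀ s ∈ Ioo a b, HasDerivAt k (k' s) s)
    (nonneg : ∀ s ∈ Ioo a b, 0 ≤ f' s + k' s * f s) (pos : 0 < f a) : 0 < f b := by
  have mono : Real.exp (k a) * f a ≤ Real.exp (k b) * f b :=
    le_of_hasDerivAt_nonneg hab (hk.rexp.mul hf) (fun s hs => (hk' s hs).exp.mul (hf' s hs))
      fun s hs => (mul_nonneg (Real.exp_pos (k s)).le (nonneg s hs)).trans_eq (by ring)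
  exact pos_of_mul_pos_right ((mul_pos (Real.exp_pos _) pos).trans_le mono) (Real.exp_pos _).le

theorem abs_lt_of_hasDerivAt_sub_mul {f g k k' n n' : ℝ → ℝ} {a b : ℝ} (hab : a ≤ b)
    (hf : ContinuousOn f (Icc a b)) (hk : ContinuousOn k (Icc a b)) (hn : ContinuousOn n (Icc a b))
    (hf' : ∀ s ∈ Ioo a b, HasDerivAt f (g s - k' s * f s) s)
    (hk' : ∀ s ∈ Ioo a b, HasDerivAt k (k' s) s) (hn' : ∀ s ∈ Ioo a b, HasDerivAt n (n' s) s)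
    (hg : ∀ s ∈ Ioo a b, |g s| ≤ n' s + k' s * n s) (initial : |f a| < n a) : |f b| < n b := by
  have lower := pos_of_hasDerivAt_add_mul_nonneg hab (hn.add hf) hk
    (fun s hs => (hn' s hs).add (hf' s hs)) hk'
    (fun s hs => by simp only [Pi.add_apply]; linarith [(abs_le.1 (hg s hs)).1])
    (by simp only [Pi.add_apply]; linarith [(abs_lt.1 initial).1])
  have upper := pos_of_hasDerivAt_add_mul_nonneg hab (hn.sub hf) hk
    (fun s hs => (hn' s hs).sub (hf' s hs)) hk'
    (fun s hs => by simp only [Pi.sub_apply]; linarith [(abs_le.1 (hg s hs)).2])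
    (by simp only [Pi.sub_apply]; linarith [(abs_lt.1 initial).2])
  simp only [Pi.add_apply, Pi.sub_apply] at lower upper
  exact abs_lt.2 ⟨by linarith, by linarith⟩

end Comparison

section Primitives

/-- The primitive of `u ^ (-m)`, the square root of the speed of sound, that vanishes at `1`. -/
def theta (m u : ℝ) : ℝ := ∫ s in (1 : ℝ)..u, s ^ (-m)

/-- The primitive of the speed of sound that vanishes at `1`; `v ± eta m u` are the Riemann
invariants. -/
def eta (m u : ℝ) : ℝ := theta (2 * m) u

theorem hasDerivAt_theta (m : ℝ) {u : ℝ} (hu : 0 < u) : HasDerivAt (theta m) (u ^ (-m)) u := by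
  have cont : ContinuousOn (fun s : ℝ => s ^ (-m)) (Ioi 0) := fun s hs =>
    (Real.continuousAt_rpow_const _ _ (Or.inl (ne_of_gt hs))).continuousWithinAt
  have subset : uIcc 1 u ⊆ Ioi 0 := fun s hs => (lt_min one_pos hu).trans_le hs.1
  exact intervalIntegral.integral_hasDerivAt_right (cont.mono subset).intervalIntegrable
    (cont.stronglyMeasurableAtFilter isOpen_Ioi u hu) (cont.continuousAt (Ioi_mem_nhds hu))

theorem hasDerivAt_eta (m : ℝ) {u : ℝ} (hu : 0 < u) : HasDerivAt (eta m) (speed m u) u :=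
  hasDerivAt_theta (2 * m) hu

theorem theta_one (m : ℝ) : theta m 1 = 0 := intervalIntegral.integral_same

theorem pos_of_mem_Icc_half_two {u : ℝ} (hu : u ∈ Icc (1 / 2 : ℝ) 2) : 0 < u :=
  one_half_pos.trans_le hu.1

theorem inv_le_two_of_half_le {u : ℝ} (hu : 1 / 2 ≤ u) : u⁻¹ ≤ 2 :=
  inv_le_of_inv_le₀ two_pos ((one_div (2 : ℝ)).symm.trans_le hu)

theorem rpow_le_two_rpow {m u : ℝ} (hm : 0 ≤ m) (hu : u ∈ Icc (1 / 2 : ℝ) 2) : u ^ m ≤ 2 ^ m :=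
  Real.rpow_le_rpow (pos_of_mem_Icc_half_two hu).le hu.2 hm

theorem rpow_neg_le_two_rpow {m u : ℝ} (hm : 0 ≤ m) (hu : u ∈ Icc (1 / 2 : ℝ) 2) :
    u ^ (-m) ≤ 2 ^ m := by
  have u_pos := pos_of_mem_Icc_half_two hu
  rw [Real.rpow_neg u_pos.le, ← Real.inv_rpow u_pos.le]
  exact Real.rpow_le_rpow (by positivity) (inv_le_two_of_half_le hu.1) hm

theorem inv_two_rpow_le_rpow_neg {m u : ℝ} (hm : 0 ≤ m) (hu : u ∈ Icc (1 / 2 : ℝ) 2) :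
    (2 ^ m)⁻¹ ≤ u ^ (-m) := by
  have u_pos := pos_of_mem_Icc_half_two hu
  rw [Real.rpow_neg u_pos.le]
  exact inv_anti₀ (Real.rpow_pos_of_pos u_pos _) (rpow_le_two_rpow hm hu)

theorem four_rpow (m : ℝ) : (4 : ℝ) ^ m = 2 ^ (2 * m) := by
  rw [Real.rpow_mul two_pos.le]
  norm_num

theorem speed_le_four_rpow {m u : ℝ} (hm : 0 ≤ m) (hu : u ∈ Icc (1 / 2 : ℝ) 2) :
    speed m u ≤ 4 ^ m :=
  four_rpow m ▸ rpow_neg_le_two_rpow (by positivity) hu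

theorem inv_four_rpow_le_speed {m u : ℝ} (hm : 0 ≤ m) (hu : u ∈ Icc (1 / 2 : ℝ) 2) :
    (4 ^ m)⁻¹ ≤ speed m u :=
  four_rpow m ▸ inv_two_rpow_le_rpow_neg (by positivity) hu

theorem abs_theta_le {m u : ℝ} (hm : 0 ≤ m) (hu : u ∈ Icc (1 / 2 : ℝ) 2) :
    |theta m u| ≤ 2 ^ m * |u - 1| := by
  refine intervalIntegral.norm_integral_le_of_norm_le_const (E := ℝ) fun s hs => ?_
  have s_mem : s ∈ Icc (1 / 2 : ℝ) 2 :=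
    uIcc_subset_Icc (by norm_num) hu (uIoc_subset_uIcc hs)
  rw [Real.norm_of_nonneg (Real.rpow_nonneg (pos_of_mem_Icc_half_two s_mem).le _)]
  exact rpow_neg_le_two_rpow hm s_mem

theorem abs_sub_one_le_theta {m u : ℝ} (hm : 0 ≤ m) (hu : u ∈ Icc (1 / 2 : ℝ) 2) :
    |u - 1| ≤ 2 ^ m * |theta m u| := by
  have deriv_theta : ∀ s ∈ Icc (1 / 2 : ℝ) 2, HasDerivAt (theta m) (s ^ (-m)) s := fun s hs =>
    hasDerivAt_theta m (pos_of_mem_Icc_half_two hs)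
  have growth := (convex_Icc (1 / 2 : ℝ) 2).mul_sub_le_image_sub_of_le_deriv (C := (2 ^ m)⁻¹)
    (fun s hs => (deriv_theta s hs).continuousAt.continuousWithinAt)
    (fun s hs =>
      (deriv_theta s (interior_subset hs)).differentiableAt.differentiableWithinAt)
    (fun s hs => (deriv_theta s (interior_subset hs)).deriv.symm ▸
      inv_two_rpow_le_rpow_neg hm (interior_subset hs))
  have one_mem : (1 : ℝ) ∈ Icc (1 / 2 : ℝ) 2 := by norm_num
  rw [← inv_mul_le_iff₀ (by positivity)]
  rcases le_total 1 u with h | h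
  · have := growth 1 one_mem u hu h
    rw [theta_one, sub_zero] at this
    rw [abs_of_nonneg (sub_nonneg.2 h)]
    exact this.trans (le_abs_self _)
  · have := growth u hu 1 one_mem h
    rw [theta_one, zero_sub] at this
    rw [abs_of_nonpos (sub_nonpos.2 h), neg_sub]
    exact this.trans (neg_le_abs _)

theorem abs_sub_one_le_eta {m u : ℝ} (hm : 0 ≤ m) (hu : u ∈ Icc (1 / 2 : ℝ) 2) :
    |u - 1| ≤ 4 ^ m * |eta m u| :=
  four_rpow m ▸ abs_sub_one_le_theta (by positivity) hu

theorem continuous_theta (m : ℝ) {α : Type*} [TopologicalSpace α] {u : α → ℝ}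
    (hu : Continuous u) (hu_pos : ∀ x, 0 < u x) : Continuous fun x => theta m (u x) :=
  continuous_iff_continuousAt.2 fun x =>
    (hasDerivAt_theta m (hu_pos x)).continuousAt.comp hu.continuousAt

theorem continuous_eta (m : ℝ) {α : Type*} [TopologicalSpace α] {u : α → ℝ}
    (hu : Continuous u) (hu_pos : ∀ x, 0 < u x) : Continuous fun x => eta m (u x) :=
  continuous_theta (2 * m) hu hu_pos

end Primitives

section Triangle

/-- A parametrization by the unit square of the triangle with vertices `(ξ, β)`, `(-β, β)` and
`(ξ, -ξ)`, where `z = (ξ, β)`. -/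
def triangle (z k : ℝ × ℝ) : ℝ × ℝ :=
  (-z.2 + k.1 * (z.1 + z.2),
    -(-z.2 + k.1 * (z.1 + z.2)) + k.2 * (z.2 + (-z.2 + k.1 * (z.1 + z.2))))

theorem continuous_triangle : Continuous fun w : (ℝ × ℝ) × (ℝ × ℝ) => triangle w.1 w.2 := by
  unfold triangle
  fun_prop

/-- The unit square, the parameter space of `triangle`. -/
def square : Set (ℝ × ℝ) := Icc (0 : ℝ) 1 ×ˢ Icc (0 : ℝ) 1

theorem isCompact_square : IsCompact square := isCompact_Icc.prod isCompact_Icc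

theorem triangle_mem {z k : ℝ × ℝ} (hz : 0 ≤ z.1 + z.2) (hk : k ∈ square) :
    (triangle z k).1 ≤ z.1 ∧ (triangle z k).2 ≤ z.2 ∧ 0 ≤ (triangle z k).1 + (triangle z k).2 := by
  obtain ⟨⟨k₁_nonneg, k₁_le⟩, k₂_nonneg, k₂_le⟩ := hk
  have width_nonneg : 0 ≤ z.2 + (-z.2 + k.1 * (z.1 + z.2)) := by
    linarith [mul_nonneg k₁_nonneg hz]
  simp only [triangle]
  exact ⟨by nlinarith, by nlinarith, by linarith [mul_nonneg k₂_nonneg width_nonneg]⟩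

theorem exists_mem_Icc_mul_eq {x y : ℝ} (hx : 0 ≤ x) (hxy : x ≤ y) :
    ∃ k ∈ Icc (0 : ℝ) 1, k * y = x := by
  rcases (hx.trans hxy).eq_or_lt with y_eq | y_pos
  · exact ⟨0, by simp, by linarith⟩
  · exact ⟨x / y, ⟨by positivity, (div_le_one y_pos).2 hxy⟩, div_mul_cancel₀ _ y_pos.ne'⟩

theorem exists_triangle_eq {z : ℝ × ℝ} {s b : ℝ} (hs : s ≤ z.1) (hb : b ≤ z.2) (hsb : 0 ≤ s + b) :
    ∃ k ∈ square, triangle z k = (s, b) := by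
  obtain ⟨k₁, hk₁, k₁_eq⟩ : ∃ k₁ ∈ Icc (0 : ℝ) 1, k₁ * (z.1 + z.2) = s + z.2 :=
    exists_mem_Icc_mul_eq (by linarith) (by linarith)
  obtain ⟨k₂, hk₂, k₂_eq⟩ : ∃ k₂ ∈ Icc (0 : ℝ) 1, k₂ * (z.2 + s) = b + s :=
    exists_mem_Icc_mul_eq (by linarith) (by linarith)
  refine ⟨(k₁, k₂), ⟨hk₁, hk₂⟩, ?_⟩
  have fst_eq : -z.2 + k₁ * (z.1 + z.2) = s := by linarith
  simp only [triangle, fst_eq, k₂_eq]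
  congr 1
  ring

theorem exists_isMax_triangle {f : ℝ × ℝ → ℝ} (hf : Continuous f) {z : ℝ × ℝ}
    (hz : 0 ≤ z.1 + z.2) : ∃ ξ β, ξ ≤ z.1 ∧ β ≤ z.2 ∧ 0 ≤ ξ + β ∧
      ∀ s b, s ≤ z.1 → b ≤ z.2 → 0 ≤ s + b → f (s, b) ≤ f (ξ, β) := by
  have cont : Continuous fun k => f (triangle z k) :=
    hf.comp (continuous_triangle.comp (by fun_prop : Continuous fun k : ℝ × ℝ => (z, k)))
  obtain ⟨k, hk, max⟩ := isCompact_square.exists_isMaxOn ⟨(0, 0), by simp [square]⟩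
    cont.continuousOn
  obtain ⟨fst_le, snd_le, nonneg⟩ := triangle_mem hz hk
  refine ⟨_, _, fst_le, snd_le, nonneg, fun s b hs hb hsb => ?_⟩
  obtain ⟨j, hj, triangle_eq⟩ := exists_triangle_eq hs hb hsb
  exact triangle_eq ▸ max hj

/-- The points of the half plane `ξ + β ≥ 0` whose triangle of dependence lies in `G`. -/
def dependenceRegion (G : Set (ℝ × ℝ)) : Set (ℝ × ℝ) :=
  {z | 0 ≤ z.1 + z.2 ∧ ∀ s b, s ≤ z.1 → b ≤ z.2 → 0 ≤ s + b → (s, b) ∈ G}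

theorem mem_dependenceRegion_iff {G : Set (ℝ × ℝ)} {z : ℝ × ℝ} :
    z ∈ dependenceRegion G ↔ 0 ≤ z.1 + z.2 ∧ ∀ k ∈ square, triangle z k ∈ G := by
  refine ⟨fun h => ⟨h.1, fun k hk => ?_⟩, fun h => ⟨h.1, fun s b hs hb hsb => ?_⟩⟩
  · obtain ⟨fst_le, snd_le, nonneg⟩ := triangle_mem h.1 hk
    exact h.2 _ _ fst_le snd_le nonneg
  · obtain ⟨k, hk, triangle_eq⟩ := exists_triangle_eq hs hb hsb
    exact triangle_eq ▸ h.2 k hk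

theorem isClosed_dependenceRegion {G : Set (ℝ × ℝ)} (hG : IsClosed G) :
    IsClosed (dependenceRegion G) := by
  have eq_inter :
      dependenceRegion G = {z | 0 ≤ z.1 + z.2} ∩ ⋂ k ∈ square, {z | triangle z k ∈ G} := by
    ext z
    simp only [mem_dependenceRegion_iff, mem_inter_iff, mem_ofPred_eq, mem_iInter]
  rw [eq_inter]
  refine (isClosed_le continuous_const (by fun_prop)).inter (isClosed_biInter fun k _ => ?_)
  exact hG.preimage (continuous_triangle.comp (by fun_prop : Continuous fun z : ℝ × ℝ => (z, k)))

theorem eventually_mem_dependenceRegion {G : Set (ℝ × ℝ)} {z : ℝ × ℝ}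
    (hz : ∀ s b, s ≤ z.1 → b ≤ z.2 → 0 ≤ s + b → G ∈ 𝓝 (s, b)) (hz0 : 0 ≤ z.1 + z.2) :
    ∀ᶠ w in 𝓝 z, 0 ≤ w.1 + w.2 → w ∈ dependenceRegion G := by
  have near : ∀ᶠ w in 𝓝 z, ∀ k ∈ square, triangle w k ∈ G := by
    refine isCompact_square.eventually_forall_of_forall_eventually
      (P := fun w k => triangle w k ∈ G) fun k hk => ?_
    obtain ⟨fst_le, snd_le, nonneg⟩ := triangle_mem hz0 hk
    exact continuous_triangle.continuousAt.eventually (hz _ _ fst_le snd_le nonneg)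
  filter_upwards [near] with w hw nonneg
  exact mem_dependenceRegion_iff.2 ⟨nonneg, hw⟩

theorem dependenceRegion_mono_point {G : Set (ℝ × ℝ)} {z : ℝ × ℝ} (hz : z ∈ dependenceRegion G)
    {s b : ℝ} (hs : s ≤ z.1) (hb : b ≤ z.2) (hsb : 0 ≤ s + b) : (s, b) ∈ dependenceRegion G :=
  ⟨hsb, fun _ _ hs' hb' nonneg => hz.2 _ _ (hs'.trans hs) (hb'.trans hb) nonneg⟩

theorem dependenceRegion_subset {G : Set (ℝ × ℝ)} : dependenceRegion G ⊆ G :=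
  fun z hz => hz.2 z.1 z.2 le_rfl le_rfl hz.1

end Triangle

/-! ### A priori bounds -/

/-- The modified slope `u ^ (-m) p + (α / 2) θ(u)`. Along its characteristic it satisfies a scalar
Riccati equation in which the slope of the other family no longer occurs. -/
def slope (m α p u : ℝ) : ℝ := u ^ (-m) * p + α / 2 * theta m u

/-- The part of the rate of change of `slope` along its characteristic that is left besides the
damping `-(α / 2) * slope`, when `α'` is the time derivative of the damping coefficient. -/
def slopeSource (m α α' p u : ℝ) : ℝ :=
  -m / u * u ^ (-m) * p ^ 2 + (α ^ 2 / 4 + α' / 2) * theta m u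

theorem rpow_mul_rpow_neg (m : ℝ) {u : ℝ} (hu : 0 < u) : u ^ m * u ^ (-m) = 1 := by
  rw [← Real.rpow_add hu, add_neg_cancel, Real.rpow_zero]

theorem abs_rpow_neg_mul_le {m α p u ν Θ : ℝ} (hα : 0 ≤ α) (hθ : |theta m u| ≤ Θ)
    (hν : |slope m α p u| ≤ ν) : |u ^ (-m) * p| ≤ ν + α * Θ / 2 :=
  calc |u ^ (-m) * p| = |slope m α p u - α / 2 * theta m u| := by rw [slope, add_sub_cancel_right]
    _ ≤ |slope m α p u| + α / 2 * |theta m u| := by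
      refine (abs_sub _ _).trans_eq ?_
      rw [abs_mul, abs_of_nonneg (by positivity : 0 ≤ α / 2)]
    _ ≤ ν + α / 2 * Θ := by gcongr
    _ = ν + α * Θ / 2 := by ring

theorem abs_le_two_rpow_mul {m p u r : ℝ} (hm : 0 ≤ m) (hu : u ∈ Icc (1 / 2 : ℝ) 2)
    (hr : |u ^ (-m) * p| ≤ r) : |p| ≤ 2 ^ m * r := by
  have u_pos := pos_of_mem_Icc_half_two hu
  have rpow_pos := Real.rpow_pos_of_pos u_pos m
  have p_eq : p = u ^ m * (u ^ (-m) * p) := by rw [← mul_assoc, rpow_mul_rpow_neg m u_pos, one_mul]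
  rw [p_eq, abs_mul, abs_of_pos rpow_pos]
  exact mul_le_mul (rpow_le_two_rpow hm hu) hr (abs_nonneg _) (by positivity)

theorem abs_slopeSource_le {m α α' p u r Θ : ℝ} (hm : 0 ≤ m) (hu : u ∈ Icc (1 / 2 : ℝ) 2)
    (hθ : |theta m u| ≤ Θ) (hr : |u ^ (-m) * p| ≤ r) :
    |slopeSource m α α' p u| ≤ 2 * m * 2 ^ m * r ^ 2 + |α ^ 2 / 4 + α' / 2| * Θ := by
  have u_pos := pos_of_mem_Icc_half_two hu
  have sq_le : (u ^ (-m) * p) ^ 2 ≤ r ^ 2 := sq_le_sq' (abs_le.1 hr).1 (abs_le.1 hr).2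
  have quadratic_eq : -m / u * u ^ (-m) * p ^ 2 = -(u⁻¹ * m * u ^ m * (u ^ (-m) * p) ^ 2) := by
    linear_combination (m / u * u ^ (-m) * p ^ 2) * rpow_mul_rpow_neg m u_pos
  have quadratic_le : |-m / u * u ^ (-m) * p ^ 2| ≤ 2 * m * 2 ^ m * r ^ 2 := by
    rw [quadratic_eq, abs_neg, abs_of_nonneg (by positivity)]
    gcongr
    exacts [inv_le_two_of_half_le hu.1, hu.2]
  refine (abs_add_le _ _).trans (add_le_add quadratic_le ?_)
  rw [abs_mul]
  gcongr

theorem abs_sub_one_le_of_invariants {m M₀ v u : ℝ} (hm : 0 ≤ m) (hu : u ∈ Icc (1 / 2 : ℝ) 2)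
    (h_add : |v + eta m u| ≤ M₀) (h_sub : |v - eta m u| ≤ M₀) : |u - 1| ≤ 4 ^ m * M₀ := by
  have eta_le : |eta m u| ≤ M₀ := by
    rw [abs_le] at h_add h_sub ⊢
    constructor <;> linarith
  exact (abs_sub_one_le_eta hm hu).trans (by gcongr)

/-- The bound for `|θ(u)|` that follows from the bound `M₀` for the Riemann invariants. -/
def thetaBound (m M₀ : ℝ) : ℝ := 2 ^ m * (4 ^ m * M₀)

theorem abs_theta_le_thetaBound {m M₀ u : ℝ} (hm : 0 ≤ m) (hu : u ∈ Icc (1 / 2 : ℝ) 2)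
    (hu1 : |u - 1| ≤ 4 ^ m * M₀) : |theta m u| ≤ thetaBound m M₀ :=
  (abs_theta_le hm hu).trans (mul_le_mul_of_nonneg_left hu1 (by positivity))

/-- The closed bootstrap conditions on a state at time `t`. -/
structure Controlled (m B : ℝ) (a n : ℝ → ℝ) (p q N Q u t : ℝ) : Prop where
  p_le : |p| ≤ 1
  q_le : |q| ≤ 1
  u_mem : u ∈ Icc (1 / 2 : ℝ) 2
  N_mem : N ∈ Icc B⁻¹ B
  Q_mem : Q ∈ Icc B⁻¹ B
  slope_p_le : |slope m (a t) p u| ≤ n t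
  slope_q_le : |slope m (a t) q u| ≤ n t

/-- The open version of the bootstrap conditions `Controlled`. -/
structure StrictlyControlled (m B : ℝ) (a n : ℝ → ℝ) (p q N Q u t : ℝ) : Prop where
  p_lt : |p| < 1
  q_lt : |q| < 1
  u_mem : u ∈ Ioo (1 / 2 : ℝ) 2
  N_mem : N ∈ Ioo B⁻¹ B
  Q_mem : Q ∈ Ioo B⁻¹ B
  slope_p_lt : |slope m (a t) p u| < n t
  slope_q_lt : |slope m (a t) q u| < n t

section

variable {m B : ℝ} {a n : ℝ → ℝ} {p q N Q u t : ℝ}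

theorem controlled_iff : Controlled m B a n p q N Q u t ↔
    |p| ≤ 1 ∧ |q| ≤ 1 ∧ u ∈ Icc (1 / 2 : ℝ) 2 ∧ N ∈ Icc B⁻¹ B ∧ Q ∈ Icc B⁻¹ B ∧
      |slope m (a t) p u| ≤ n t ∧ |slope m (a t) q u| ≤ n t :=
  ⟨fun ⟨h₁, h₂, h₃, h₄, h₅, h₆, h₇⟩ => ⟨h₁, h₂, h₃, h₄, h₅, h₆, h₇⟩,
    fun ⟨h₁, h₂, h₃, h₄, h₅, h₆, h₇⟩ => ⟨h₁, h₂, h₃, h₄, h₅, h₆, h₇⟩⟩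

theorem strictlyControlled_iff : StrictlyControlled m B a n p q N Q u t ↔
    |p| < 1 ∧ |q| < 1 ∧ u ∈ Ioo (1 / 2 : ℝ) 2 ∧ N ∈ Ioo B⁻¹ B ∧ Q ∈ Ioo B⁻¹ B ∧
      |slope m (a t) p u| < n t ∧ |slope m (a t) q u| < n t :=
  ⟨fun ⟨h₁, h₂, h₃, h₄, h₅, h₆, h₇⟩ => ⟨h₁, h₂, h₃, h₄, h₅, h₆, h₇⟩,
    fun ⟨h₁, h₂, h₃, h₄, h₅, h₆, h₇⟩ => ⟨h₁, h₂, h₃, h₄, h₅, h₆, h₇⟩⟩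

theorem StrictlyControlled.controlled (h : StrictlyControlled m B a n p q N Q u t) :
    Controlled m B a n p q N Q u t :=
  ⟨h.p_lt.le, h.q_lt.le, Ioo_subset_Icc_self h.u_mem, Ioo_subset_Icc_self h.N_mem,
    Ioo_subset_Icc_self h.Q_mem, h.slope_p_lt.le, h.slope_q_lt.le⟩

theorem Controlled.symm (h : Controlled m B a n p q N Q u t) :
    Controlled m B a n q p Q N u t :=
  ⟨h.q_le, h.p_le, h.u_mem, h.Q_mem, h.N_mem, h.slope_q_le, h.slope_p_le⟩

end

/-- A bound `n` for the slopes, valid up to time `T`, when the damping coefficient is `a` and the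
Riemann invariants are bounded by `M₀`: a small supersolution of the Riccati equation of `slope`.
The number `B` bounds the densities `N`, `Q` and their inverses. -/
structure Barrier (m B T M₀ : ℝ) (a a' n n' : ℝ → ℝ) : Prop where
  m_nonneg : 0 ≤ m
  T_pos : 0 < T
  a_nonneg : ∀ t, 0 ≤ a t
  cont_a : Continuous a
  cont_n : Continuous n
  hasDerivAt_a : ∀ t ∈ Ioo 0 T, HasDerivAt a (a' t) t
  hasDerivAt_n : ∀ t ∈ Ioo 0 T, HasDerivAt n (n' t) t
  supersolution : ∀ t ∈ Ioo 0 T, 2 * m * 2 ^ m * (n t + a t * thetaBound m M₀ / 2) ^ 2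
    + |a t ^ 2 / 4 + a' t / 2| * thetaBound m M₀ ≤ n' t + a t / 2 * n t
  small : ∀ t ∈ Icc 0 T, 2 ^ m * (n t + a t * thetaBound m M₀ / 2) < 1
  M₀_small : 4 ^ m * M₀ < 1 / 2
  B_large : 2 * 4 ^ m * Real.exp (4 * m * T) < B

/-- Bounds for the initial data: `M₀` for the Riemann invariants and `ν` for the slopes, with the
initial value `α` of the damping coefficient. -/
structure DataBounds (m M₀ α ν : ℝ) (u₀ v₀ p₀ q₀ : ℝ → ℝ) : Prop where
  u₀_mem : ∀ x, u₀ x ∈ Icc (1 / 2 : ℝ) 2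
  invariant_add : ∀ x, |v₀ x + eta m (u₀ x)| ≤ M₀
  invariant_sub : ∀ x, |v₀ x - eta m (u₀ x)| ≤ M₀
  slope_p : ∀ x, |slope m α (p₀ x) (u₀ x)| < ν
  slope_q : ∀ x, |slope m α (q₀ x) (u₀ x)| < ν

section

variable {m B T M₀ : ℝ} {a a' n n' u₀ v₀ p₀ q₀ : ℝ → ℝ}

theorem DataBounds.swap {α ν : ℝ} (h : DataBounds m M₀ α ν u₀ v₀ p₀ q₀) :
    DataBounds m M₀ α ν (fun x => u₀ (-x)) (fun x => -v₀ (-x)) (fun x => q₀ (-x))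
      fun x => p₀ (-x) where
  u₀_mem _ := h.u₀_mem _
  invariant_add x := by
    rw [neg_add_eq_sub, abs_sub_comm]
    exact h.invariant_sub (-x)
  invariant_sub x := by
    rw [← neg_add', abs_neg]
    exact h.invariant_add (-x)
  slope_p _ := h.slope_q _
  slope_q _ := h.slope_p _

theorem DataBounds.abs_sub_one_le {α ν : ℝ} (hm : 0 ≤ m) (h : DataBounds m M₀ α ν u₀ v₀ p₀ q₀)
    (x : ℝ) : |u₀ x - 1| ≤ 4 ^ m * M₀ :=
  abs_sub_one_le_of_invariants hm (h.u₀_mem x) (h.invariant_add x) (h.invariant_sub x)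

namespace Barrier

variable (h : Barrier m B T M₀ a a' n n')
include h

theorem two_mul_four_rpow_le_B : 2 * 4 ^ m ≤ B := by
  have one_le_exp : 1 ≤ Real.exp (4 * m * T) :=
    Real.one_le_exp (mul_nonneg (mul_nonneg four_pos.le h.m_nonneg) h.T_pos.le)
  exact (le_mul_of_one_le_right (by positivity) one_le_exp).trans h.B_large.le

theorem B_pos : 0 < B := lt_of_lt_of_le (by positivity) h.two_mul_four_rpow_le_B

theorem abs_lt_one {u p t : ℝ} (hu : u ∈ Icc (1 / 2 : ℝ) 2) (hu1 : |u - 1| ≤ 4 ^ m * M₀)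
    (ht : t ∈ Icc 0 T) (hp : |slope m (a t) p u| ≤ n t) : |p| < 1 :=
  have hθ := abs_theta_le_thetaBound h.m_nonneg hu hu1
  (abs_le_two_rpow_mul h.m_nonneg hu (abs_rpow_neg_mul_le (h.a_nonneg t) hθ hp)).trans_lt
    (h.small t ht)

theorem abs_slopeSource_le {u p t : ℝ} (hu : u ∈ Icc (1 / 2 : ℝ) 2) (hu1 : |u - 1| ≤ 4 ^ m * M₀)
    (ht : t ∈ Ioo 0 T) (hp : |slope m (a t) p u| ≤ n t) :
    |slopeSource m (a t) (a' t) p u| ≤ n' t + a t / 2 * n t :=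
  have hθ := abs_theta_le_thetaBound h.m_nonneg hu hu1
  (DampedEuler.abs_slopeSource_le h.m_nonneg hu hθ
    (abs_rpow_neg_mul_le (h.a_nonneg t) hθ hp)).trans (h.supersolution t ht)

theorem initial_density_mem {u : ℝ} (hu : u ∈ Icc (1 / 2 : ℝ) 2) :
    1 / (2 * speed m u) ∈ Icc (2 * 4 ^ m)⁻¹ (2 * 4 ^ m) := by
  have speed_pos := speed_pos m (pos_of_mem_Icc_half_two hu)
  have le_speed := inv_four_rpow_le_speed h.m_nonneg hu
  rw [inv_le_iff_one_le_mul₀' (by positivity)] at le_speed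
  rw [one_div]
  refine ⟨inv_anti₀ (by positivity) ?_, ?_⟩
  · gcongr
    exact speed_le_four_rpow h.m_nonneg hu
  · rw [inv_le_iff_one_le_mul₀' (by positivity)]
    linarith

theorem initial_controlled (h₀ : DataBounds m M₀ (a 0) (n 0) u₀ v₀ p₀ q₀) (x : ℝ) :
    Controlled m B a n (p₀ x) (q₀ x) (1 / (2 * speed m (u₀ x))) (1 / (2 * speed m (u₀ x))) (u₀ x)
      0 :=
  have zero_mem : (0 : ℝ) ∈ Icc 0 T := ⟨le_rfl, h.T_pos.le⟩
  have hu1 := h₀.abs_sub_one_le h.m_nonneg x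
  have density_mem : 1 / (2 * speed m (u₀ x)) ∈ Icc B⁻¹ B :=
    Icc_subset_Icc (inv_anti₀ (by positivity) h.two_mul_four_rpow_le_B) h.two_mul_four_rpow_le_B
      (h.initial_density_mem (h₀.u₀_mem x))
  { p_le := (h.abs_lt_one (h₀.u₀_mem x) hu1 zero_mem (h₀.slope_p x).le).le
    q_le := (h.abs_lt_one (h₀.u₀_mem x) hu1 zero_mem (h₀.slope_q x).le).le
    u_mem := h₀.u₀_mem x
    N_mem := density_mem
    Q_mem := density_mem
    slope_p_le := (h₀.slope_p x).le
    slope_q_le := (h₀.slope_q x).le }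

end Barrier

end

theorem abs_log_le_of_mem_Icc {x c : ℝ} (hc : 0 < c) (hx : x ∈ Icc c⁻¹ c) :
    |Real.log x| ≤ Real.log c := by
  have x_pos : 0 < x := (inv_pos.2 hc).trans_le hx.1
  exact abs_le.2 ⟨by simpa only [Real.log_inv] using Real.log_le_log (inv_pos.2 hc) hx.1,
    Real.log_le_log x_pos hx.2⟩

theorem mem_Ioo_of_abs_log_lt {x c : ℝ} (hx : 0 < x) (hc : 0 < c)
    (hlog : |Real.log x| < Real.log c) : x ∈ Ioo c⁻¹ c := by
  obtain ⟨lower, upper⟩ := abs_lt.1 hlog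
  rw [← Real.log_inv] at lower
  exact ⟨(Real.log_lt_log_iff (inv_pos.2 hc) hx).1 lower, (Real.log_lt_log_iff hx hc).1 upper⟩

namespace CharacteristicSolution

variable {m B T M₀ : ℝ} {a a' n n' u₀ v₀ p₀ q₀ : ℝ → ℝ} {D : Set (ℝ × ℝ)}

/-- The points at which the bootstrap conditions hold in the whole triangle of dependence. -/
def region (S : CharacteristicSolution m a u₀ v₀ p₀ q₀ D) (B : ℝ) (n : ℝ → ℝ) : Set (ℝ × ℝ) :=
  dependenceRegion {z | Controlled m B a n (S.p z) (S.q z) (S.N z) (S.Q z) (S.u z) (S.t z)}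

section Region

variable (S : CharacteristicSolution m a u₀ v₀ p₀ q₀ D)

theorem controlled_of_mem_region {z : ℝ × ℝ} (hz : z ∈ S.region B n) :
    Controlled m B a n (S.p z) (S.q z) (S.N z) (S.Q z) (S.u z) (S.t z) :=
  dependenceRegion_subset hz

theorem mem_region_swap {z : ℝ × ℝ} : z ∈ S.swap.region B n ↔ z.swap ∈ S.region B n := by
  constructor <;> exact fun h => ⟨by simpa only [Prod.fst_swap, Prod.snd_swap, add_comm] using h.1,
    fun s b hs hb hsb => (h.2 b s hb hs (by rwa [add_comm])).symm⟩

theorem region_swap_subset (hR : S.region B n ⊆ D) : S.swap.region B n ⊆ Prod.swap ⁻¹' D :=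
  fun _ hz => hR (S.mem_region_swap.1 hz)

theorem N_pos (hB : 0 < B) {z : ℝ × ℝ} (hz : z ∈ S.region B n) : 0 < S.N z :=
  (inv_pos.2 hB).trans_le (S.controlled_of_mem_region hz).N_mem.1

theorem Q_pos (hB : 0 < B) {z : ℝ × ℝ} (hz : z ∈ S.region B n) : 0 < S.Q z :=
  (inv_pos.2 hB).trans_le (S.controlled_of_mem_region hz).Q_mem.1

theorem line_mem_region {ξ β : ℝ} (hz : (ξ, β) ∈ S.region B n) {s : ℝ} (hs : s ∈ Icc (-β) ξ) :
    (s, β) ∈ S.region B n :=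
  dependenceRegion_mono_point hz hs.2 le_rfl (by linarith [hs.1])

theorem t_lt_fst (hB : 0 < B) (hR : S.region B n ⊆ D) {ξ β s : ℝ} (hz : (ξ, β) ∈ S.region B n)
    (hβs : -β ≤ s) (hsξ : s < ξ) : S.t (s, β) < S.t (ξ, β) := by
  have line_mem : ∀ x ∈ Ioo s ξ, (x, β) ∈ S.region B n := fun x hx =>
    S.line_mem_region hz ⟨hβs.trans hx.1.le, hx.2.le⟩
  exact lt_of_hasDerivAt_pos hsξ (S.cont_t.comp (.prodMk_left β)).continuousOn
    (fun x hx => S.t_fst x β (hR (line_mem x hx))) (fun x hx => S.N_pos hB (line_mem x hx))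

theorem t_lt_snd (hB : 0 < B) (hR : S.region B n ⊆ D) {ξ β b : ℝ} (hz : (ξ, β) ∈ S.region B n)
    (hξb : -ξ ≤ b) (hbβ : b < β) : S.t (ξ, b) < S.t (ξ, β) :=
  S.swap.t_lt_fst hB (S.region_swap_subset hR) (S.mem_region_swap.2 hz) hξb hbβ

theorem t_pos (hB : 0 < B) (hR : S.region B n ⊆ D) {ξ β : ℝ} (hz : (ξ, β) ∈ S.region B n)
    (hβξ : -β < ξ) : 0 < S.t (ξ, β) :=
  (S.t_diag β).symm.trans_lt (S.t_lt_fst hB hR hz le_rfl hβξ)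

theorem t_mono (hB : 0 < B) (hR : S.region B n ⊆ D) {ξ β s b : ℝ}
    (hz : (ξ, β) ∈ S.region B n) (hs : s ≤ ξ) (hb : b ≤ β) (hsb : 0 ≤ s + b) :
    S.t (s, b) ≤ S.t (ξ, β) := by
  have snd_le : S.t (s, b) ≤ S.t (s, β) := by
    rcases hb.eq_or_lt with rfl | hb
    · rfl
    · exact (S.t_lt_snd hB hR (dependenceRegion_mono_point hz hs le_rfl (by linarith))
        (by linarith) hb).le
  rcases hs.eq_or_lt with rfl | hs
  · exact snd_le
  · exact snd_le.trans (S.t_lt_fst hB hR hz (by linarith) hs).le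

theorem t_nonneg (hB : 0 < B) (hR : S.region B n ⊆ D) {z : ℝ × ℝ} (hz : z ∈ S.region B n) :
    0 ≤ S.t z :=
  (S.t_diag z.2).symm.trans_le
    (S.t_mono hB hR hz (by linarith [hz.1]) le_rfl (neg_add_cancel z.2).ge)

/-- Comparison along a left-going characteristic, with time as the parameter. -/
theorem abs_lt_of_transport (hB : 0 < B) (hR : S.region B n ⊆ D) {ξ β : ℝ}
    (hz : (ξ, β) ∈ S.region B n) {f G : ℝ × ℝ → ℝ} {κ ν ν' : ℝ → ℝ}
    (hf : ContinuousOn (fun s => f (s, β)) (Icc (-β) ξ)) (hκ : Continuous κ) (hν : Continuous ν)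
    (hν' : ∀ t ∈ Ioo 0 (S.t (ξ, β)), HasDerivAt ν (ν' t) t)
    (f_fst : ∀ s ∈ Ioo (-β) ξ, HasDerivAt (fun s => f (s, β))
      (S.N (s, β) * (G (s, β) - κ (S.t (s, β)) * f (s, β))) s)
    (hG : ∀ s ∈ Ioo (-β) ξ,
      |G (s, β)| ≤ ν' (S.t (s, β)) + κ (S.t (s, β)) * ν (S.t (s, β)))
    (initial : |f (-β, β)| < ν 0) : |f (ξ, β)| < ν (S.t (ξ, β)) := by
  have cont_t : Continuous fun s => S.t (s, β) := S.cont_t.comp (.prodMk_left β)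
  have line_mem : ∀ s ∈ Ioo (-β) ξ, (s, β) ∈ S.region B n := fun s hs =>
    S.line_mem_region hz ⟨hs.1.le, hs.2.le⟩
  have t_fst : ∀ s ∈ Ioo (-β) ξ, HasDerivAt (fun s => S.t (s, β)) (S.N (s, β)) s := fun s hs =>
    S.t_fst s β (hR (line_mem s hs))
  have primitive_deriv : ∀ t, HasDerivAt (fun t => ∫ τ in (0 : ℝ)..t, κ τ) (κ t) t := fun t =>
    hκ.integral_hasStrictDerivAt 0 t |>.hasDerivAt
  have cont_primitive : Continuous fun t => ∫ τ in (0 : ℝ)..t, κ τ :=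
    continuous_iff_continuousAt.2 fun t => (primitive_deriv t).continuousAt
  refine abs_lt_of_hasDerivAt_sub_mul (by linarith [hz.1]) hf
    (cont_primitive.comp cont_t).continuousOn (hν.comp cont_t).continuousOn
    (g := fun s => S.N (s, β) * G (s, β)) (k' := fun s => κ (S.t (s, β)) * S.N (s, β))
    (n' := fun s => ν' (S.t (s, β)) * S.N (s, β)) (fun s hs => ?_) (fun s hs => ?_)
    (fun s hs => ?_) (fun s hs => ?_) ?_
  · exact (f_fst s hs).congr_deriv (by ring)
  · exact (primitive_deriv _).comp s (t_fst s hs)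
  · exact (hν' _ ⟨S.t_pos hB hR (line_mem s hs) hs.1,
      S.t_lt_fst hB hR hz hs.1.le hs.2⟩).comp s (t_fst s hs)
  · have N_pos := S.N_pos hB (line_mem s hs)
    rw [abs_mul, abs_of_pos N_pos]
    exact (mul_le_mul_of_nonneg_left (hG s hs) N_pos.le).trans_eq
      (by simp only [Function.comp_apply]; ring)
  · simpa only [Function.comp_apply, S.t_diag] using initial

end Region

variable {S : CharacteristicSolution m a u₀ v₀ p₀ q₀ D}

theorem invariant_add_lt (h : Barrier m B T M₀ a a' n n')
    (h₀ : DataBounds m M₀ (a 0) (n 0) u₀ v₀ p₀ q₀) (hR : S.region B n ⊆ D) {ξ β M : ℝ}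
    (hz : (ξ, β) ∈ S.region B n)
    (sub_le : ∀ s ∈ Icc (-β) ξ, |S.v (s, β) - eta m (S.u (s, β))| ≤ M) (hM : M₀ < M) :
    |S.v (ξ, β) + eta m (S.u (ξ, β))| < M := by
  have cont : Continuous fun z => S.v z + eta m (S.u z) :=
    S.cont_v.add (continuous_eta m S.cont_u S.u_pos)
  refine S.abs_lt_of_transport h.B_pos hR hz (f := fun z => S.v z + eta m (S.u z))
    (G := fun z => -(a (S.t z) / 2 * (S.v z - eta m (S.u z)))) (κ := fun t => a t / 2)
    (ν := fun _ => M) (ν' := fun _ => 0) (cont.comp (.prodMk_left β)).continuousOn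
    (h.cont_a.div_const 2) continuous_const (fun t _ => hasDerivAt_const t M) (fun s hs => ?_)
    (fun s hs => ?_) ?_
  · have hD := hR (S.line_mem_region hz ⟨hs.1.le, hs.2.le⟩)
    have eta_fst := HasDerivAt.comp (h₂ := eta m) s (hasDerivAt_eta m (S.u_pos (s, β)))
      (S.u_fst s β hD)
    exact ((S.v_fst s β hD).add eta_fst).congr_deriv (by ring)
  · have half_nonneg : 0 ≤ a (S.t (s, β)) / 2 := div_nonneg (h.a_nonneg _) two_pos.le
    rw [abs_neg, abs_mul, abs_of_nonneg half_nonneg, zero_add]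
    exact mul_le_mul_of_nonneg_left (sub_le s ⟨hs.1.le, hs.2.le⟩) half_nonneg
  · simp only [S.v_diag, S.u_diag]
    exact (h₀.invariant_add β).trans_lt hM

/-- The larger of the absolute values of the two Riemann invariants. -/
def invariantMax (S : CharacteristicSolution m a u₀ v₀ p₀ q₀ D) (z : ℝ × ℝ) : ℝ :=
  max |S.v z + eta m (S.u z)| |S.v z - eta m (S.u z)|

theorem invariantMax_swap (S : CharacteristicSolution m a u₀ v₀ p₀ q₀ D) (z : ℝ × ℝ) :
    S.swap.invariantMax z = S.invariantMax z.swap := by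
  change max |-S.v z.swap + eta m (S.u z.swap)| |-S.v z.swap - eta m (S.u z.swap)| = _
  rw [neg_add_eq_sub, abs_sub_comm, ← neg_add', abs_neg, max_comm, invariantMax]

theorem continuous_invariantMax (S : CharacteristicSolution m a u₀ v₀ p₀ q₀ D) :
    Continuous S.invariantMax :=
  have cont_eta := continuous_eta m S.cont_u S.u_pos
  (S.cont_v.add cont_eta).abs.max (S.cont_v.sub cont_eta).abs

theorem invariantMax_lt (h : Barrier m B T M₀ a a' n n')
    (h₀ : DataBounds m M₀ (a 0) (n 0) u₀ v₀ p₀ q₀) (hR : S.region B n ⊆ D) {ξ β M : ℝ}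
    (hz : (ξ, β) ∈ S.region B n)
    (le : ∀ s b, s ≤ ξ → b ≤ β → 0 ≤ s + b → S.invariantMax (s, b) ≤ M) (hM : M₀ < M) :
    S.invariantMax (ξ, β) < M := by
  refine max_lt (S.invariant_add_lt h h₀ hR hz (fun s hs => (le_max_right _ _).trans
    (le s β hs.2 le_rfl (by linarith [hs.1]))) hM) ?_
  have swap_lt := S.swap.invariant_add_lt h h₀.swap (S.region_swap_subset hR) (ξ := β) (β := ξ)
    (S.mem_region_swap.2 hz) (fun b hb => (le_max_right _ _).trans
      ((S.invariantMax_swap _).trans_le (le ξ b le_rfl hb.2 (by linarith [hb.1])))) hM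
  rwa [show S.swap.v (β, ξ) = -S.v (ξ, β) from rfl, show S.swap.u (β, ξ) = S.u (ξ, β) from rfl,
    neg_add_eq_sub, abs_sub_comm] at swap_lt

/-- Otherwise the maximum over the triangle of dependence is not attained. -/
theorem invariantMax_le (h : Barrier m B T M₀ a a' n n')
    (h₀ : DataBounds m M₀ (a 0) (n 0) u₀ v₀ p₀ q₀) (hR : S.region B n ⊆ D) {z : ℝ × ℝ}
    (hz : z ∈ S.region B n) : S.invariantMax z ≤ M₀ := by
  obtain ⟨ξ, β, hξ, hβ, nonneg, max⟩ := exists_isMax_triangle S.continuous_invariantMax hz.1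
  refine (max z.1 z.2 le_rfl le_rfl hz.1).trans (not_lt.1 fun hlt => ?_)
  exact lt_irrefl _ (S.invariantMax_lt h h₀ hR (dependenceRegion_mono_point hz hξ hβ nonneg)
    (fun s b hs hb => max s b (hs.trans hξ) (hb.trans hβ)) hlt)

theorem abs_u_sub_one_le (h : Barrier m B T M₀ a a' n n')
    (h₀ : DataBounds m M₀ (a 0) (n 0) u₀ v₀ p₀ q₀) (hR : S.region B n ⊆ D) {z : ℝ × ℝ}
    (hz : z ∈ S.region B n) : |S.u z - 1| ≤ 4 ^ m * M₀ := by
  obtain ⟨add_le, sub_le⟩ := max_le_iff.1 (S.invariantMax_le h h₀ hR hz)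
  exact abs_sub_one_le_of_invariants h.m_nonneg (S.controlled_of_mem_region hz).u_mem add_le sub_le

theorem continuous_slope (S : CharacteristicSolution m a u₀ v₀ p₀ q₀ D) (ha : Continuous a)
    {p : ℝ × ℝ → ℝ} (hp : Continuous p) : Continuous fun z => slope m (a (S.t z)) (p z) (S.u z) :=
  ((S.cont_u.rpow_const fun _ => Or.inl (S.u_pos _).ne').mul hp).add
    (((ha.comp S.cont_t).div_const 2).mul (continuous_theta m S.cont_u S.u_pos))

theorem hasDerivAt_slope {ξ β : ℝ} (hD : (ξ, β) ∈ D)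
    (ha : HasDerivAt a (a' (S.t (ξ, β))) (S.t (ξ, β))) :
    HasDerivAt (fun s => slope m (a (S.t (s, β))) (S.p (s, β)) (S.u (s, β)))
      (S.N (ξ, β) * (slopeSource m (a (S.t (ξ, β))) (a' (S.t (ξ, β))) (S.p (ξ, β)) (S.u (ξ, β))
        - a (S.t (ξ, β)) / 2 * slope m (a (S.t (ξ, β))) (S.p (ξ, β)) (S.u (ξ, β)))) ξ := by
  have u_pos := S.u_pos (ξ, β)
  have rpow_fst := HasDerivAt.comp (h₂ := fun y : ℝ => y ^ (-m)) ξ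
    (Real.hasDerivAt_rpow_const (Or.inl u_pos.ne')) (S.u_fst ξ β hD)
  have theta_fst := HasDerivAt.comp (h₂ := theta m) ξ (hasDerivAt_theta m u_pos) (S.u_fst ξ β hD)
  have damping_fst := HasDerivAt.comp (h₂ := a) (h := fun s => S.t (s, β)) ξ ha (S.t_fst ξ β hD)
  refine ((rpow_fst.mul (S.p_fst ξ β hD)).add
    ((damping_fst.div_const 2).mul theta_fst)).congr_deriv ?_
  simp only [Function.comp_apply, slope, slopeSource, slopeRate]
  rw [Real.rpow_sub_one u_pos.ne']
  ring

theorem slope_lt (h : Barrier m B T M₀ a a' n n')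
    (h₀ : DataBounds m M₀ (a 0) (n 0) u₀ v₀ p₀ q₀) (hR : S.region B n ⊆ D) {ξ β : ℝ}
    (hz : (ξ, β) ∈ S.region B n) (hT : S.t (ξ, β) ≤ T) :
    |slope m (a (S.t (ξ, β))) (S.p (ξ, β)) (S.u (ξ, β))| < n (S.t (ξ, β)) := by
  have time_subset : Ioo 0 (S.t (ξ, β)) ⊆ Ioo 0 T := Ioo_subset_Ioo_right hT
  have t_mem : ∀ s ∈ Ioo (-β) ξ, S.t (s, β) ∈ Ioo 0 T := fun s hs =>
    time_subset ⟨S.t_pos h.B_pos hR (S.line_mem_region hz ⟨hs.1.le, hs.2.le⟩) hs.1,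
      S.t_lt_fst h.B_pos hR hz hs.1.le hs.2⟩
  refine S.abs_lt_of_transport h.B_pos hR hz (κ := fun t => a t / 2) (ν' := n')
    (f := fun z => slope m (a (S.t z)) (S.p z) (S.u z))
    (G := fun z => slopeSource m (a (S.t z)) (a' (S.t z)) (S.p z) (S.u z))
    ((S.continuous_slope h.cont_a S.cont_p).comp (.prodMk_left β)).continuousOn
    (h.cont_a.div_const 2) h.cont_n (fun t ht => h.hasDerivAt_n t (time_subset ht))
    (fun s hs => ?_) (fun s hs => ?_) ?_
  · exact S.hasDerivAt_slope (hR (S.line_mem_region hz ⟨hs.1.le, hs.2.le⟩))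
      (h.hasDerivAt_a _ (t_mem s hs))
  · have hs_mem := S.line_mem_region hz ⟨hs.1.le, hs.2.le⟩
    have controlled := S.controlled_of_mem_region hs_mem
    exact h.abs_slopeSource_le controlled.u_mem (S.abs_u_sub_one_le h h₀ hR hs_mem) (t_mem s hs)
      controlled.slope_p_le
  · simp only [S.t_diag, S.u_diag, S.p_diag]
    exact h₀.slope_p β

theorem abs_stretch_rate_le (hm : 0 ≤ m) {z : ℝ × ℝ} (hz : z ∈ S.region B n) :
    |m / S.u z * (S.p z + S.q z)| ≤ 4 * m := by
  have controlled := S.controlled_of_mem_region hz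
  have inv_le := inv_le_two_of_half_le controlled.u_mem.1
  have u_pos := S.u_pos z
  have sum_le : |S.p z + S.q z| ≤ 2 :=
    (abs_add_le _ _).trans (by linarith [controlled.p_le, controlled.q_le])
  rw [abs_mul, abs_of_nonneg (by positivity), div_eq_mul_inv]
  calc m * (S.u z)⁻¹ * |S.p z + S.q z| ≤ m * 2 * 2 := by gcongr
    _ = 4 * m := by ring

theorem Q_mem (h : Barrier m B T M₀ a a' n n') (h₀ : DataBounds m M₀ (a 0) (n 0) u₀ v₀ p₀ q₀)
    (hR : S.region B n ⊆ D) {ξ β : ℝ} (hz : (ξ, β) ∈ S.region B n) (hT : S.t (ξ, β) ≤ T) :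
    S.Q (ξ, β) ∈ Ioo B⁻¹ B := by
  have margin : Real.log (2 * 4 ^ m) < Real.log B - 4 * m * T := by
    have log_lt := Real.log_lt_log (by positivity) h.B_large
    rw [Real.log_mul (by positivity) (Real.exp_pos _).ne', Real.log_exp] at log_lt
    linarith
  have log_lt : |Real.log (S.Q (ξ, β))| < 4 * m * S.t (ξ, β) + (Real.log B - 4 * m * T) := by
    refine S.abs_lt_of_transport h.B_pos hR hz (f := fun z => Real.log (S.Q z)) (κ := fun _ => 0)
      (G := fun z => m / S.u z * (S.p z + S.q z)) (ν' := fun _ => 4 * m)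
      (ν := fun t => 4 * m * t + (Real.log B - 4 * m * T)) (fun s hs => ?_) continuous_const
      (by fun_prop) (fun t _ => ?_) (fun s hs => ?_) (fun s hs => ?_) ?_
    · exact ((S.cont_Q.comp (.prodMk_left β)).continuousAt.log
        (S.Q_pos h.B_pos (S.line_mem_region hz hs)).ne').continuousWithinAt
    · simpa only [mul_one, id] using ((hasDerivAt_id t).const_mul (4 * m)).add_const _
    · have hs_mem := S.line_mem_region hz ⟨hs.1.le, hs.2.le⟩
      have Q_pos := S.Q_pos h.B_pos hs_mem
      refine ((S.Q_fst s β (hR hs_mem)).log Q_pos.ne').congr_deriv ?_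
      rw [div_eq_iff Q_pos.ne']
      ring
    · simpa only [zero_mul, add_zero] using
        S.abs_stretch_rate_le h.m_nonneg (S.line_mem_region hz ⟨hs.1.le, hs.2.le⟩)
    · simp only [S.Q_diag, mul_zero, zero_add]
      exact (abs_log_le_of_mem_Icc (by positivity) (h.initial_density_mem (h₀.u₀_mem β))).trans_lt
        margin
  have time_le : 4 * m * S.t (ξ, β) ≤ 4 * m * T :=
    mul_le_mul_of_nonneg_left hT (mul_nonneg four_pos.le h.m_nonneg)
  exact mem_Ioo_of_abs_log_lt (S.Q_pos h.B_pos hz) h.B_pos (by linarith)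

/-- The bootstrap: up to time `T` the closed conditions imply the open ones. -/
theorem strictlyControlled (h : Barrier m B T M₀ a a' n n')
    (h₀ : DataBounds m M₀ (a 0) (n 0) u₀ v₀ p₀ q₀) (hR : S.region B n ⊆ D) {z : ℝ × ℝ}
    (hz : z ∈ S.region B n) (hT : S.t z ≤ T) :
    StrictlyControlled m B a n (S.p z) (S.q z) (S.N z) (S.Q z) (S.u z) (S.t z) :=
  have controlled := S.controlled_of_mem_region hz
  have t_mem : S.t z ∈ Icc 0 T := ⟨S.t_nonneg h.B_pos hR hz, hT⟩
  have hu1 := S.abs_u_sub_one_le h h₀ hR hz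
  have u_near_one := abs_lt.1 (hu1.trans_lt h.M₀_small)
  have hz_swap : z.swap ∈ S.swap.region B n := S.mem_region_swap.2 hz
  have hR_swap := S.region_swap_subset hR
  { p_lt := h.abs_lt_one controlled.u_mem hu1 t_mem controlled.slope_p_le
    q_lt := h.abs_lt_one controlled.u_mem hu1 t_mem controlled.slope_q_le
    u_mem := ⟨by linarith [u_near_one.1], by linarith [u_near_one.2]⟩
    N_mem := S.swap.Q_mem h h₀.swap hR_swap hz_swap hT
    Q_mem := S.Q_mem h h₀ hR hz hT
    slope_p_lt := S.slope_lt h h₀ hR hz hT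
    slope_q_lt := S.swap.slope_lt h h₀.swap hR_swap hz_swap hT }

theorem diag_mem_region (S : CharacteristicSolution m a u₀ v₀ p₀ q₀ D)
    (h : Barrier m B T M₀ a a' n n') (h₀ : DataBounds m M₀ (a 0) (n 0) u₀ v₀ p₀ q₀) (x : ℝ) :
    (-x, x) ∈ S.region B n := by
  refine ⟨(neg_add_cancel x).ge, fun s b hs hb hsb => ?_⟩
  obtain rfl : b = x := by linarith
  obtain rfl : s = -b := by linarith
  simp only [mem_ofPred_eq, S.p_diag, S.q_diag, S.N_diag, S.Q_diag, S.u_diag, S.t_diag]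
  exact h.initial_controlled h₀ b

theorem isClosed_region (S : CharacteristicSolution m a u₀ v₀ p₀ q₀ D) (ha : Continuous a)
    (hn : Continuous n) : IsClosed (S.region B n) := by
  have cont_n := hn.comp S.cont_t
  refine isClosed_dependenceRegion ?_
  simp only [controlled_iff]
  exact (isClosed_le S.cont_p.abs continuous_const).inter <|
    (isClosed_le S.cont_q.abs continuous_const).inter <|
    (isClosed_Icc.preimage S.cont_u).inter <| (isClosed_Icc.preimage S.cont_N).inter <|
    (isClosed_Icc.preimage S.cont_Q).inter <|
    (isClosed_le (S.continuous_slope ha S.cont_p).abs cont_n).inter <|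
    isClosed_le (S.continuous_slope ha S.cont_q).abs cont_n

theorem isOpen_strictlyControlled (S : CharacteristicSolution m a u₀ v₀ p₀ q₀ D)
    (ha : Continuous a) (hn : Continuous n) :
    IsOpen {z | StrictlyControlled m B a n (S.p z) (S.q z) (S.N z) (S.Q z) (S.u z) (S.t z)} := by
  have cont_n := hn.comp S.cont_t
  simp only [strictlyControlled_iff]
  exact (isOpen_lt S.cont_p.abs continuous_const).inter <|
    (isOpen_lt S.cont_q.abs continuous_const).inter <|
    (isOpen_Ioo.preimage S.cont_u).inter <| (isOpen_Ioo.preimage S.cont_N).inter <|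
    (isOpen_Ioo.preimage S.cont_Q).inter <|
    (isOpen_lt (S.continuous_slope ha S.cont_p).abs cont_n).inter <|
    isOpen_lt (S.continuous_slope ha S.cont_q).abs cont_n

theorem eventually_mem_region (h : Barrier m B T M₀ a a' n n')
    (h₀ : DataBounds m M₀ (a 0) (n 0) u₀ v₀ p₀ q₀) (hR : S.region B n ⊆ D) {z : ℝ × ℝ}
    (hz : z ∈ S.region B n) (hT : S.t z ≤ T) :
    ∀ᶠ w in 𝓝 z, 0 ≤ w.1 + w.2 → w ∈ S.region B n := by
  refine eventually_mem_dependenceRegion (fun s b hs hb hsb => ?_) hz.1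
  have strict := S.strictlyControlled h h₀ hR (dependenceRegion_mono_point hz hs hb hsb)
    ((S.t_mono h.B_pos hR hz hs hb hsb).trans hT)
  exact mem_of_superset ((S.isOpen_strictlyControlled h.cont_a h.cont_n).mem_nhds strict)
    fun w hw => StrictlyControlled.controlled hw

end CharacteristicSolution

/-! ### Return to time and space -/

/-- The differential of `(ξ, β) ↦ (t, x)`, where `c` is the characteristic speed. -/
def charEquiv {N Q c : ℝ} (hN : N ≠ 0) (hQ : Q ≠ 0) (hc : c ≠ 0) : (ℝ × ℝ) ≃L[ℝ] (ℝ × ℝ) :=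
  ContinuousLinearEquiv.equivOfInverse
    ((planeForm N Q).prod (planeForm (-(c * N)) (c * Q)))
    ((planeForm (1 / (2 * N)) (-(1 / (2 * c * N)))).prod
      (planeForm (1 / (2 * Q)) (1 / (2 * c * Q))))
    (fun z => by ext <;> simp <;> field_simp <;> ring)
    (fun z => by ext <;> simp <;> field_simp <;> ring)

namespace CharacteristicSolution

variable {m B T M₀ : ℝ} {a a' n n' u₀ v₀ p₀ q₀ : ℝ → ℝ} {D : Set (ℝ × ℝ)}

/-- The map from characteristic coordinates to time and space. -/
def toTimeSpace (S : CharacteristicSolution m a u₀ v₀ p₀ q₀ D) (z : ℝ × ℝ) : ℝ × ℝ :=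
  (S.t z, S.X z)

variable (S : CharacteristicSolution m a u₀ v₀ p₀ q₀ D)

theorem hasStrictFDerivAt_toTimeSpace (hD : IsOpen D) {z : ℝ × ℝ} (hz : z ∈ D)
    (hN : S.N z ≠ 0) (hQ : S.Q z ≠ 0) :
    HasStrictFDerivAt S.toTimeSpace
      (charEquiv hN hQ (speed_pos m (S.u_pos z)).ne' : ℝ × ℝ →L[ℝ] ℝ × ℝ) z := by
  have cont_speed := continuous_speed m S.cont_u S.u_pos
  have t_deriv := hasStrictFDerivAt_of_partials hD S.cont_Q S.cont_N S.t_fst S.t_snd hz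
  have X_deriv := hasStrictFDerivAt_of_partials hD (cont_speed.mul S.cont_Q)
    (cont_speed.mul S.cont_N).neg S.X_fst S.X_snd hz
  exact t_deriv.prodMk X_deriv

theorem X_lt_fst (hB : 0 < B) (hR : S.region B n ⊆ D) {ξ β s : ℝ}
    (hz : (ξ, β) ∈ S.region B n) (hβs : -β ≤ s) (hsξ : s < ξ) : S.X (ξ, β) < S.X (s, β) := by
  have line_mem : ∀ x ∈ Ioo s ξ, (x, β) ∈ S.region B n := fun x hx =>
    S.line_mem_region hz ⟨hβs.trans hx.1.le, hx.2.le⟩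
  refine neg_lt_neg_iff.1 (lt_of_hasDerivAt_pos hsξ (f := fun x => -S.X (x, β))
    (S.cont_X.comp (.prodMk_left β)).neg.continuousOn
    (fun x hx => (S.X_fst x β (hR (line_mem x hx))).neg) fun x hx => ?_)
  rw [neg_neg]
  exact mul_pos (speed_pos m (S.u_pos _)) (S.N_pos hB (line_mem x hx))

theorem X_lt_snd (hB : 0 < B) (hR : S.region B n ⊆ D) {ξ β b : ℝ}
    (hz : (ξ, β) ∈ S.region B n) (hξb : -ξ ≤ b) (hbβ : b < β) : S.X (ξ, b) < S.X (ξ, β) :=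
  neg_lt_neg_iff.1 (S.swap.X_lt_fst hB (S.region_swap_subset hR) (S.mem_region_swap.2 hz) hξb hbβ)

theorem X_le_snd_coord (hB : 0 < B) (hR : S.region B n ⊆ D) {ξ β : ℝ}
    (hz : (ξ, β) ∈ S.region B n) : S.X (ξ, β) ≤ β := by
  have nonneg : 0 ≤ ξ + β := hz.1
  rcases (neg_le_iff_add_nonneg.2 nonneg).eq_or_lt with rfl | hlt
  · exact (S.X_diag β).le
  · exact (S.X_lt_fst hB hR hz le_rfl hlt).le.trans_eq (S.X_diag β)

theorem neg_fst_coord_le_X (hB : 0 < B) (hR : S.region B n ⊆ D) {ξ β : ℝ}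
    (hz : (ξ, β) ∈ S.region B n) : -ξ ≤ S.X (ξ, β) :=
  neg_le.2 (S.swap.X_le_snd_coord hB (S.region_swap_subset hR) (S.mem_region_swap.2 hz))

/-- The speed of propagation is at most `4 ^ m`. -/
theorem snd_coord_le_X_add (hm : 0 ≤ m) (hB : 0 < B) (hR : S.region B n ⊆ D) {ξ β : ℝ}
    (hz : (ξ, β) ∈ S.region B n) : β ≤ S.X (ξ, β) + 4 ^ m * S.t (ξ, β) := by
  have line_mem : ∀ x ∈ Ioo (-β) ξ, (x, β) ∈ S.region B n := fun x hx =>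
    S.line_mem_region hz ⟨hx.1.le, hx.2.le⟩
  have X_add_le := le_of_hasDerivAt_nonneg (f := fun x => S.X (x, β) + 4 ^ m * S.t (x, β))
    (neg_le_iff_add_nonneg.2 hz.1)
    ((S.cont_X.add (S.cont_t.const_mul _)).comp (.prodMk_left β)).continuousOn
    (fun x hx => (S.X_fst x β (hR (line_mem x hx))).add
      ((S.t_fst x β (hR (line_mem x hx))).const_mul _))
    (fun x hx => by
      have speed_le := speed_le_four_rpow hm (S.controlled_of_mem_region (line_mem x hx)).u_mem
      rw [neg_add_eq_sub, ← sub_mul]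
      exact mul_nonneg (sub_nonneg.2 speed_le) (S.N_pos hB (line_mem x hx)).le)
  simpa only [S.X_diag, S.t_diag, mul_zero, add_zero] using X_add_le

theorem X_sub_le_neg_fst_coord (hm : 0 ≤ m) (hB : 0 < B) (hR : S.region B n ⊆ D) {ξ β : ℝ}
    (hz : (ξ, β) ∈ S.region B n) : S.X (ξ, β) ≤ -ξ + 4 ^ m * S.t (ξ, β) := by
  have swap_le := S.swap.snd_coord_le_X_add hm hB (S.region_swap_subset hR)
    (S.mem_region_swap.2 hz : (β, ξ) ∈ _)
  simp only [swap, Prod.swap_prod_mk] at swap_le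
  linarith

theorem fst_le_of_toTimeSpace_eq (hB : 0 < B) (hR : S.region B n ⊆ D) {z w : ℝ × ℝ}
    (hz : z ∈ S.region B n) (hw : w ∈ S.region B n) (heq : S.toTimeSpace z = S.toTimeSpace w) :
    w.1 ≤ z.1 := by
  obtain ⟨t_eq, X_eq⟩ := Prod.ext_iff.1 heq
  simp only [toTimeSpace] at t_eq X_eq
  by_contra! fst_lt
  have snd_lt : w.2 < z.2 := by
    by_contra! snd_le
    have t_le := S.t_mono hB hR hw le_rfl snd_le (by linarith [hz.1])
    have t_lt := S.t_lt_fst hB hR (dependenceRegion_mono_point hw le_rfl snd_le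
      (by linarith [hz.1])) (by linarith [hz.1] : -z.2 ≤ z.1) fst_lt
    linarith
  rcases le_or_gt 0 (z.1 + w.2) with meet | disjoint
  · have X_lt_z := S.X_lt_snd hB hR hz (by linarith) snd_lt
    have X_lt_w := S.X_lt_fst hB hR hw (by linarith) fst_lt
    linarith
  · have z_le := S.neg_fst_coord_le_X hB hR hz
    have w_le := S.X_le_snd_coord hB hR hw
    linarith

theorem toTimeSpace_injOn (hB : 0 < B) (hR : S.region B n ⊆ D) :
    InjOn S.toTimeSpace (S.region B n) := by
  rintro ⟨ξ, β₁⟩ h₁ ⟨ξ₂, β₂⟩ h₂ heq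
  obtain rfl : ξ = ξ₂ := le_antisymm (S.fst_le_of_toTimeSpace_eq hB hR h₂ h₁ heq.symm)
    (S.fst_le_of_toTimeSpace_eq hB hR h₁ h₂ heq)
  have t_eq : S.t (ξ, β₁) = S.t (ξ, β₂) := congrArg Prod.fst heq
  rcases lt_trichotomy β₁ β₂ with hlt | rfl | hlt
  · exact absurd t_eq (S.t_lt_snd hB hR h₂ (neg_le_iff_add_nonneg'.2 h₁.1) hlt).ne
  · rfl
  · exact absurd t_eq (S.t_lt_snd hB hR h₁ (neg_le_iff_add_nonneg'.2 h₂.1) hlt).ne'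

/-- Below the initial line time is negative, since it increases with `β`. -/
theorem eventually_add_nonneg (hB : 0 < B) (hD : IsOpen D) (hR : S.region B n ⊆ D)
    {z : ℝ × ℝ} (hz : z ∈ S.region B n) : ∀ᶠ w in 𝓝 z, 0 ≤ S.t w → 0 ≤ w.1 + w.2 := by
  rcases (show 0 ≤ z.1 + z.2 from hz.1).eq_or_lt with on_diag | interior
  · have good : ∀ᶠ w in 𝓝 z, w ∈ D ∧ 0 < S.Q w := (hD.eventually_mem (hR hz)).and
      (S.cont_Q.continuousAt.eventually (lt_mem_nhds (S.Q_pos hB hz)))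
    have tube : ∀ᶠ w in 𝓝 z, ∀ b ∈ Ioo w.2 (-w.1), (w.1, b) ∈ D ∧ 0 < S.Q (w.1, b) := by
      obtain ⟨δ, δ_pos, good_ball⟩ := Metric.eventually_nhds_iff_ball.1 good
      filter_upwards [Metric.ball_mem_nhds z δ_pos] with w hw b hb
      refine good_ball _ ?_
      rw [Metric.mem_ball, Prod.dist_eq, max_lt_iff, Real.dist_eq, Real.dist_eq, abs_lt,
        abs_lt] at hw ⊢
      refine ⟨hw.1, ?_, ?_⟩ <;> linarith [hb.1, hb.2, hw.1.1, hw.2.1]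
    filter_upwards [tube] with w hw ht
    by_contra! below
    have t_lt : S.t (w.1, w.2) < S.t (w.1, -w.1) :=
      lt_of_hasDerivAt_pos (by linarith) (S.cont_t.comp (.prodMk_right w.1)).continuousOn
        (fun b hb => S.t_snd w.1 b (hw b hb).1) fun b hb => (hw b hb).2
    have t_zero : S.t (w.1, -w.1) = 0 := by simpa only [neg_neg] using S.t_diag (-w.1)
    exact ht.not_gt (t_lt.trans_eq t_zero)
  · filter_upwards [continuousAt_fst.add continuousAt_snd |>.eventually (lt_mem_nhds interior)]
      with w hw _ using hw.le

theorem eventually_mem_region_of_t_nonneg (h : Barrier m B T M₀ a a' n n')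
    (h₀ : DataBounds m M₀ (a 0) (n 0) u₀ v₀ p₀ q₀) (hD : IsOpen D) (hR : S.region B n ⊆ D)
    {z : ℝ × ℝ} (hz : z ∈ S.region B n) (hT : S.t z ≤ T) :
    ∀ᶠ w in 𝓝 z, 0 ≤ S.t w → w ∈ S.region B n := by
  filter_upwards [S.eventually_mem_region h h₀ hR hz hT, S.eventually_add_nonneg h.B_pos hD hR hz]
    with w mem_of_add add_of_t ht using mem_of_add (add_of_t ht)

theorem isCompact_region_inter (hm : 0 ≤ m) (hB : 0 < B) (ha : Continuous a) (hn : Continuous n)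
    (hR : S.region B n ⊆ D) (T x : ℝ) :
    IsCompact (S.region B n ∩ {z | S.X z = x} ∩ {z | S.t z ≤ T}) := by
  have closed : IsClosed (S.region B n ∩ {z | S.X z = x} ∩ {z | S.t z ≤ T}) :=
    ((S.isClosed_region ha hn).inter (isClosed_eq S.cont_X continuous_const)).inter
      (isClosed_le S.cont_t continuous_const)
  refine (isCompact_Icc (a := -x) (b := -x + 4 ^ m * T)).prod
    (isCompact_Icc (a := x) (b := x + 4 ^ m * T)) |>.of_isClosed_subset closed ?_
  rintro ⟨ξ, β⟩ ⟨⟨hz, rfl⟩, ht⟩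
  have travel_le : 4 ^ m * S.t (ξ, β) ≤ 4 ^ m * T :=
    mul_le_mul_of_nonneg_left ht (Real.rpow_nonneg four_pos.le m)
  have := S.X_sub_le_neg_fst_coord hm hB hR hz
  have := S.snd_coord_le_X_add hm hB hR hz
  exact ⟨⟨neg_le.1 (S.neg_fst_coord_le_X hB hR hz), by linarith⟩, S.X_le_snd_coord hB hR hz,
    by linarith⟩

theorem eventually_mem_image_region (h : Barrier m B T M₀ a a' n n')
    (h₀ : DataBounds m M₀ (a 0) (n 0) u₀ v₀ p₀ q₀) (hD : IsOpen D) (hR : S.region B n ⊆ D)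
    {z : ℝ × ℝ} (hz : z ∈ S.region B n) (hT : S.t z ≤ T) :
    ∀ᶠ y in 𝓝 (S.toTimeSpace z), 0 ≤ y.1 → y ∈ S.toTimeSpace '' S.region B n := by
  have image_mem := image_mem_map (m := S.toTimeSpace)
    (S.eventually_mem_region_of_t_nonneg h h₀ hD hR hz hT)
  rw [(S.hasStrictFDerivAt_toTimeSpace hD (hR hz) (S.N_pos h.B_pos hz).ne'
    (S.Q_pos h.B_pos hz).ne').map_nhds_eq_of_equiv] at image_mem
  filter_upwards [image_mem]
  rintro _ ⟨w, hw, rfl⟩ ht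
  exact ⟨w, hw ht, rfl⟩

/-- By continuous induction in time at a fixed place. -/
theorem mem_image_region (h : Barrier m B T M₀ a a' n n')
    (h₀ : DataBounds m M₀ (a 0) (n 0) u₀ v₀ p₀ q₀) (hD : IsOpen D) (hR : S.region B n ⊆ D)
    {τ : ℝ} (hτ : τ ∈ Icc 0 T) (x : ℝ) : (τ, x) ∈ S.toTimeSpace '' S.region B n := by
  suffices Icc 0 T ⊆ {τ | (τ, x) ∈ S.toTimeSpace '' S.region B n} from this hτ
  refine IsClosed.Icc_subset_of_forall_exists_gt ?_
    ⟨(-x, x), S.diag_mem_region h h₀ x, Prod.ext (S.t_diag x) (S.X_diag x)⟩ ?_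
  · have times_eq : {τ | (τ, x) ∈ S.toTimeSpace '' S.region B n} ∩ Icc 0 T
        = S.t '' (S.region B n ∩ {z | S.X z = x} ∩ {z | S.t z ≤ T}) := by
      ext τ
      constructor
      · rintro ⟨⟨z, hz, hzx⟩, hτ⟩
        obtain ⟨rfl, rfl⟩ := Prod.ext_iff.1 hzx
        exact ⟨z, ⟨⟨hz, rfl⟩, hτ.2⟩, rfl⟩
      · rintro ⟨z, ⟨⟨hz, rfl⟩, ht⟩, rfl⟩
        exact ⟨⟨z, hz, rfl⟩, S.t_nonneg h.B_pos hR hz, ht⟩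
    rw [times_eq]
    exact ((S.isCompact_region_inter h.m_nonneg h.B_pos h.cont_a h.cont_n hR T x).image
      S.cont_t).isClosed
  · rintro τ ⟨⟨z, hz, hzx⟩, hτ⟩ τ' hτ'
    obtain ⟨rfl, rfl⟩ := Prod.ext_iff.1 hzx
    have curve : ContinuousAt (fun σ : ℝ => (σ, S.X z)) (S.t z) := by fun_prop
    have reached := (curve.eventually (S.eventually_mem_image_region h h₀ hD hR hz
      hτ.2.le)).filter_mono (nhdsWithin_le_nhds (s := Ioi (S.t z)))
    obtain ⟨σ, hσ, σ_mem⟩ := (reached.and (Ioc_mem_nhdsGT hτ')).exists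
    exact ⟨σ, hσ (hτ.1.trans σ_mem.1.le), σ_mem⟩

/-- On the strip `0 ≤ t < T`, the map `g` is the inverse of `toTimeSpace` with values in the
bootstrap region. -/
structure IsInverse (B : ℝ) (n : ℝ → ℝ) (T : ℝ) (g : ℝ × ℝ → ℝ × ℝ) : Prop where
  mem_region : ∀ y ∈ Ico 0 T ×ˢ (univ : Set ℝ), g y ∈ S.region B n
  toTimeSpace_eq : ∀ y ∈ Ico 0 T ×ˢ (univ : Set ℝ), S.toTimeSpace (g y) = y

theorem hasFDerivWithinAt_inverse (h : Barrier m B T M₀ a a' n n')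
    (h₀ : DataBounds m M₀ (a 0) (n 0) u₀ v₀ p₀ q₀) (hD : IsOpen D) (hR : S.region B n ⊆ D)
    {g : ℝ × ℝ → ℝ × ℝ} (hg : S.IsInverse B n T g) {y : ℝ × ℝ}
    (hy : y ∈ Ico 0 T ×ˢ (univ : Set ℝ)) :
    HasFDerivWithinAt g
      ((planeForm (1 / (2 * S.N (g y))) (-(1 / (2 * speed m (S.u (g y)) * S.N (g y))))).prod
        (planeForm (1 / (2 * S.Q (g y))) (1 / (2 * speed m (S.u (g y)) * S.Q (g y)))))
      (Ico 0 T ×ˢ univ) y := by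
  have hz := hg.mem_region y hy
  have strict := S.hasStrictFDerivAt_toTimeSpace hD (hR hz) (S.N_pos h.B_pos hz).ne'
    (S.Q_pos h.B_pos hz).ne'
  have local_deriv := strict.to_localInverse.hasFDerivAt.hasFDerivWithinAt
    (s := Ico 0 T ×ˢ (univ : Set ℝ))
  have local_tendsto := strict.localInverse_tendsto
  have right_inverse := strict.eventually_right_inverse
  have local_apply := strict.localInverse_apply_image
  rw [hg.toTimeSpace_eq y hy] at local_deriv local_tendsto right_inverse local_apply
  refine local_deriv.congr_of_eventuallyEq ?_ local_apply.symm
  have t_le : S.t (g y) ≤ T := (congrArg Prod.fst (hg.toTimeSpace_eq y hy)).trans_le hy.1.2.le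
  have local_mem := local_tendsto.eventually
    (S.eventually_mem_region_of_t_nonneg h h₀ hD hR hz t_le)
  filter_upwards [local_mem.filter_mono nhdsWithin_le_nhds,
    right_inverse.filter_mono nhdsWithin_le_nhds, self_mem_nhdsWithin] with w mem_of_t right hw
  refine S.toTimeSpace_injOn h.B_pos hR (hg.mem_region w hw) (mem_of_t ?_)
    ((hg.toTimeSpace_eq w hw).trans right.symm)
  exact hw.1.1.trans_eq (congrArg Prod.fst right).symm

theorem exists_isInverse (h : Barrier m B T M₀ a a' n n')
    (h₀ : DataBounds m M₀ (a 0) (n 0) u₀ v₀ p₀ q₀) (hD : IsOpen D) (hR : S.region B n ⊆ D) :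
    ∃ g, S.IsInverse B n T g := by
  have reached : ∀ y : ℝ × ℝ, ∃ z, y ∈ Ico 0 T ×ˢ (univ : Set ℝ) →
      z ∈ S.region B n ∧ S.toTimeSpace z = y := by
    intro y
    by_cases hy : y ∈ Ico 0 T ×ˢ (univ : Set ℝ)
    · obtain ⟨z, hz⟩ := S.mem_image_region h h₀ hD hR (Ico_subset_Icc_self hy.1) y.2
      exact ⟨z, fun _ => hz⟩
    · exact ⟨0, fun h => absurd h hy⟩
  choose g hg using reached
  exact ⟨g, fun y hy => (hg y hy).1, fun y hy => (hg y hy).2⟩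

end CharacteristicSolution

section Strip

theorem planeForm_comp_prod (a b c d e f : ℝ) :
    (planeForm a b).comp ((planeForm c d).prod (planeForm e f))
      = planeForm (a * c + b * e) (a * d + b * f) := by
  ext <;> simp

theorem contDiffOn_of_planeForm {U : Set (ℝ × ℝ)} (hU : UniqueDiffOn ℝ U) {f a b : ℝ × ℝ → ℝ}
    (hf : ∀ y ∈ U, HasFDerivWithinAt f (planeForm (a y) (b y)) U y)
    (ha : ContinuousOn a U) (hb : ContinuousOn b U) : ContDiffOn ℝ 1 f U := by
  rw [← zero_add (1 : WithTop ℕ∞), contDiffOn_succ_iff_hasFDerivWithinAt_of_uniqueDiffOn hU]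
  refine ⟨by simp, fun y => planeForm (a y) (b y), contDiffOn_zero.2 ?_, hf⟩
  exact (ha.smul continuousOn_const).add (hb.smul continuousOn_const)

theorem dt_eq_of_hasFDerivWithinAt {T : ℝ} {f : ℝ × ℝ → ℝ} {a b t x : ℝ} (ht : t ∈ Ico 0 T)
    (hf : HasFDerivWithinAt f (planeForm a b) (Ico 0 T ×ˢ univ) (t, x)) :
    dt T (fun t x => f (t, x)) t x = a := by
  have curve : HasDerivWithinAt (fun s : ℝ => (s, x)) ((1 : ℝ), (0 : ℝ)) (Ico 0 T) t :=
    (hasDerivWithinAt_id t _).prodMk (hasDerivWithinAt_const t _ x)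
  have maps : MapsTo (fun s : ℝ => (s, x)) (Ico 0 T) (Ico 0 T ×ˢ univ) := fun _ hs =>
    ⟨hs, mem_univ x⟩
  have comp_deriv := hf.comp_hasDerivWithinAt t curve maps
  simp only [planeForm_apply, mul_one, mul_zero, add_zero] at comp_deriv
  exact comp_deriv.derivWithin (uniqueDiffOn_Ico 0 T t ht)

theorem hasDerivAt_of_hasFDerivWithinAt_strip {T : ℝ} {f : ℝ × ℝ → ℝ} {a b t x : ℝ}
    (ht : t ∈ Ico 0 T) (hf : HasFDerivWithinAt f (planeForm a b) (Ico 0 T ×ˢ univ) (t, x)) :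
    HasDerivAt (fun y => f (t, y)) b x := by
  have curve : HasDerivWithinAt (fun y : ℝ => (t, y)) ((0 : ℝ), (1 : ℝ)) univ x :=
    (hasDerivWithinAt_const x _ t).prodMk (hasDerivWithinAt_id x _)
  have maps : MapsTo (fun y : ℝ => (t, y)) univ (Ico 0 T ×ˢ univ) := fun y _ =>
    ⟨ht, mem_univ y⟩
  have comp_deriv := hf.comp_hasDerivWithinAt x curve maps
  simp only [planeForm_apply, mul_one, mul_zero, zero_add] at comp_deriv
  exact hasDerivWithinAt_univ.1 comp_deriv

theorem hasDerivAt_pressure {m γ u : ℝ} (hγ : γ ≠ 0) (hm : 4 * m = γ + 1) (hu : 0 < u) :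
    HasDerivAt (pressure γ) (-speed m u ^ 2) u := by
  have speed_sq : speed m u ^ 2 = u ^ (-γ - 1) := by
    rw [speed, ← Real.rpow_mul_natCast hu.le]
    congr 1
    push_cast
    linarith
  rw [speed_sq]
  refine ((Real.hasDerivAt_rpow_const (Or.inl hu.ne')).div_const γ).congr_deriv ?_
  rw [neg_mul, neg_div, mul_div_cancel_left₀ _ hγ]

end Strip

namespace Controlled

variable {m B : ℝ} {a n : ℝ → ℝ} {p q N Q u t : ℝ}

theorem abs_half_add_le (h : Controlled m B a n p q N Q u t) : |(p + q) / 2| ≤ 1 := by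
  have p_le := abs_le.1 h.p_le
  have q_le := abs_le.1 h.q_le
  exact abs_le.2 ⟨by linarith, by linarith⟩

theorem abs_half_sub_le (h : Controlled m B a n p q N Q u t) : |(p - q) / 2| ≤ 1 := by
  have p_le := abs_le.1 h.p_le
  have q_le := abs_le.1 h.q_le
  exact abs_le.2 ⟨by linarith, by linarith⟩

theorem abs_speed_mul_half_sub_le (h : Controlled m B a n p q N Q u t) (hm : 0 ≤ m) :
    |speed m u * ((p - q) / 2)| ≤ 4 ^ m := by
  rw [abs_mul, abs_of_pos (speed_pos m (pos_of_mem_Icc_half_two h.u_mem))]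
  exact (mul_le_mul (speed_le_four_rpow hm h.u_mem) h.abs_half_sub_le (abs_nonneg _)
    (by positivity)).trans_eq (mul_one _)

theorem abs_sub_div_two_mul_speed_le (h : Controlled m B a n p q N Q u t) (hm : 0 ≤ m) :
    |(p - q) / (2 * speed m u)| ≤ 4 ^ m := by
  have inv_pos := inv_pos.2 (speed_pos m (pos_of_mem_Icc_half_two h.u_mem))
  rw [← div_div, div_eq_mul_inv _ (speed m u), abs_mul, abs_of_pos inv_pos]
  exact (mul_le_of_le_one_left inv_pos.le h.abs_half_sub_le).trans
    (inv_le_of_inv_le₀ (by positivity) (inv_four_rpow_le_speed hm h.u_mem))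

theorem abs_speed_sq_le (h : Controlled m B a n p q N Q u t) (hm : 0 ≤ m) :
    |speed m u ^ 2| ≤ (4 ^ m) ^ 2 := by
  rw [abs_pow, abs_of_pos (speed_pos m (pos_of_mem_Icc_half_two h.u_mem))]
  exact pow_le_pow_left₀ (speed_pos m (pos_of_mem_Icc_half_two h.u_mem)).le
    (speed_le_four_rpow hm h.u_mem) 2

end Controlled

namespace CharacteristicSolution

section TimeSpace

variable {m B T M₀ : ℝ} {a a' n n' u₀ v₀ p₀ q₀ : ℝ → ℝ} {D : Set (ℝ × ℝ)}
  {S : CharacteristicSolution m a u₀ v₀ p₀ q₀ D} {g : ℝ × ℝ → ℝ × ℝ}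

theorem hasFDerivWithinAt_u_comp (h : Barrier m B T M₀ a a' n n')
    (h₀ : DataBounds m M₀ (a 0) (n 0) u₀ v₀ p₀ q₀) (hD : IsOpen D) (hR : S.region B n ⊆ D)
    (hg : S.IsInverse B n T g) {y : ℝ × ℝ} (hy : y ∈ Ico 0 T ×ˢ (univ : Set ℝ)) :
    HasFDerivWithinAt (fun y => S.u (g y))
      (planeForm ((S.p (g y) + S.q (g y)) / 2)
        ((S.p (g y) - S.q (g y)) / (2 * speed m (S.u (g y))))) (Ico 0 T ×ˢ univ) y := by
  have hz := hg.mem_region y hy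
  have N_pos := S.N_pos h.B_pos hz
  have Q_pos := S.Q_pos h.B_pos hz
  have speed_pos := speed_pos m (S.u_pos (g y))
  have u_deriv : HasStrictFDerivAt S.u
      (planeForm (S.q (g y) * S.N (g y)) (S.p (g y) * S.Q (g y))) (g y) :=
    hasStrictFDerivAt_of_partials hD (S.cont_p.mul S.cont_Q) (S.cont_q.mul S.cont_N)
      S.u_fst S.u_snd (hR hz)
  refine (u_deriv.hasFDerivAt.comp_hasFDerivWithinAt y
    (S.hasFDerivWithinAt_inverse h h₀ hD hR hg hy)).congr_fderiv ?_
  rw [planeForm_comp_prod]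
  congr 1 <;> field_simp <;> ring

theorem hasFDerivWithinAt_v_comp (h : Barrier m B T M₀ a a' n n')
    (h₀ : DataBounds m M₀ (a 0) (n 0) u₀ v₀ p₀ q₀) (hD : IsOpen D) (hR : S.region B n ⊆ D)
    (hg : S.IsInverse B n T g) {y : ℝ × ℝ} (hy : y ∈ Ico 0 T ×ˢ (univ : Set ℝ)) :
    HasFDerivWithinAt (fun y => S.v (g y))
      (planeForm (-(a (S.t (g y)) * S.v (g y))
          + speed m (S.u (g y)) * ((S.p (g y) - S.q (g y)) / 2))
        ((S.p (g y) + S.q (g y)) / 2)) (Ico 0 T ×ˢ univ) y := by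
  have hz := hg.mem_region y hy
  have N_pos := S.N_pos h.B_pos hz
  have Q_pos := S.Q_pos h.B_pos hz
  have speed_pos := speed_pos m (S.u_pos (g y))
  have cont_speed := continuous_speed m S.cont_u S.u_pos
  have cont_av := (h.cont_a.comp S.cont_t).mul S.cont_v
  have v_deriv : HasStrictFDerivAt S.v (planeForm
      (-(a (S.t (g y)) * S.v (g y) * S.N (g y)) - speed m (S.u (g y)) * S.q (g y) * S.N (g y))
      (-(a (S.t (g y)) * S.v (g y) * S.Q (g y)) + speed m (S.u (g y)) * S.p (g y) * S.Q (g y)))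
      (g y) :=
    hasStrictFDerivAt_of_partials hD
      ((cont_av.mul S.cont_Q).neg.add ((cont_speed.mul S.cont_p).mul S.cont_Q))
      ((cont_av.mul S.cont_N).neg.sub ((cont_speed.mul S.cont_q).mul S.cont_N))
      S.v_fst S.v_snd (hR hz)
  refine (v_deriv.hasFDerivAt.comp_hasFDerivWithinAt y
    (S.hasFDerivWithinAt_inverse h h₀ hD hR hg hy)).congr_fderiv ?_
  rw [planeForm_comp_prod]
  congr 1 <;> field_simp <;> ring

theorem contDiffOn_comp (h : Barrier m B T M₀ a a' n n')
    (h₀ : DataBounds m M₀ (a 0) (n 0) u₀ v₀ p₀ q₀) (hD : IsOpen D) (hR : S.region B n ⊆ D)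
    (hg : S.IsInverse B n T g) :
    ContDiffOn ℝ 1 (fun y => S.u (g y)) (Ico 0 T ×ˢ univ) ∧
      ContDiffOn ℝ 1 (fun y => S.v (g y)) (Ico 0 T ×ˢ univ) := by
  have cont_g : ContinuousOn g (Ico 0 T ×ˢ univ) := fun y hy =>
    (S.hasFDerivWithinAt_inverse h h₀ hD hR hg hy).continuousWithinAt
  have uniqueDiff : UniqueDiffOn ℝ (Ico 0 T ×ˢ (univ : Set ℝ)) :=
    (uniqueDiffOn_Ico 0 T).prod uniqueDiffOn_univ
  have cont_speed := continuous_speed m S.cont_u S.u_pos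
  have cont_sum := (S.cont_p.add S.cont_q).div_const 2
  have cont_diff := S.cont_p.sub S.cont_q
  constructor
  · exact contDiffOn_of_planeForm uniqueDiff
      (fun y hy => hasFDerivWithinAt_u_comp h h₀ hD hR hg hy) (cont_sum.comp_continuousOn cont_g)
      ((cont_diff.div (continuous_const.mul cont_speed) fun z =>
        (mul_pos two_pos (speed_pos m (S.u_pos z))).ne').comp_continuousOn cont_g)
  · exact contDiffOn_of_planeForm uniqueDiff
      (fun y hy => hasFDerivWithinAt_v_comp h h₀ hD hR hg hy)
      ((((h.cont_a.comp S.cont_t).mul S.cont_v).neg.add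
        (cont_speed.mul (cont_diff.div_const 2))).comp_continuousOn cont_g)
      (cont_sum.comp_continuousOn cont_g)

theorem dt_u_comp (h : Barrier m B T M₀ a a' n n')
    (h₀ : DataBounds m M₀ (a 0) (n 0) u₀ v₀ p₀ q₀) (hD : IsOpen D) (hR : S.region B n ⊆ D)
    (hg : S.IsInverse B n T g) {t : ℝ} (ht : t ∈ Ico 0 T) (x : ℝ) :
    dt T (fun t x => S.u (g (t, x))) t x = (S.p (g (t, x)) + S.q (g (t, x))) / 2 :=
  dt_eq_of_hasFDerivWithinAt (f := fun y => S.u (g y)) ht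
    (hasFDerivWithinAt_u_comp h h₀ hD hR hg ⟨ht, mem_univ _⟩)

theorem dt_v_comp (h : Barrier m B T M₀ a a' n n')
    (h₀ : DataBounds m M₀ (a 0) (n 0) u₀ v₀ p₀ q₀) (hD : IsOpen D) (hR : S.region B n ⊆ D)
    (hg : S.IsInverse B n T g) {t : ℝ} (ht : t ∈ Ico 0 T) (x : ℝ) :
    dt T (fun t x => S.v (g (t, x))) t x = -(a t * S.v (g (t, x)))
      + speed m (S.u (g (t, x))) * ((S.p (g (t, x)) - S.q (g (t, x))) / 2) := by
  rw [dt_eq_of_hasFDerivWithinAt (f := fun y => S.v (g y)) ht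
    (hasFDerivWithinAt_v_comp h h₀ hD hR hg ⟨ht, mem_univ _⟩),
    show S.t (g (t, x)) = t from congrArg Prod.fst (hg.toTimeSpace_eq (t, x) ⟨ht, mem_univ _⟩)]

theorem hasDerivAt_u_comp (h : Barrier m B T M₀ a a' n n')
    (h₀ : DataBounds m M₀ (a 0) (n 0) u₀ v₀ p₀ q₀) (hD : IsOpen D) (hR : S.region B n ⊆ D)
    (hg : S.IsInverse B n T g) {t : ℝ} (ht : t ∈ Ico 0 T) (x : ℝ) :
    HasDerivAt (fun y => S.u (g (t, y)))
      ((S.p (g (t, x)) - S.q (g (t, x))) / (2 * speed m (S.u (g (t, x))))) x :=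
  hasDerivAt_of_hasFDerivWithinAt_strip (f := fun y => S.u (g y)) ht
    (hasFDerivWithinAt_u_comp h h₀ hD hR hg ⟨ht, mem_univ _⟩)

theorem hasDerivAt_v_comp (h : Barrier m B T M₀ a a' n n')
    (h₀ : DataBounds m M₀ (a 0) (n 0) u₀ v₀ p₀ q₀) (hD : IsOpen D) (hR : S.region B n ⊆ D)
    (hg : S.IsInverse B n T g) {t : ℝ} (ht : t ∈ Ico 0 T) (x : ℝ) :
    HasDerivAt (fun y => S.v (g (t, y))) ((S.p (g (t, x)) + S.q (g (t, x))) / 2) x :=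
  hasDerivAt_of_hasFDerivWithinAt_strip (f := fun y => S.v (g y)) ht
    (hasFDerivWithinAt_v_comp h h₀ hD hR hg ⟨ht, mem_univ _⟩)

theorem IsInverse.apply_zero (h : Barrier m B T M₀ a a' n n')
    (h₀ : DataBounds m M₀ (a 0) (n 0) u₀ v₀ p₀ q₀) (hR : S.region B n ⊆ D)
    (hg : S.IsInverse B n T g) (x : ℝ) : g (0, x) = (-x, x) := by
  have mem_strip : ((0 : ℝ), x) ∈ Ico 0 T ×ˢ (univ : Set ℝ) := ⟨⟨le_rfl, h.T_pos⟩, mem_univ _⟩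
  exact S.toTimeSpace_injOn h.B_pos hR (hg.mem_region _ mem_strip) (S.diag_mem_region h h₀ x)
    ((hg.toTimeSpace_eq _ mem_strip).trans (Prod.ext (S.t_diag x) (S.X_diag x)).symm)

theorem isSolution_comp {γ mu lam : ℝ} (h : Barrier m B T M₀ a a' n n')
    (h₀ : DataBounds m M₀ (a 0) (n 0) u₀ v₀ p₀ q₀) (hD : IsOpen D) (hR : S.region B n ⊆ D)
    (hg : S.IsInverse B n T g) (hγ : γ ≠ 0) (hm : 4 * m = γ + 1)
    (ha : ∀ t ∈ Ico 0 T, a t = lam / (1 + t) ^ mu) :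
    IsSolution γ mu lam u₀ v₀ T (fun t x => S.u (g (t, x))) fun t x => S.v (g (t, x)) where
  contDiffOn_u := (contDiffOn_comp h h₀ hD hR hg).1
  contDiffOn_v := (contDiffOn_comp h h₀ hD hR hg).2
  pos _ _ _ := S.u_pos _
  mass t ht x := by
    rw [dt_u_comp h h₀ hD hR hg ht, dx, (hasDerivAt_v_comp h h₀ hD hR hg ht x).deriv, sub_self]
  momentum t ht x := by
    have pressure_deriv := (hasDerivAt_pressure hγ hm (S.u_pos (g (t, x)))).comp x
      (hasDerivAt_u_comp h h₀ hD hR hg ht x)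
    have pressure_dx : dx (fun τ y => pressure γ (S.u (g (τ, y)))) t x = _ := pressure_deriv.deriv
    rw [dt_v_comp h h₀ hD hR hg ht, pressure_dx, ha t ht]
    field_simp
    ring
  init_u x := by rw [hg.apply_zero h h₀ hR, S.u_diag]
  init_v x := by rw [hg.apply_zero h h₀ hR, S.v_diag]

theorem abs_v_le (h : Barrier m B T M₀ a a' n n')
    (h₀ : DataBounds m M₀ (a 0) (n 0) u₀ v₀ p₀ q₀) (hR : S.region B n ⊆ D) {z : ℝ × ℝ}
    (hz : z ∈ S.region B n) : |S.v z| ≤ M₀ := by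
  obtain ⟨add_le, sub_le⟩ := max_le_iff.1 (S.invariantMax_le h h₀ hR hz)
  rw [abs_le] at add_le sub_le ⊢
  constructor <;> linarith

theorem isBoundedOn_comp {γ K : ℝ} (h : Barrier m B T M₀ a a' n n')
    (h₀ : DataBounds m M₀ (a 0) (n 0) u₀ v₀ p₀ q₀) (hD : IsOpen D) (hR : S.region B n ⊆ D)
    (hg : S.IsInverse B n T g) (hγ : γ ≠ 0) (hm : 4 * m = γ + 1) (hK : ∀ t, |a t| ≤ K) :
    IsBoundedOn γ T (fun t x => S.u (g (t, x))) fun t x => S.v (g (t, x)) := by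
  refine ⟨2 + M₀ + K * M₀ + 4 ^ m + (4 ^ m) ^ 2, fun t ht x => ?_⟩
  have hz := hg.mem_region (t, x) ⟨ht, mem_univ _⟩
  have controlled := S.controlled_of_mem_region hz
  have u_pos := S.u_pos (g (t, x))
  have v_le := abs_v_le h h₀ hR hz
  have K_nonneg : 0 ≤ K := (abs_nonneg _).trans (hK 0)
  have M₀_nonneg : 0 ≤ M₀ := (abs_nonneg _).trans v_le
  have damping_le : |a t * S.v (g (t, x))| ≤ K * M₀ := by
    rw [abs_mul]
    exact mul_le_mul (hK t) v_le (abs_nonneg _) K_nonneg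
  have damping_nonneg : 0 ≤ K * M₀ := mul_nonneg K_nonneg M₀_nonneg
  have four_rpow_pos : (0 : ℝ) < 4 ^ m := by positivity
  have sq_nonneg : (0 : ℝ) ≤ (4 ^ m) ^ 2 := by positivity
  have mean_le := controlled.abs_half_add_le
  have v_t_le := controlled.abs_speed_mul_half_sub_le h.m_nonneg
  rw [dt_u_comp h h₀ hD hR hg ht, dt_v_comp h h₀ hD hR hg ht, dx, dx,
    (hasDerivAt_u_comp h h₀ hD hR hg ht x).deriv, (hasDerivAt_v_comp h h₀ hD hR hg ht x).deriv,
    (hasDerivAt_pressure hγ hm u_pos).deriv, abs_of_pos u_pos, abs_neg (_ ^ 2)]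
  refine ⟨by linarith [controlled.u_mem.2], by linarith, by linarith, ?_,
    (controlled.abs_sub_div_two_mul_speed_le h.m_nonneg).trans (by linarith), by linarith,
    (controlled.abs_speed_sq_le h.m_nonneg).trans (by linarith)⟩
  refine (abs_add_le _ _).trans ?_
  rw [abs_neg]
  linarith

end TimeSpace

end CharacteristicSolution

theorem Controlled.untruncated {m B : ℝ} {a n : ℝ → ℝ} {p q N Q u t : ℝ} (hB : 0 < B)
    (h : Controlled m B a n p q N Q u t) : Untruncated (2 * B) p q N Q u :=
  have inv_pos := inv_pos.2 hB
  have p_le := abs_le.1 h.p_le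
  have q_le := abs_le.1 h.q_le
  ⟨⟨by linarith, by linarith⟩, ⟨by linarith, by linarith⟩,
    ⟨by linarith [h.N_mem.1], by linarith [h.N_mem.2]⟩,
    ⟨by linarith [h.Q_mem.1], by linarith [h.Q_mem.2]⟩,
    ⟨by linarith [h.u_mem.1], by linarith [h.u_mem.2]⟩⟩

theorem CharacteristicSolution.region_subset {m B : ℝ} {a n u₀ v₀ p₀ q₀ : ℝ → ℝ}
    {D : Set (ℝ × ℝ)} (S : CharacteristicSolution m a u₀ v₀ p₀ q₀ D) (hB : 0 < B)
    (hD : segmentDomain {z | Untruncated (2 * B) (S.p z) (S.q z) (S.N z) (S.Q z) (S.u z)} ⊆ D) :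
    S.region B n ⊆ D := by
  intro z hz
  refine hD fun b hb => ?_
  rw [uIcc_of_le (by linarith [hz.1])] at hb
  exact (hz.2 z.1 b le_rfl hb.2 (by linarith [hb.1])).untruncated hB

theorem Barrier.le_lifespan {m B T M₀ γ mu lam : ℝ} {a a' n n' u₀ v₀ p₀ q₀ u₀' v₀' : ℝ → ℝ}
    (h : Barrier m B T M₀ a a' n n') (h₀ : DataBounds m M₀ (a 0) (n 0) u₀ v₀ p₀ q₀)
    (hγ : γ ≠ 0) (hm : 4 * m = γ + 1) (a_lip : BddLip a)
    (ha : ∀ t ∈ Ico 0 T, a t = lam / (1 + t) ^ mu)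
    (hu₀ : ∀ x, HasDerivAt u₀ (u₀' x) x) (hv₀ : ∀ x, HasDerivAt v₀ (v₀' x) x)
    (hu₀' : Continuous u₀') (hv₀' : Continuous v₀')
    (hp₀ : ∀ x, p₀ x = v₀' x + speed m (u₀ x) * u₀' x)
    (hq₀ : ∀ x, q₀ x = v₀' x - speed m (u₀ x) * u₀' x) :
    (T : EReal) ≤ lifespan γ mu lam u₀ v₀ := by
  obtain ⟨D, S, hD, segment_subset⟩ := exists_characteristicSolution m (B := 2 * B) a_lip
    (fun t => (h.cont_a.integral_hasStrictDerivAt 0 t).hasDerivAt) intervalIntegral.integral_same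
    hu₀ hv₀ hu₀' hv₀' hp₀ hq₀ fun x => (h.initial_controlled h₀ x).untruncated h.B_pos
  have hR : S.region B n ⊆ D := S.region_subset h.B_pos segment_subset
  obtain ⟨g, hg⟩ := S.exists_isInverse h h₀ hD hR
  obtain ⟨K, hK⟩ := a_lip.2
  exact le_sSup ⟨T, rfl, h.T_pos, _, _,
    CharacteristicSolution.isSolution_comp h h₀ hD hR hg hγ hm ha,
    CharacteristicSolution.isBoundedOn_comp h h₀ hD hR hg hγ hm hK⟩

/-! ### Supersolutions of the Riccati equation -/

section Damping

/-- The damping coefficient `λ / (1 + t) ^ μ`. -/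
def damp (mu lam t : ℝ) : ℝ := lam * (1 + t) ^ (-mu)

/-- The derivative of `damp`. -/
def dampDeriv (mu lam t : ℝ) : ℝ := -(lam * mu * (1 + t) ^ (-mu - 1))

/-- The coefficient `a² / 4 + a' / 2` of the zeroth order term in the Riccati equation of `slope`,
when `a` is the damping coefficient. -/
def dampDefect (mu lam t : ℝ) : ℝ := damp mu lam t ^ 2 / 4 + dampDeriv mu lam t / 2

variable {mu lam t : ℝ}

theorem hasDerivAt_add_rpow {b r : ℝ} (hbt : 0 < b + t) :
    HasDerivAt (fun s : ℝ => (b + s) ^ r) (r * (b + t) ^ (r - 1)) t := by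
  simpa using ((hasDerivAt_id t).const_add b).rpow_const (p := r) (Or.inl hbt.ne')

theorem hasDerivAt_damp (ht : 0 ≤ t) : HasDerivAt (damp mu lam) (dampDeriv mu lam t) t := by
  refine ((hasDerivAt_add_rpow (by linarith)).const_mul lam).congr_deriv ?_
  rw [dampDeriv]
  ring

theorem one_add_rpow_neg_le_one {r : ℝ} (hr : 0 ≤ r) (ht : 0 ≤ t) : (1 + t) ^ (-r) ≤ 1 :=
  Real.rpow_le_one_of_one_le_of_nonpos (by linarith) (by linarith)

theorem damp_nonneg (hlam : 0 ≤ lam) (ht : 0 ≤ t) : 0 ≤ damp mu lam t :=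
  mul_nonneg hlam (Real.rpow_nonneg (by linarith) _)

theorem damp_le (hmu : 0 ≤ mu) (hlam : 0 ≤ lam) (ht : 0 ≤ t) : damp mu lam t ≤ lam :=
  mul_le_of_le_one_right hlam (one_add_rpow_neg_le_one hmu ht)

theorem damp_zero (mu lam : ℝ) : damp mu lam 0 = lam := by simp [damp]

theorem damp_eq_div (ht : 0 ≤ t) : damp mu lam t = lam / (1 + t) ^ mu := by
  rw [damp, Real.rpow_neg (by linarith), div_eq_mul_inv]

theorem abs_dampDeriv_le (hmu : 0 ≤ mu) (hlam : 0 ≤ lam) (ht : 0 ≤ t) :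
    |dampDeriv mu lam t| ≤ lam * mu := by
  have exponent_eq : -mu - 1 = -(mu + 1) := by ring
  rw [dampDeriv, abs_neg, abs_of_nonneg (by positivity), exponent_eq]
  exact mul_le_of_le_one_right (by positivity) (one_add_rpow_neg_le_one (by linarith) ht)

theorem bddLip_damp (hmu : 0 ≤ mu) (hlam : 0 ≤ lam) : BddLip fun t => damp mu lam (max t 0) := by
  have lipschitzOn : LipschitzOnWith ⟨lam * mu, mul_nonneg hlam hmu⟩ (damp mu lam) (Ici 0) :=
    (convex_Ici 0).lipschitzOnWith_of_nnnorm_hasDerivWithin_le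
      (fun _ ht => (hasDerivAt_damp ht).hasDerivWithinAt) fun _ ht => abs_dampDeriv_le hmu hlam ht
  refine ⟨⟨_, fun x y => (lipschitzOn (le_max_right x 0) (le_max_right y 0)).trans
    (mul_le_mul_right (?_ : edist (max x 0) (max y 0) ≤ edist x y) _)⟩, lam, fun t => ?_⟩
  · simpa using LipschitzWith.id.max_const 0 x y
  · rw [Real.norm_of_nonneg (damp_nonneg hlam (le_max_right _ _))]
    exact damp_le hmu hlam (le_max_right _ _)

theorem hasDerivAt_comp_max_zero {f : ℝ → ℝ} {f' t : ℝ} (hf : HasDerivAt f f' t) (ht : 0 < t) :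
    HasDerivAt (fun s => f (max s 0)) f' t := by
  refine hf.congr_of_eventuallyEq ?_
  filter_upwards [lt_mem_nhds ht] with s hs
  rw [max_eq_left hs.le]

end Damping

section SmallData

theorem abs_slope_lt {m α p u δ r ν : ℝ} (hm : 0 ≤ m) (hα : 0 ≤ α)
    (hu : u ∈ Icc (1 / 2 : ℝ) 2) (hu1 : |u - 1| ≤ δ) (hp : |p| ≤ r)
    (hν : 2 ^ m * (r + α / 2 * δ) < ν) : |slope m α p u| < ν := by
  have u_pos := pos_of_mem_Icc_half_two hu
  refine (abs_add_le _ _).trans_lt (lt_of_le_of_lt ?_ hν)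
  rw [abs_mul, abs_mul, abs_of_pos (Real.rpow_pos_of_pos u_pos _),
    abs_of_nonneg (by positivity : 0 ≤ α / 2)]
  calc u ^ (-m) * |p| + α / 2 * |theta m u| ≤ 2 ^ m * r + α / 2 * (2 ^ m * δ) := by
        have theta_le := (abs_theta_le hm hu).trans (mul_le_mul_of_nonneg_left hu1 (by positivity))
        have rpow_le := rpow_neg_le_two_rpow hm hu
        gcongr
    _ = 2 ^ m * (r + α / 2 * δ) := by ring

theorem dataBounds_of_abs_le {m α ν δ : ℝ} {u₀ v₀ u₀' v₀' : ℝ → ℝ} (hm : 0 ≤ m) (hα : 0 ≤ α)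
    (hδ : δ ≤ 1 / 2) (hu₀ : ∀ x, |u₀ x - 1| ≤ δ) (hv₀ : ∀ x, |v₀ x| ≤ δ)
    (hu₀' : ∀ x, |u₀' x| ≤ δ) (hv₀' : ∀ x, |v₀' x| ≤ δ)
    (hν : 2 ^ m * (1 + 4 ^ m + α / 2) * δ < ν) :
    DataBounds m ((1 + 4 ^ m) * δ) α ν u₀ v₀ (fun x => v₀' x + speed m (u₀ x) * u₀' x)
      fun x => v₀' x - speed m (u₀ x) * u₀' x := by
  have u₀_mem : ∀ x, u₀ x ∈ Icc (1 / 2 : ℝ) 2 := fun x => by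
    have := abs_le.1 (hu₀ x)
    constructor <;> linarith
  have eta_le : ∀ x, |eta m (u₀ x)| ≤ 4 ^ m * δ := fun x => by
    rw [four_rpow]
    exact (abs_theta_le (by positivity) (u₀_mem x)).trans
      (mul_le_mul_of_nonneg_left (hu₀ x) (by positivity))
  have speed_mul_le : ∀ x, |speed m (u₀ x) * u₀' x| ≤ 4 ^ m * δ := fun x => by
    rw [abs_mul, abs_of_pos (speed_pos m (pos_of_mem_Icc_half_two (u₀_mem x)))]
    exact mul_le_mul (speed_le_four_rpow hm (u₀_mem x)) (hu₀' x) (abs_nonneg _) (by positivity)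
  have slope_lt : ∀ x p, |p| ≤ δ + 4 ^ m * δ → |slope m α p (u₀ x)| < ν := fun x p hp =>
    abs_slope_lt hm hα (u₀_mem x) (hu₀ x) hp (by linarith)
  have one_add_mul_eq : δ + 4 ^ m * δ = (1 + 4 ^ m) * δ := by ring
  exact
    { u₀_mem := u₀_mem
      invariant_add x :=
        ((abs_add_le _ _).trans (add_le_add (hv₀ x) (eta_le x))).trans_eq one_add_mul_eq
      invariant_sub x :=
        ((abs_sub _ _).trans (add_le_add (hv₀ x) (eta_le x))).trans_eq one_add_mul_eq
      slope_p x := slope_lt x _ <| (abs_add_le _ _).trans (add_le_add (hv₀' x) (speed_mul_le x))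
      slope_q x := slope_lt x _ <| (abs_sub _ _).trans (add_le_add (hv₀' x) (speed_mul_le x)) }

end SmallData

section Supersolution

/-- A small positive supersolution `n`, on `[0, T]`, of the Riccati equation satisfied by the slopes
of data of size `ε`. The constant `κ` absorbs all constants depending on the data and on `γ`. -/
structure RiccatiSupersolution (mu lam κ ε T : ℝ) (n n' : ℝ → ℝ) : Prop where
  hasDerivAt : ∀ t, 0 ≤ t → HasDerivAt n (n' t) t
  zero_lt : κ * ε < n 0
  nonneg : ∀ t ∈ Icc 0 T, 0 ≤ n t
  riccati : ∀ t ∈ Ioo 0 T, κ * (n t + κ * ε * damp mu lam t) ^ 2 + κ * ε * |dampDefect mu lam t|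
    ≤ n' t + damp mu lam t / 2 * n t
  small : ∀ t ∈ Icc 0 T, κ * (n t + κ * ε * damp mu lam t) < 1

variable {m mu lam κ ε T M₀ : ℝ} {n n' : ℝ → ℝ}

theorem RiccatiSupersolution.continuous_comp_max_zero
    (h : RiccatiSupersolution mu lam κ ε T n n') : Continuous fun t => n (max t 0) :=
  continuous_iff_continuousAt.2 fun t =>
    (h.hasDerivAt _ (le_max_right t 0)).continuousAt.comp (f := fun t : ℝ => max t 0) (by fun_prop)

theorem RiccatiSupersolution.barrier (h : RiccatiSupersolution mu lam κ ε T n n') (hm : 0 ≤ m)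
    (hmu : 0 ≤ mu) (hlam : 0 ≤ lam) (hT : 0 < T) (hκ : 2 * m * 2 ^ m + 2 ^ m ≤ κ)
    (hM₀ : 0 ≤ M₀) (hM₀_small : 4 ^ m * M₀ < 1 / 2) (hΘ : thetaBound m M₀ ≤ κ * ε) :
    Barrier m (2 * 4 ^ m * Real.exp (4 * m * T) + 1) T M₀ (fun t => damp mu lam (max t 0))
      (dampDeriv mu lam) (fun t => n (max t 0)) n' := by
  have quadratic_le : 2 * m * 2 ^ m ≤ κ := (le_add_of_nonneg_right (by positivity)).trans hκ
  have two_rpow_le : 2 ^ m ≤ κ := (le_add_of_nonneg_left (by positivity)).trans hκ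
  have κ_nonneg : 0 ≤ κ := (by positivity : (0 : ℝ) ≤ 2 ^ m).trans two_rpow_le
  have thetaBound_nonneg : 0 ≤ thetaBound m M₀ := by
    rw [thetaBound]
    positivity
  have nonneg_and_le : ∀ t ∈ Icc 0 T, 0 ≤ n t + damp mu lam t * thetaBound m M₀ / 2 ∧
      n t + damp mu lam t * thetaBound m M₀ / 2 ≤ n t + κ * ε * damp mu lam t := fun t ht => by
    have damp_nonneg := damp_nonneg (mu := mu) hlam ht.1
    have n_nonneg := h.nonneg t ht
    refine ⟨by positivity, ?_⟩
    nlinarith [mul_le_mul_of_nonneg_left hΘ damp_nonneg]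
  obtain ⟨K, damp_lipschitz⟩ := (bddLip_damp hmu hlam).1
  refine
    { m_nonneg := hm
      T_pos := hT
      a_nonneg t := damp_nonneg hlam (le_max_right _ _)
      cont_a := damp_lipschitz.continuous
      cont_n := h.continuous_comp_max_zero
      hasDerivAt_a t ht := hasDerivAt_comp_max_zero (hasDerivAt_damp ht.1.le) ht.1
      hasDerivAt_n t ht := hasDerivAt_comp_max_zero (h.hasDerivAt t ht.1.le) ht.1
      supersolution t ht := ?_
      small t ht := ?_
      M₀_small := hM₀_small
      B_large := lt_add_one _ }
  · obtain ⟨sum_nonneg, sum_le⟩ := nonneg_and_le t (Ioo_subset_Icc_self ht)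
    rw [max_eq_left ht.1.le]
    refine le_trans (add_le_add ?_ ?_) (h.riccati t ht)
    · gcongr
    · rw [mul_comm (κ * ε), dampDefect]
      gcongr
  · obtain ⟨sum_nonneg, sum_le⟩ := nonneg_and_le t ht
    rw [max_eq_left ht.1]
    exact (mul_le_mul two_rpow_le sum_le sum_nonneg κ_nonneg).trans_lt (h.small t ht)

theorem IsC1b.hasDerivAt {φ : ℝ → ℝ} (h : IsC1b φ) (x : ℝ) : HasDerivAt φ (deriv φ x) x :=
  (h.1.differentiable one_ne_zero x).hasDerivAt

theorem IsC1b.exists_common_bound {φ ψ : ℝ → ℝ} (hφ : IsC1b φ) (hψ : IsC1b ψ) :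
    ∃ M, 0 < M ∧ ∀ x, |φ x| ≤ M ∧ |deriv φ x| ≤ M ∧ |ψ x| ≤ M ∧ |deriv ψ x| ≤ M := by
  obtain ⟨-, ⟨M₁, h₁⟩, M₂, h₂⟩ := hφ
  obtain ⟨-, ⟨M₃, h₃⟩, M₄, h₄⟩ := hψ
  have one_le := le_max_left 1 (max (max M₁ M₂) (max M₃ M₄))
  have le_bound := le_max_right 1 (max (max M₁ M₂) (max M₃ M₄))
  simp only [max_le_iff] at le_bound
  obtain ⟨⟨le₁, le₂⟩, le₃, le₄⟩ := le_bound
  exact ⟨_, one_pos.trans_le one_le, fun x => ⟨(h₁ x).trans le₁, (h₂ x).trans le₂,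
    (h₃ x).trans le₃, (h₄ x).trans le₄⟩⟩

theorem RiccatiSupersolution.le_lifespan {γ M : ℝ} {φ ψ : ℝ → ℝ}
    (h : RiccatiSupersolution mu lam κ ε T n n') (hm : 0 ≤ m) (hγm : 4 * m = γ + 1) (hγ : γ ≠ 0)
    (hmu : 0 ≤ mu) (hlam : 0 ≤ lam) (hφ : IsC1b φ) (hψ : IsC1b ψ) (hM : 0 < M)
    (hφψ : ∀ x, |φ x| ≤ M ∧ |deriv φ x| ≤ M ∧ |ψ x| ≤ M ∧ |deriv ψ x| ≤ M)
    (hκ : 2 * m * 2 ^ m + 2 ^ m ≤ κ) (hκΘ : thetaBound m ((1 + 4 ^ m) * M) ≤ κ)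
    (hκ_slope : 2 ^ m * (1 + 4 ^ m + lam / 2) * M ≤ κ)
    (hε : 0 < ε) (hε_small : 4 ^ m * ((1 + 4 ^ m) * M) * ε < 1 / 2) (hT : 0 < T) :
    (T : EReal) ≤ lifespan γ mu lam (fun x => 1 + ε * φ x) (fun x => ε * ψ x) := by
  have mul_le : ∀ {r}, |r| ≤ M → |ε * r| ≤ M * ε := fun hr => by
    rw [abs_mul, abs_of_pos hε, mul_comm]
    exact mul_le_mul_of_nonneg_right hr hε.le
  have one_le_four_rpow : (1 : ℝ) ≤ 4 ^ m := Real.one_le_rpow (by norm_num) hm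
  have bound_small : 4 ^ m * ((1 + 4 ^ m) * (M * ε)) < 1 / 2 := by linarith
  have Mε_pos : 0 < M * ε := mul_pos hM hε
  have Mε_le : M * ε ≤ 1 / 2 := by
    have : M * ε ≤ (1 + 4 ^ m) * (M * ε) := le_mul_of_one_le_left Mε_pos.le (by linarith)
    exact (this.trans (le_mul_of_one_le_left (by positivity) one_le_four_rpow)).trans
      bound_small.le
  have Θ_le : thetaBound m ((1 + 4 ^ m) * (M * ε)) ≤ κ * ε :=
    calc _ = thetaBound m ((1 + 4 ^ m) * M) * ε := by simp only [thetaBound]; ring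
      _ ≤ κ * ε := by gcongr
  have barrier := h.barrier hm hmu hlam hT hκ (by positivity) bound_small Θ_le
  refine barrier.le_lifespan (dataBounds_of_abs_le hm (barrier.a_nonneg 0) Mε_le
    (fun x => ?_) (fun x => mul_le (hφψ x).2.2.1) (fun x => mul_le (hφψ x).2.1)
    (fun x => mul_le (hφψ x).2.2.2) ?_) hγ hγm (bddLip_damp hmu hlam) (fun t ht => ?_)
    (fun x => ((hφ.hasDerivAt x).const_mul ε).const_add 1) (fun x => (hψ.hasDerivAt x).const_mul ε)
    (continuous_const.mul (hφ.1.continuous_deriv le_rfl))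
    (continuous_const.mul (hψ.1.continuous_deriv le_rfl)) (fun _ => rfl) fun _ => rfl
  · rw [add_sub_cancel_left]
    exact mul_le (hφψ x).1
  · rw [max_self, damp_zero, ← mul_assoc]
    exact (mul_le_mul_of_nonneg_right hκ_slope hε.le).trans_lt h.zero_lt
  · rw [max_eq_left ht.1, damp_eq_div ht.1]

theorem exists_lifespan_criterion {γ : ℝ} (hγ : -1 ≤ γ) (hγ0 : γ ≠ 0) (hmu : 0 ≤ mu)
    (hlam : 0 ≤ lam) {φ ψ : ℝ → ℝ} (hφ : IsC1b φ) (hψ : IsC1b ψ) :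
    ∃ κ ε₁ : ℝ, 0 < κ ∧ 0 < ε₁ ∧ ∀ ε, 0 < ε → ε ≤ ε₁ → ∀ T, 0 < T → ∀ n n' : ℝ → ℝ,
      RiccatiSupersolution mu lam κ ε T n n' →
      (T : EReal) ≤ lifespan γ mu lam (fun x => 1 + ε * φ x) (fun x => ε * ψ x) := by
  obtain ⟨M, hM, hφψ⟩ := hφ.exists_common_bound hψ
  obtain ⟨m, hm⟩ : ∃ m : ℝ, 4 * m = γ + 1 := ⟨(γ + 1) / 4, by ring⟩
  have m_nonneg : 0 ≤ m := by linarith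
  have Θ_pos : 0 < thetaBound m ((1 + 4 ^ m) * M) := by
    rw [thetaBound]
    positivity
  have slope_pos : 0 < 2 ^ m * (1 + 4 ^ m + lam / 2) * M := by positivity
  have quadratic_pos : 0 < 2 * m * 2 ^ m + 2 ^ m := by positivity
  refine ⟨(2 * m * 2 ^ m + 2 ^ m) + thetaBound m ((1 + 4 ^ m) * M)
    + 2 ^ m * (1 + 4 ^ m + lam / 2) * M, 1 / (4 * (4 ^ m * ((1 + 4 ^ m) * M))), by linarith,
    by positivity, fun ε hε hε_le T hT n n' h => ?_⟩
  rw [le_div_iff₀ (by positivity)] at hε_le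
  exact h.le_lifespan m_nonneg hm hγ0 hmu hlam hφ hψ hM hφψ (by linarith) (by linarith)
    (by linarith) hε (by linarith) hT

end Supersolution

section GrowthFactor

/-- A factor `E` growing at most like the integrating factor `exp (∫ a / 2)` of the damping `a`,
together with upper bounds `F` for the primitive of `1 / E` and `f ≤ K` for the primitive of
`E * |dampDefect|`. -/
structure GrowthFactor (mu lam c K : ℝ) (E E' F F' f f' : ℝ → ℝ) : Prop where
  c_nonneg : 0 ≤ c
  K_nonneg : 0 ≤ K
  hasDerivAt_E : ∀ t, 0 ≤ t → HasDerivAt E (E' t) t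
  hasDerivAt_F : ∀ t, 0 ≤ t → HasDerivAt F (F' t) t
  hasDerivAt_f : ∀ t, 0 ≤ t → HasDerivAt f (f' t) t
  E_zero : E 0 = 1
  one_le_E : ∀ t, 0 ≤ t → 1 ≤ E t
  E'_le : ∀ t, 0 ≤ t → E' t ≤ damp mu lam t / 2 * E t
  damp_mul_le : ∀ t, 0 ≤ t → damp mu lam t * E t ≤ c
  F_nonneg : ∀ t, 0 ≤ t → 0 ≤ F t
  inv_le_F' : ∀ t, 0 ≤ t → (E t)⁻¹ ≤ F' t
  f_mem : ∀ t, 0 ≤ t → f t ∈ Icc 0 K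
  mul_defect_le_f' : ∀ t, 0 ≤ t → E t * |dampDefect mu lam t| ≤ f' t

/-- An upper bound for `(n + κ ε a) * E / ε`, where `n = riccatiNumerator / E`. -/
def amplitude (κ c K : ℝ) : ℝ := (κ + 1) * (1 + K) + 1 + κ * c

/-- The supersolution attached to a growth factor `E` is `riccatiNumerator / E`. -/
def riccatiNumerator (κ ε J : ℝ) (F f : ℝ → ℝ) (t : ℝ) : ℝ :=
  ε * (κ + 1) * (1 + f t) + κ * J ^ 2 * ε ^ 2 * F t

theorem amplitude_pos {κ c K : ℝ} (hκ : 0 < κ) (hc : 0 ≤ c) (hK : 0 ≤ K) :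
    0 < amplitude κ c K := by
  rw [amplitude]
  positivity

namespace GrowthFactor

variable {mu lam c K κ ε J T t : ℝ} {E E' F F' f f' : ℝ → ℝ}
  (h : GrowthFactor mu lam c K E E' F F' f f')
include h

theorem E_pos (ht : 0 ≤ t) : 0 < E t := one_pos.trans_le (h.one_le_E t ht)

theorem hasDerivAt_riccatiNumerator (ht : 0 ≤ t) : HasDerivAt (riccatiNumerator κ ε J F f)
    (ε * (κ + 1) * f' t + κ * J ^ 2 * ε ^ 2 * F' t) t :=
  (((h.hasDerivAt_f t ht).const_add 1).const_mul _).add ((h.hasDerivAt_F t ht).const_mul _)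

theorem le_riccatiNumerator (hκ : 0 < κ) (hε : 0 < ε) (ht : 0 ≤ t) :
    ε * (κ + 1) ≤ riccatiNumerator κ ε J F f t := by
  have F_nonneg := h.F_nonneg t ht
  have f_nonneg := (h.f_mem t ht).1
  have F_term : 0 ≤ κ * J ^ 2 * ε ^ 2 * F t := by positivity
  have f_term : 0 ≤ ε * (κ + 1) * f t := by positivity
  rw [riccatiNumerator]
  linarith

theorem riccatiNumerator_pos (hκ : 0 < κ) (hε : 0 < ε) (ht : 0 ≤ t) :
    0 < riccatiNumerator κ ε J F f t :=
  lt_of_lt_of_le (by positivity) (h.le_riccatiNumerator hκ hε ht)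

theorem div_add_damp_nonneg (hκ : 0 < κ) (hε : 0 < ε) (hlam : 0 ≤ lam) (ht : 0 ≤ t) :
    0 ≤ riccatiNumerator κ ε J F f t / E t + κ * ε * damp mu lam t := by
  have E_pos := h.E_pos ht
  have numerator_pos := h.riccatiNumerator_pos hκ hε (J := J) ht
  have damp_nonneg := damp_nonneg (mu := mu) hlam ht
  positivity

theorem div_add_damp_le (hκ : 0 < κ) (hε : 0 < ε) (ht : 0 ≤ t)
    (hF : κ * J ^ 2 * (ε * F t) ≤ 1) (hJ : amplitude κ c K = J) :
    riccatiNumerator κ ε J F f t / E t + κ * ε * damp mu lam t ≤ ε * J / E t := by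
  have E_pos := h.E_pos ht
  rw [div_add' _ _ _ E_pos.ne']
  refine div_le_div_of_nonneg_right ?_ E_pos.le
  calc riccatiNumerator κ ε J F f t + κ * ε * damp mu lam t * E t
      = ε * (κ + 1) * (1 + f t) + ε * (κ * J ^ 2 * (ε * F t))
        + κ * ε * (damp mu lam t * E t) := by rw [riccatiNumerator]; ring
    _ ≤ ε * (κ + 1) * (1 + K) + ε * 1 + κ * ε * c := by
      gcongr
      exacts [(h.f_mem t ht).2, h.damp_mul_le t ht]
    _ = ε * J := by rw [← hJ, amplitude]; ring

theorem riccati_le (hκ : 0 < κ) (hε : 0 < ε) (hlam : 0 ≤ lam) (ht : 0 ≤ t)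
    (hF : κ * J ^ 2 * (ε * F t) ≤ 1) (hJ : amplitude κ c K = J) :
    κ * (riccatiNumerator κ ε J F f t / E t + κ * ε * damp mu lam t) ^ 2
        + κ * ε * |dampDefect mu lam t|
      ≤ ((ε * (κ + 1) * f' t + κ * J ^ 2 * ε ^ 2 * F' t) * E t
          - riccatiNumerator κ ε J F f t * E' t) / E t ^ 2
        + damp mu lam t / 2 * (riccatiNumerator κ ε J F f t / E t) := by
  have E_pos := h.E_pos ht
  set w := riccatiNumerator κ ε J F f t
  have w_nonneg : 0 ≤ w := (h.riccatiNumerator_pos hκ hε ht).le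
  have quadratic_le : κ * (w / E t + κ * ε * damp mu lam t) ^ 2
      ≤ κ * J ^ 2 * ε ^ 2 * F' t / E t :=
    calc κ * (w / E t + κ * ε * damp mu lam t) ^ 2 ≤ κ * (ε * J / E t) ^ 2 := by
          have sum_nonneg := h.div_add_damp_nonneg hκ hε (J := J) hlam ht
          have sum_le := h.div_add_damp_le hκ hε ht hF hJ
          gcongr
      _ = κ * J ^ 2 * ε ^ 2 * (E t)⁻¹ / E t := by field_simp
      _ ≤ κ * J ^ 2 * ε ^ 2 * F' t / E t := by
          have inv_le := h.inv_le_F' t ht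
          gcongr
  have defect_le : κ * ε * |dampDefect mu lam t| ≤ ε * (κ + 1) * f' t / E t := by
    rw [le_div_iff₀ E_pos]
    calc κ * ε * |dampDefect mu lam t| * E t = ε * κ * (E t * |dampDefect mu lam t|) := by ring
      _ ≤ ε * (κ + 1) * f' t := by
        have mul_defect_le := h.mul_defect_le_f' t ht
        gcongr
        linarith
  have growth_nonneg : 0 ≤ w * (damp mu lam t / 2 * E t - E' t) / E t ^ 2 :=
    div_nonneg (mul_nonneg w_nonneg (sub_nonneg.2 (h.E'_le t ht))) (sq_nonneg _)
  calc _ ≤ κ * J ^ 2 * ε ^ 2 * F' t / E t + ε * (κ + 1) * f' t / E t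
        + w * (damp mu lam t / 2 * E t - E' t) / E t ^ 2 := by linarith
    _ = _ := by
      field_simp
      ring

theorem riccatiSupersolution (hκ : 0 < κ) (hε : 0 < ε) (hlam : 0 ≤ lam)
    (hJ : amplitude κ c K = J) (hε_small : κ * J * ε < 1)
    (hF : ∀ t ∈ Icc 0 T, κ * J ^ 2 * (ε * F t) ≤ 1) :
    RiccatiSupersolution mu lam κ ε T (fun t => riccatiNumerator κ ε J F f t / E t) fun t =>
      ((ε * (κ + 1) * f' t + κ * J ^ 2 * ε ^ 2 * F' t) * E t
        - riccatiNumerator κ ε J F f t * E' t) / E t ^ 2 where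
  hasDerivAt t ht := (h.hasDerivAt_riccatiNumerator ht).div (h.hasDerivAt_E t ht) (h.E_pos ht).ne'
  zero_lt := by
    rw [h.E_zero, div_one]
    linarith [h.le_riccatiNumerator hκ hε (J := J) le_rfl]
  nonneg t ht := div_nonneg (h.riccatiNumerator_pos hκ hε ht.1).le (h.E_pos ht.1).le
  riccati t ht := h.riccati_le hκ hε hlam ht.1.le (hF t (Ioo_subset_Icc_self ht)) hJ
  small t ht := by
    have J_pos : 0 < J := hJ ▸ amplitude_pos hκ h.c_nonneg h.K_nonneg
    have div_le : ε * J / E t ≤ ε * J := div_le_self (by positivity) (h.one_le_E t ht.1)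
    calc _ ≤ κ * (ε * J) := by
          have sum_le := (h.div_add_damp_le hκ hε ht.1 (hF t ht) hJ).trans div_le
          gcongr
      _ = κ * J * ε := by ring
      _ < 1 := hε_small

theorem exists_le_lifespan {γ : ℝ} {φ ψ : ℝ → ℝ} (hγ : -1 ≤ γ) (hγ0 : γ ≠ 0) (hmu : 0 ≤ mu)
    (hlam : 0 ≤ lam) (hφ : IsC1b φ) (hψ : IsC1b ψ) :
    ∃ ε₀ C : ℝ, 0 < ε₀ ∧ 0 < C ∧ ∀ ε, 0 < ε → ε ≤ ε₀ → ∀ T, 0 < T →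
      (∀ t ∈ Icc 0 T, ε * F t ≤ C) →
      (T : EReal) ≤ lifespan γ mu lam (fun x => 1 + ε * φ x) (fun x => ε * ψ x) := by
  obtain ⟨κ, ε₁, hκ, hε₁, criterion⟩ := exists_lifespan_criterion hγ hγ0 hmu hlam hφ hψ
  have J_pos := amplitude_pos hκ h.c_nonneg h.K_nonneg
  set J := amplitude κ c K with hJ
  refine ⟨min ε₁ (1 / (2 * (κ * J))), 1 / (κ * J ^ 2), by positivity, by positivity,
    fun ε hε hε_le T hT hF => ?_⟩
  obtain ⟨hε_le₁, hε_le₂⟩ := le_min_iff.1 hε_le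
  rw [le_div_iff₀ (by positivity)] at hε_le₂
  refine criterion ε hε hε_le₁ T hT _ _
    (h.riccatiSupersolution hκ hε hlam hJ.symm (by linarith) fun t ht => ?_)
  have := hF t ht
  rwa [le_div_iff₀' (by positivity)] at this

end GrowthFactor

end GrowthFactor

section DecayRate

/-- A rate `r ≤ 1` of decay, comparable to a supersolution of the damped Riccati equation, which
dominates the damping coefficient and whose square dominates `dampDefect`. -/
structure DecayRate (mu lam c σ : ℝ) (r r' : ℝ → ℝ) : Prop where
  c_nonneg : 0 ≤ c
  σ_pos : 0 < σ
  hasDerivAt : ∀ t, 0 ≤ t → HasDerivAt r (r' t) t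
  pos : ∀ t, 0 ≤ t → 0 < r t
  le_one : ∀ t, 0 ≤ t → r t ≤ 1
  riccati : ∀ t, 0 ≤ t → σ * r t ^ 2 ≤ r' t + damp mu lam t / 2 * r t
  damp_le : ∀ t, 0 ≤ t → damp mu lam t ≤ c * r t
  defect_le : ∀ t, 0 ≤ t → |dampDefect mu lam t| ≤ c * r t ^ 2

namespace DecayRate

variable {mu lam c σ : ℝ} {r r' : ℝ → ℝ} (h : DecayRate mu lam c σ r r')
include h

theorem riccatiSupersolution {k κ ε : ℝ} (T : ℝ) (hlam : 0 ≤ lam) (hκ : 0 < κ) (hε : 0 < ε)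
    (hk : 0 < k) (hkσ : κ * c + 1 ≤ k * σ) (hk_zero : κ < k * r 0)
    (hε_sq : ε * (κ * (k + κ * c) ^ 2) ≤ 1) (hε_lin : ε * (κ * (k + κ * c)) < 1) :
    RiccatiSupersolution mu lam κ ε T (fun t => k * ε * r t) fun t => k * ε * r' t := by
  have sum_le : ∀ t, 0 ≤ t →
      k * ε * r t + κ * ε * damp mu lam t ≤ ε * (k + κ * c) * r t := fun t ht => by
    have := mul_le_mul_of_nonneg_left (h.damp_le t ht) (by positivity : 0 ≤ κ * ε)
    linarith
  have sum_nonneg : ∀ t, 0 ≤ t → 0 ≤ k * ε * r t + κ * ε * damp mu lam t := fun t ht => by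
    have r_pos := h.pos t ht
    have damp_nonneg := damp_nonneg (mu := mu) hlam ht
    positivity
  have c_nonneg := h.c_nonneg
  refine
    { hasDerivAt t ht := (h.hasDerivAt t ht).const_mul _
      zero_lt := ?_
      nonneg t ht := mul_nonneg (by positivity) (h.pos t ht.1).le
      riccati t ht := ?_
      small t ht := ?_ }
  · calc κ * ε < k * r 0 * ε := by gcongr
      _ = k * ε * r 0 := by ring
  · have ht' := ht.1.le
    calc κ * (k * ε * r t + κ * ε * damp mu lam t) ^ 2 + κ * ε * |dampDefect mu lam t|
        ≤ κ * (ε * (k + κ * c) * r t) ^ 2 + κ * ε * (c * r t ^ 2) := by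
          have := sum_nonneg t ht'
          gcongr
          exacts [sum_le t ht', h.defect_le t ht']
      _ = ε * (κ * (k + κ * c) ^ 2) * (ε * r t ^ 2) + κ * c * (ε * r t ^ 2) := by ring
      _ ≤ 1 * (ε * r t ^ 2) + κ * c * (ε * r t ^ 2) := by gcongr
      _ = (κ * c + 1) * (ε * r t ^ 2) := by ring
      _ ≤ k * σ * (ε * r t ^ 2) := by gcongr
      _ = k * ε * (σ * r t ^ 2) := by ring
      _ ≤ k * ε * (r' t + damp mu lam t / 2 * r t) := by gcongr; exact h.riccati t ht'
      _ = k * ε * r' t + damp mu lam t / 2 * (k * ε * r t) := by ring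
  · calc κ * (k * ε * r t + κ * ε * damp mu lam t) ≤ κ * (ε * (k + κ * c) * r t) := by
          gcongr
          exact sum_le t ht.1
      _ = ε * (κ * (k + κ * c)) * r t := by ring
      _ ≤ ε * (κ * (k + κ * c)) * 1 := by gcongr; exact h.le_one t ht.1
      _ < 1 := by rwa [mul_one]

theorem exists_lifespan_eq_top {γ : ℝ} {φ ψ : ℝ → ℝ} (hγ : -1 ≤ γ) (hγ0 : γ ≠ 0) (hmu : 0 ≤ mu)
    (hlam : 0 ≤ lam) (hφ : IsC1b φ) (hψ : IsC1b ψ) :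
    ∃ ε₀ : ℝ, 0 < ε₀ ∧ ∀ ε, 0 < ε → ε ≤ ε₀ →
      lifespan γ mu lam (fun x => 1 + ε * φ x) (fun x => ε * ψ x) = ⊤ := by
  obtain ⟨κ, ε₁, hκ, hε₁, criterion⟩ := exists_lifespan_criterion hγ hγ0 hmu hlam hφ hψ
  have c_nonneg := h.c_nonneg
  have σ_pos := h.σ_pos
  have r_zero_pos := h.pos 0 le_rfl
  obtain ⟨k, hk, hkσ, hk_zero⟩ : ∃ k, 0 < k ∧ κ * c + 1 ≤ k * σ ∧ κ < k * r 0 := by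
    refine ⟨max ((κ * c + 1) / σ) ((κ + 1) / r 0), by positivity, ?_, ?_⟩
    · rw [← div_le_iff₀ σ_pos]
      exact le_max_left _ _
    · exact (lt_add_one κ).trans_le ((div_le_iff₀ r_zero_pos).1 (le_max_right _ _))
  refine ⟨min ε₁ (min (1 / (2 * (κ * (k + κ * c)))) (1 / (κ * (k + κ * c) ^ 2))), by positivity,
    fun ε hε hε_le => ?_⟩
  obtain ⟨hε_le₁, hε_le₂, hε_le₃⟩ := by simpa only [le_min_iff] using hε_le
  rw [le_div_iff₀ (by positivity)] at hε_le₂ hε_le₃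
  refine (EReal.eq_top_iff_forall_lt _).2 fun y => ?_
  refine (EReal.coe_lt_coe_iff.2 ((le_max_left y 0).trans_lt (lt_add_one _))).trans_le ?_
  exact criterion ε hε hε_le₁ _ (by positivity) _ _
    (h.riccatiSupersolution _ hlam hκ hε hk hkσ hk_zero hε_le₃ (by linarith))

end DecayRate

end DecayRate

section Rates

variable {mu lam b t : ℝ}

theorem one_add_rpow_mul (r s : ℝ) (ht : 0 ≤ t) : (1 + t) ^ r * (1 + t) ^ s = (1 + t) ^ (r + s) :=
  (Real.rpow_add (by linarith) r s).symm

theorem damp_sq (ht : 0 ≤ t) : damp mu lam t ^ 2 = lam ^ 2 * (1 + t) ^ (-(2 * mu)) := by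
  rw [damp, mul_pow, sq ((1 + t) ^ (-mu)), one_add_rpow_mul _ _ ht]
  ring_nf

theorem abs_dampDefect_le (hmu : 0 ≤ mu) (hlam : 0 ≤ lam) {r : ℝ} (ht : 0 ≤ t)
    (h_sq : -(2 * mu) ≤ r) (h_deriv : -mu - 1 ≤ r) :
    |dampDefect mu lam t| ≤ (lam ^ 2 / 4 + lam * mu / 2) * (1 + t) ^ r := by
  have one_le : 1 ≤ 1 + t := by linarith
  rw [dampDefect, damp_sq ht, dampDeriv]
  refine (abs_add_le _ _).trans ?_
  rw [abs_of_nonneg (by positivity), abs_div, abs_neg, abs_of_nonneg (by positivity), abs_two]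
  calc _ = lam ^ 2 / 4 * (1 + t) ^ (-(2 * mu)) + lam * mu / 2 * (1 + t) ^ (-mu - 1) := by ring
    _ ≤ lam ^ 2 / 4 * (1 + t) ^ r + lam * mu / 2 * (1 + t) ^ r := by gcongr
    _ = _ := by ring

theorem dampDefect_one (ht : 0 ≤ t) :
    dampDefect 1 lam t = (lam ^ 2 / 4 - lam / 2) * (1 + t) ^ (-2 : ℝ) := by
  rw [dampDefect, damp_sq ht, dampDeriv]
  norm_num
  ring

theorem hasDerivAt_mul_one_sub_rpow_neg {G δ : ℝ} (hδ : δ ≠ 0) (ht : 0 ≤ t) :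
    HasDerivAt (fun s => G / δ * (1 - (1 + s) ^ (-δ))) (G * (1 + t) ^ (-δ - 1)) t := by
  refine (((hasDerivAt_add_rpow (by linarith)).const_sub 1).const_mul _).congr_deriv ?_
  field_simp

theorem mul_one_sub_rpow_neg_mem_Icc {G δ : ℝ} (hG : 0 ≤ G) (hδ : 0 < δ) (ht : 0 ≤ t) :
    G / δ * (1 - (1 + t) ^ (-δ)) ∈ Icc 0 (G / δ) := by
  have le_one := one_add_rpow_neg_le_one hδ.le ht
  have rpow_nonneg : 0 ≤ (1 + t) ^ (-δ) := by positivity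
  have div_nonneg : 0 ≤ G / δ := by positivity
  exact ⟨mul_nonneg div_nonneg (by linarith), mul_le_of_le_one_right div_nonneg (by linarith)⟩

theorem growthFactor_of_one_lt (hmu : 1 < mu) (hlam : 0 ≤ lam) :
    GrowthFactor mu lam lam ((lam ^ 2 / 4 + lam * mu / 2) / (mu - 1)) (fun _ => 1) (fun _ => 0)
      (fun t => t) (fun _ => 1)
      (fun t => (lam ^ 2 / 4 + lam * mu / 2) / (mu - 1) * (1 - (1 + t) ^ (-(mu - 1))))
      fun t => (lam ^ 2 / 4 + lam * mu / 2) * (1 + t) ^ (-(mu - 1) - 1) where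
  c_nonneg := hlam
  K_nonneg := div_nonneg (by positivity) (by linarith)
  hasDerivAt_E t _ := hasDerivAt_const t _
  hasDerivAt_F t _ := hasDerivAt_id t
  hasDerivAt_f t ht := hasDerivAt_mul_one_sub_rpow_neg (by linarith) ht
  E_zero := rfl
  one_le_E _ _ := le_rfl
  E'_le t ht := mul_nonneg (div_nonneg (damp_nonneg hlam ht) zero_le_two) zero_le_one
  damp_mul_le t ht := (mul_one _).trans_le (damp_le (by linarith) hlam ht)
  F_nonneg _ ht := ht
  inv_le_F' _ _ := inv_one.le
  f_mem t ht := mul_one_sub_rpow_neg_mem_Icc (by positivity) (by linarith) ht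
  mul_defect_le_f' t ht := by
    rw [one_mul]
    exact abs_dampDefect_le (by linarith) hlam ht (by linarith) (by linarith)

theorem growthFactor_one_of_lt_two (hlam : 0 ≤ lam) {δ : ℝ} (hδ : 0 < δ) (hlamδ : lam / 2 = 1 - δ) :
    GrowthFactor 1 lam lam (|lam ^ 2 / 4 - lam / 2| / δ) (fun t => (1 + t) ^ (lam / 2))
      (fun t => lam / 2 * (1 + t) ^ (lam / 2 - 1)) (fun t => (1 + t) ^ δ / δ)
      (fun t => (1 + t) ^ (δ - 1))
      (fun t => |lam ^ 2 / 4 - lam / 2| / δ * (1 - (1 + t) ^ (-δ)))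
      fun t => |lam ^ 2 / 4 - lam / 2| * (1 + t) ^ (-δ - 1) where
  c_nonneg := hlam
  K_nonneg := by positivity
  hasDerivAt_E t ht := hasDerivAt_add_rpow (by linarith)
  hasDerivAt_F t ht := by
    refine ((hasDerivAt_add_rpow (by linarith)).div_const _).congr_deriv ?_
    field_simp
  hasDerivAt_f t ht := hasDerivAt_mul_one_sub_rpow_neg hδ.ne' ht
  E_zero := by simp
  one_le_E t ht := Real.one_le_rpow (by linarith) (by linarith)
  E'_le t ht := by
    rw [damp, mul_div_right_comm, mul_assoc, one_add_rpow_mul _ _ ht, neg_add_eq_sub]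
  damp_mul_le t ht := by
    have exponent_eq : -1 + lam / 2 = -δ := by linarith
    rw [damp, mul_assoc, one_add_rpow_mul _ _ ht, exponent_eq]
    exact mul_le_of_le_one_right hlam (one_add_rpow_neg_le_one hδ.le ht)
  F_nonneg t ht := by positivity
  inv_le_F' t ht := by
    rw [← Real.rpow_neg (by linarith), hlamδ, neg_sub]
  f_mem t ht := mul_one_sub_rpow_neg_mem_Icc (abs_nonneg _) hδ ht
  mul_defect_le_f' t ht := by
    have exponent_eq : lam / 2 + -2 = -δ - 1 := by linarith
    rw [dampDefect_one ht, abs_mul, abs_of_nonneg (by positivity : 0 ≤ (1 + t) ^ (-2 : ℝ)),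
      mul_left_comm, one_add_rpow_mul _ _ ht, exponent_eq]

theorem growthFactor_one_two : GrowthFactor 1 2 2 0 (fun t => 1 + t) (fun _ => 1)
    (fun t => Real.log (1 + t)) (fun t => (1 + t)⁻¹) (fun _ => 0) fun _ => 0 where
  c_nonneg := zero_le_two
  K_nonneg := le_rfl
  hasDerivAt_E t _ := (hasDerivAt_id t).const_add 1
  hasDerivAt_F t ht := by
    simpa using ((hasDerivAt_id t).const_add 1).log (by simp only [id]; positivity)
  hasDerivAt_f t _ := hasDerivAt_const t _
  E_zero := add_zero 1
  one_le_E t ht := le_add_of_nonneg_right ht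
  E'_le t ht := by
    rw [damp, Real.rpow_neg_one]
    field_simp
    exact le_rfl
  damp_mul_le t ht := by
    rw [damp, Real.rpow_neg_one, inv_mul_cancel_right₀ (by positivity)]
  F_nonneg t ht := Real.log_nonneg (by linarith)
  inv_le_F' _ _ := le_rfl
  f_mem _ _ := ⟨le_rfl, le_rfl⟩
  mul_defect_le_f' t ht := by
    rw [dampDefect_one ht]
    norm_num

theorem one_add_rpow_neg_le_mul (hmu : 0 ≤ mu) (hb : 1 ≤ b) (ht : 0 ≤ t) :
    (1 + t) ^ (-mu) ≤ b ^ mu * (b + t) ^ (-mu) := by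
  have b_pos : 0 < b := by linarith
  rw [Real.rpow_neg (by positivity), Real.rpow_neg (by positivity), ← div_eq_mul_inv,
    inv_le_comm₀ (by positivity) (by positivity), inv_div, div_le_iff₀ (by positivity),
    ← Real.mul_rpow (by positivity) b_pos.le]
  exact Real.rpow_le_rpow (by positivity) (by nlinarith) hmu

theorem add_rpow_neg_le (hmu : 0 ≤ mu) (hb : 1 ≤ b) (ht : 0 ≤ t) :
    (b + t) ^ (-mu) ≤ (1 + t) ^ (-mu) :=
  Real.rpow_le_rpow_of_nonpos (by linarith) (by linarith) (by linarith)

theorem riccati_add_rpow_neg (hmu : 0 ≤ mu) (hmu1 : mu ≤ 1) (hlam : 0 ≤ lam) (hb : 1 ≤ b)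
    (ht : 0 ≤ t) : (lam / 2 - mu * b ^ (mu - 1)) * ((b + t) ^ (-mu)) ^ 2
      ≤ -mu * (b + t) ^ (-mu - 1) + damp mu lam t / 2 * (b + t) ^ (-mu) := by
  have rpow_deriv_le : (b + t) ^ (-mu - 1) ≤ b ^ (mu - 1) * ((b + t) ^ (-mu)) ^ 2 :=
    calc (b + t) ^ (-mu - 1) = (b + t) ^ (mu - 1) * ((b + t) ^ (-mu)) ^ 2 := by
          rw [sq, ← Real.rpow_add (by linarith), ← Real.rpow_add (by linarith)]
          ring_nf
      _ ≤ b ^ (mu - 1) * ((b + t) ^ (-mu)) ^ 2 := by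
          gcongr ?_ * _
          exact Real.rpow_le_rpow_of_nonpos (by linarith) (by linarith) (by linarith)
  have damp_mul_le : lam / 2 * (b + t) ^ (-mu) * (b + t) ^ (-mu)
      ≤ damp mu lam t / 2 * (b + t) ^ (-mu) := by
    rw [damp, mul_div_right_comm]
    gcongr ?_ * ?_ * _
    exact add_rpow_neg_le hmu hb ht
  linarith [mul_le_mul_of_nonneg_left rpow_deriv_le hmu]

theorem decayRate_add_rpow_neg (hmu : 0 ≤ mu) (hmu1 : mu ≤ 1) (hlam : 0 ≤ lam) (hb : 1 ≤ b)
    (hb_lam : mu * b ^ (mu - 1) < lam / 2) :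
    DecayRate mu lam (lam * b ^ mu + (lam ^ 2 / 4 + lam * mu / 2) * (b ^ mu) ^ 2)
      (lam / 2 - mu * b ^ (mu - 1)) (fun t => (b + t) ^ (-mu))
      fun t => -mu * (b + t) ^ (-mu - 1) where
  c_nonneg := by positivity
  σ_pos := sub_pos.2 hb_lam
  hasDerivAt t ht := hasDerivAt_add_rpow (by linarith)
  pos t ht := Real.rpow_pos_of_pos (by linarith) _
  le_one t ht := (add_rpow_neg_le hmu hb ht).trans (one_add_rpow_neg_le_one hmu ht)
  riccati t ht := riccati_add_rpow_neg hmu hmu1 hlam hb ht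
  damp_le t ht :=
    calc damp mu lam t ≤ lam * (b ^ mu * (b + t) ^ (-mu)) :=
          mul_le_mul_of_nonneg_left (one_add_rpow_neg_le_mul hmu hb ht) hlam
      _ = lam * b ^ mu * (b + t) ^ (-mu) := by ring
      _ ≤ _ := by
          gcongr
          exact le_add_of_nonneg_right (by positivity)
  defect_le t ht :=
    calc |dampDefect mu lam t| ≤ (lam ^ 2 / 4 + lam * mu / 2) * (1 + t) ^ (-(2 * mu)) :=
          abs_dampDefect_le hmu hlam ht le_rfl (by linarith)
      _ = (lam ^ 2 / 4 + lam * mu / 2) * ((1 + t) ^ (-mu)) ^ 2 := by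
          rw [sq ((1 + t) ^ (-mu)), one_add_rpow_mul _ _ ht]
          ring_nf
      _ ≤ (lam ^ 2 / 4 + lam * mu / 2) * (b ^ mu * (b + t) ^ (-mu)) ^ 2 := by
          gcongr
          exact one_add_rpow_neg_le_mul hmu hb ht
      _ = (lam ^ 2 / 4 + lam * mu / 2) * (b ^ mu) ^ 2 * ((b + t) ^ (-mu)) ^ 2 := by ring
      _ ≤ _ := by
          gcongr
          exact le_add_of_nonneg_left (by positivity)

theorem exists_one_le_mul_rpow_lt (h : (mu < 1 ∧ 0 < lam) ∨ (mu = 1 ∧ 2 < lam)) :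
    ∃ b : ℝ, 1 ≤ b ∧ mu * b ^ (mu - 1) < lam / 2 := by
  rcases h with ⟨hmu, hlam⟩ | ⟨rfl, hlam⟩
  · have tendsto_zero : Tendsto (fun b : ℝ => mu * b ^ (-(1 - mu))) atTop (𝓝 (mu * 0)) :=
      (tendsto_rpow_neg_atTop (by linarith)).const_mul mu
    rw [mul_zero, neg_sub] at tendsto_zero
    exact ((eventually_ge_atTop 1).and
      (tendsto_zero.eventually (gt_mem_nhds (half_pos hlam)))).exists
  · refine ⟨1, le_rfl, ?_⟩
    rw [Real.one_rpow]
    linarith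

end Rates

section Lifespan

variable {γ mu lam : ℝ} {φ ψ : ℝ → ℝ}

theorem le_lifespan_of_one_lt (hγ : -1 ≤ γ) (hγ0 : γ ≠ 0) (hmu : 1 < mu) (hlam : 0 ≤ lam)
    (hφ : IsC1b φ) (hψ : IsC1b ψ) :
    ∃ ε₀ : ℝ, 0 < ε₀ ∧ ∃ C : ℝ, 0 < C ∧ ∀ ε, 0 < ε → ε ≤ ε₀ → ((C * ε⁻¹ : ℝ) : EReal) ≤
      lifespan γ mu lam (fun x => 1 + ε * φ x) (fun x => ε * ψ x) := by
  obtain ⟨ε₀, C, hε₀, hC, le_lifespan⟩ :=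
    (growthFactor_of_one_lt hmu hlam).exists_le_lifespan hγ hγ0 (by linarith) hlam hφ hψ
  refine ⟨ε₀, hε₀, C, hC, fun ε hε hε_le =>
    le_lifespan ε hε hε_le _ (by positivity) fun t ht => ?_⟩
  rw [← le_div_iff₀' hε, div_eq_mul_inv]
  exact ht.2

theorem le_lifespan_one_of_lt_two (hγ : -1 ≤ γ) (hγ0 : γ ≠ 0) (hlam : 0 ≤ lam) (hlam2 : lam < 2)
    (hφ : IsC1b φ) (hψ : IsC1b ψ) :
    ∃ ε₀ : ℝ, 0 < ε₀ ∧ ∃ C : ℝ, 0 < C ∧ ∀ ε, 0 < ε → ε ≤ ε₀ →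
      ((C * ε ^ (-(2 / (2 - lam))) : ℝ) : EReal) ≤
        lifespan γ 1 lam (fun x => 1 + ε * φ x) (fun x => ε * ψ x) := by
  obtain ⟨δ, hδ⟩ : ∃ δ, δ = 1 - lam / 2 := ⟨_, rfl⟩
  have δ_pos : 0 < δ := by linarith
  obtain ⟨ε₀, C, hε₀, hC, le_lifespan⟩ := (growthFactor_one_of_lt_two hlam δ_pos
    (by linarith)).exists_le_lifespan hγ hγ0 zero_le_one hlam hφ hψ
  obtain ⟨c, hc⟩ : ∃ c, c = C * δ / 2 := ⟨_, rfl⟩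
  have c_pos : 0 < c := by rw [hc]; positivity
  have exponent_eq : -(2 / (2 - lam)) * δ = -1 := by
    have : 2 - lam ≠ 0 := by linarith
    rw [hδ]
    field_simp
  refine ⟨min ε₀ c, by positivity, c ^ (1 / δ), by positivity, fun ε hε hε_le => ?_⟩
  obtain ⟨hε_le₁, hε_le₂⟩ := le_min_iff.1 hε_le
  refine le_lifespan ε hε hε_le₁ _ (by positivity) fun t ht => ?_
  have one_add_rpow_le : (1 + t) ^ δ ≤ 1 + c * ε⁻¹ :=
    calc (1 + t) ^ δ ≤ 1 ^ δ + t ^ δ :=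
          Real.rpow_add_le_add_rpow zero_le_one ht.1 δ_pos.le (by linarith)
      _ ≤ 1 ^ δ + (c ^ (1 / δ) * ε ^ (-(2 / (2 - lam)))) ^ δ := by
          gcongr
          exacts [ht.1, ht.2]
      _ = 1 + c * ε⁻¹ := by
          rw [Real.one_rpow, Real.mul_rpow (by positivity) (by positivity),
            ← Real.rpow_mul c_pos.le, ← Real.rpow_mul hε.le, one_div_mul_cancel δ_pos.ne',
            Real.rpow_one, exponent_eq, Real.rpow_neg_one]
  rw [← mul_div_assoc, div_le_iff₀ δ_pos]
  calc ε * (1 + t) ^ δ ≤ ε * (1 + c * ε⁻¹) := by gcongr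
    _ = ε + c := by field_simp
    _ ≤ C * δ := by linarith

theorem le_lifespan_one_two (hγ : -1 ≤ γ) (hγ0 : γ ≠ 0) (hφ : IsC1b φ) (hψ : IsC1b ψ) :
    ∃ ε₀ : ℝ, 0 < ε₀ ∧ ∃ C : ℝ, 0 < C ∧ ∀ ε, 0 < ε → ε ≤ ε₀ →
      ((Real.exp (C / ε) : ℝ) : EReal) ≤
        lifespan γ 1 2 (fun x => 1 + ε * φ x) (fun x => ε * ψ x) := by
  obtain ⟨ε₀, C, hε₀, hC, le_lifespan⟩ :=
    growthFactor_one_two.exists_le_lifespan hγ hγ0 zero_le_one zero_le_two hφ hψ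
  refine ⟨min ε₀ (C / 2), by positivity, C / 2, by positivity, fun ε hε hε_le => ?_⟩
  obtain ⟨hε_le₁, hε_le₂⟩ := le_min_iff.1 hε_le
  refine le_lifespan ε hε hε_le₁ _ (Real.exp_pos _) fun t ht => ?_
  have log_le : Real.log (1 + t) ≤ 1 + C / 2 / ε := by
    rw [Real.log_le_iff_le_exp (by linarith [ht.1]), Real.exp_add]
    have two_le_exp : 2 ≤ Real.exp 1 := by linarith [Real.add_one_le_exp (1 : ℝ)]
    have one_le_exp : 1 ≤ Real.exp (C / 2 / ε) := Real.one_le_exp (by positivity)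
    nlinarith [ht.2]
  calc ε * Real.log (1 + t) ≤ ε * (1 + C / 2 / ε) := by gcongr
    _ = ε + C / 2 := by field_simp
    _ ≤ C := by linarith

theorem exists_lifespan_eq_top (hγ : -1 ≤ γ) (hγ0 : γ ≠ 0) (hmu : 0 ≤ mu)
    (h : (mu < 1 ∧ 0 < lam) ∨ (mu = 1 ∧ 2 < lam)) (hφ : IsC1b φ) (hψ : IsC1b ψ) :
    ∃ ε₀ : ℝ, 0 < ε₀ ∧ ∀ ε, 0 < ε → ε ≤ ε₀ →
      lifespan γ mu lam (fun x => 1 + ε * φ x) (fun x => ε * ψ x) = ⊤ := by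
  obtain ⟨b, hb, hb_lam⟩ := exists_one_le_mul_rpow_lt h
  have mu_le : mu ≤ 1 := by rcases h with h | h <;> linarith [h.1]
  have lam_nonneg : 0 ≤ lam := by rcases h with h | h <;> linarith [h.2]
  exact (decayRate_add_rpow_neg hmu mu_le lam_nonneg hb hb_lam).exists_lifespan_eq_top hγ hγ0 hmu
    lam_nonneg hφ hψ

end Lifespan

end

end DampedEuler

theorem theorem2p4_general (γ mu lam : ℝ) (hγ : -1 ≤ γ) (hγ0 : γ ≠ 0) (hmu : 0 ≤ mu)
    (hlam : 0 ≤ lam) (φ ψ : ℝ → ℝ) (hφ : DampedEuler.IsC1b φ) (hψ : DampedEuler.IsC1b ψ) :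
    ∃ ε₀ : ℝ, 0 < ε₀ ∧ ∃ C : ℝ, 0 < C ∧ ∀ ε : ℝ, 0 < ε → ε ≤ ε₀ →
      (1 < mu →
        ((C * ε⁻¹ : ℝ) : EReal) ≤
          DampedEuler.lifespan γ mu lam (fun x => 1 + ε * φ x) (fun x => ε * ψ x)) ∧
      (mu = 1 → lam < 2 →
        ((C * ε ^ (-(2 / (2 - lam))) : ℝ) : EReal) ≤
          DampedEuler.lifespan γ mu lam (fun x => 1 + ε * φ x) (fun x => ε * ψ x)) ∧
      (mu = 1 → lam = 2 →
        ((Real.exp (C / ε) : ℝ) : EReal) ≤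
          DampedEuler.lifespan γ mu lam (fun x => 1 + ε * φ x) (fun x => ε * ψ x)) ∧
      ((mu < 1 ∧ 0 < lam) ∨ (mu = 1 ∧ 2 < lam) →
        DampedEuler.lifespan γ mu lam (fun x => 1 + ε * φ x) (fun x => ε * ψ x) = ⊤) := by
  by_cases global : (mu < 1 ∧ 0 < lam) ∨ (mu = 1 ∧ 2 < lam)
  · obtain ⟨ε₀, hε₀, lifespan_eq⟩ :=
      DampedEuler.exists_lifespan_eq_top hγ hγ0 hmu global hφ hψ
    exact ⟨ε₀, hε₀, 1, one_pos, fun ε hε hεε₀ => by simp [lifespan_eq ε hε hεε₀]⟩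
  rcases lt_trichotomy mu 1 with hmu1 | rfl | hmu1
  · exact ⟨1, one_pos, 1, one_pos, fun _ _ _ => ⟨fun h => absurd h hmu1.not_gt,
      fun h => absurd h hmu1.ne, fun h => absurd h hmu1.ne, fun h => absurd h global⟩⟩
  · rcases lt_trichotomy lam 2 with hlam2 | rfl | hlam2
    · obtain ⟨ε₀, hε₀, C, hC, le_lifespan⟩ :=
        DampedEuler.le_lifespan_one_of_lt_two hγ hγ0 hlam hlam2 hφ hψ
      exact ⟨ε₀, hε₀, C, hC, fun ε hε hεε₀ => ⟨fun h => absurd h (lt_irrefl _),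
        fun _ _ => le_lifespan ε hε hεε₀, fun _ h => absurd h hlam2.ne, fun h => absurd h global⟩⟩
    · obtain ⟨ε₀, hε₀, C, hC, le_lifespan⟩ := DampedEuler.le_lifespan_one_two hγ hγ0 hφ hψ
      exact ⟨ε₀, hε₀, C, hC, fun ε hε hεε₀ => ⟨fun h => absurd h (lt_irrefl _),
        fun _ h => absurd h (lt_irrefl _), fun _ _ => le_lifespan ε hε hεε₀,
        fun h => absurd h global⟩⟩
    · exact absurd (Or.inr ⟨rfl, hlam2⟩) global
  · obtain ⟨ε₀, hε₀, C, hC, le_lifespan⟩ :=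
      DampedEuler.le_lifespan_of_one_lt hγ hγ0 hmu1 hlam hφ hψ
    exact ⟨ε₀, hε₀, C, hC, fun ε hε hεε₀ => ⟨fun _ => le_lifespan ε hε hεε₀,
      fun h => absurd h hmu1.ne', fun h => absurd h hmu1.ne', fun h => absurd h global⟩⟩

theorem theorem2p4 (γ mu lam : ℝ) (hγ : 1 < γ) (hmu : 0 ≤ mu) (hlam : 0 ≤ lam)
    (φ ψ : ℝ → ℝ) (hφ : DampedEuler.IsC1b φ) (hψ : DampedEuler.IsC1b ψ)
    (φm ψm : ℝ) (hφm : Tendsto φ atBot (𝓝 φm)) (hψm : Tendsto ψ atBot (𝓝 ψm)) :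
    ∃ ε₀ : ℝ, 0 < ε₀ ∧ ∃ C : ℝ, 0 < C ∧ ∀ ε : ℝ, 0 < ε → ε ≤ ε₀ →
      (1 < mu →
        ((C * ε⁻¹ : ℝ) : EReal) ≤
          DampedEuler.lifespan γ mu lam (fun x => 1 + ε * φ x) (fun x => ε * ψ x)) ∧
      (mu = 1 → lam < 2 →
        ((C * ε ^ (-(2 / (2 - lam))) : ℝ) : EReal) ≤
          DampedEuler.lifespan γ mu lam (fun x => 1 + ε * φ x) (fun x => ε * ψ x)) ∧
      (mu = 1 → lam = 2 →
        ((Real.exp (C / ε) : ℝ) : EReal) ≤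
          DampedEuler.lifespan γ mu lam (fun x => 1 + ε * φ x) (fun x => ε * ψ x)) ∧
      ((mu < 1 ∧ 0 < lam) ∨ (mu = 1 ∧ 2 < lam) →
        DampedEuler.lifespan γ mu lam (fun x => 1 + ε * φ x) (fun x => ε * ψ x) = ⊤) := by
  exact theorem2p4_general γ mu lam (by linarith) (zero_lt_one.trans hγ).ne' hmu hlam φ ψ hφ hψ
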